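/- **Conventions.** All vector spaces are complex and finite-dimensional. A partition is a weakly decreasing sequence $p_1\ge p_2\ge\cdots$ of nonnegative integers that is eventually $0$ (trailing zeros may be omitted), and $|p|=\sum_j p_j$. For $k\le n$, it is a partition for $\mathrm{Gr}(k,n)$ if $p_1\le n-k$ and $p_{k+1}=0$. A Schubert problem in $\mathrm{Gr}(k,n)$ is a list $(\lambda^1,\dots,\lambda^s)$ of partitions for $\mathrm{Gr}(k,n)$ (some of them may be $0$) with $|\lambda^1|+\dots+|\lambda^s|=k(n-k)$. For a complete flag $F_\bullet$ in an $n$-dimensional space $E$, let $\Omega_pF_\bullet$ be the set of $k$-dimensional subspaces $H\subset E$ with $\dim(H\cap F_{n-k+j-p_j})\ge j$ for $j=1,\dots,k$. An instance of $\boldsymbol\lambda$ in $\mathrm{Gr}(k,E)$ is an $s$-tuple $\mathcal F=(F^1_\bullet,\dots,F^s_\bullet)$ of complete flags in $E$, with set of solutions $\Omega_{\boldsymbol\lambda}\mathcal F=\bigcap_i\Omega_{\lambda^i}F^i_\bullet$. A property holds for general instances if it holds on a dense Zariski-open set of tuples of flags. Write $c^r$ for the partition with $r$ parts equal to $c$,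 $p+q$ for the componentwise sum, $(c^r,p)$ for the partition with $r$ parts $c$ followed by the parts of $p$ (where $c\ge p_1$), and $\square=(1)$. **Fibrations.** Let $\boldsymbol\lambda$, $\boldsymbol\mu$, $\boldsymbol\nu$ be Schubert problems in $\mathrm{Gr}(k+a,n+b)$, $\mathrm{Gr}(k,n)$, $\mathrm{Gr}(a,b)$. Then $\boldsymbol\lambda$ is *fibered over* $\boldsymbol\mu$ *with fiber* $\boldsymbol\nu$ if there are a dense Zariski-open set $U$ of instances of $\boldsymbol\lambda$ in $\mathrm{Gr}(k+a,\mathbb C^{n+b})$ and a construction that assigns to each $\mathcal F\in U$ an $n$-dimensional subspace $V\subset\mathbb C^{n+b}$, an instance $\mathcal E$ of $\boldsymbol\mu$ in $\mathrm{Gr}(k,V)$, and, for each $h\in\Omega_{\boldsymbol\mu}\mathcal E$, an instance $\mathcal G(h)$ of $\boldsymbol\nu$ in $\mathrm{Gr}(a,W)$, where $W=\mathbb C^{n+b}/V$, such that: 1. for every $\mathcal F\in U$ and $H\in\Omega_{\boldsymbol\lambda}\mathcal F$, $H\cap V\in\Omega_{\boldsymbol\mu}\mathcal E$; 2. for every $\mathcal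 F\in U$, $h\in\Omega_{\boldsymbol\mu}\mathcal E$ and $H\in\Omega_{\boldsymbol\lambda}\mathcal F$ with $H\cap V=h$, the image $H/h$ of $H$ in $W$ lies in $\Omega_{\boldsymbol\nu}\mathcal G(h)$; 3. for every $\mathcal F\in U$, the map $H\mapsto(H\cap V,\,H/(H\cap V))$ is a bijection from $\Omega_{\boldsymbol\lambda}\mathcal F$ to $\{(h,K): h\in\Omega_{\boldsymbol\mu}\mathcal E,\ K\in\Omega_{\boldsymbol\nu}\mathcal G(h)\}$; 4. for every $n$-dimensional $V\subset\mathbb C^{n+b}$, every general instance $\mathcal E$ of $\boldsymbol\mu$ in $\mathrm{Gr}(k,V)$ arises together with $V$ from some $\mathcal F\in U$; moreover, for general $\mathcal E$ and each $h\in\Omega_{\boldsymbol\mu}\mathcal E$, every general instance of $\boldsymbol\nu$ in $\mathrm{Gr}(a,\mathbb C^{n+b}/V)$ arises as $\mathcal G(h)$ from some $\mathcal F\in U$ that induces $V$ and $\mathcal E$. **Theorem 3.7.** Let $0<a<b$ and $s\ge 4$ be integers, let $\kappa,\rho$ be partitions with $\kappa_1\le b-a-1$ and $\rho_a=0$, and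 suppose that $$\boldsymbol\nu=\bigl((b-a-1,\kappa),\,1^{a-1}+\rho,\,\nu^3,\nu^4,\dots,\nu^s\bigr)$$ is a Schubert problem in $\mathrm{Gr}(a,b)$. Then $$\boldsymbol\lambda=\bigl((b-a,b-a,\kappa),\,2^a+\rho,\,(b-a+1,\nu^3),\,1^{a+1}+\nu^4,\,\nu^5,\dots,\nu^s\bigr)$$ is a Schubert problem in $\mathrm{Gr}(2+a,4+b)$, and it is fibered over the Schubert problem $\square^4=(\square,\square,\square,\square)$ in $\mathrm{Gr}(2,4)$ with fiber $\boldsymbol\nu$. -/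

import Mathlib

open Module

noncomputable section

/-- A partition `p₁ ≥ p₂ ≥ ⋯`, with trailing zeros; the part `pⱼ` is `p (j - 1)`. -/
def IsPartition (p : ℕ → ℕ) : Prop :=
  Antitone p ∧ ∃ r, p r = 0

/-- `p` is a partition for `Gr(k,n)`: `p₁ ≤ n - k` and `p_{k+1} = 0`. -/
def IsPartitionFor (k n : ℕ) (p : ℕ → ℕ) : Prop :=
  Antitone p ∧ p 0 ≤ n - k ∧ p k = 0

/-- The partition `c^r` with `r` parts equal to `c`. -/
def rect (r c : ℕ) : ℕ → ℕ :=
  fun i => if i < r then c else 0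

/-- The partition `(c^r, p)`: `r` rows of length `c`, followed by the rows of `p`.
It is only used for `p₁ ≤ c`, where it is the decreasing rearrangement of the parts. -/
def prependRows (r c : ℕ) (p : ℕ → ℕ) : ℕ → ℕ :=
  fun i => if i < r then c else p (i - r)

/-- A Schubert problem in `Gr(k,n)`: a list of partitions for `Gr(k,n)` whose total size is
`k(n-k) = dim Gr(k,n)`. -/
def IsSchubertProblem (k n : ℕ) {s : ℕ} (lam : Fin s → ℕ → ℕ) : Prop :=
  k ≤ n ∧ (∀ i, IsPartitionFor k n (lam i)) ∧
    k * (n - k) = ∑ i, ∑ j ∈ Finset.range k, lam i j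

/-- A complete flag `0 = F₀ ⊂ F₁ ⊂ ⋯ ⊂ Fₙ = E` in an `n`-dimensional complex vector space `E`,
continued by `Fⱼ = E` for `j > n`. -/
@[ext]
structure CompleteFlag (E : Type*) [AddCommGroup E] [Module ℂ E] [FiniteDimensional ℂ E] where
  space : ℕ → Submodule ℂ E
  mono : Monotone space
  finrank_space : ∀ j, finrank ℂ (space j) = min j (finrank ℂ E)

section Flags

variable {E : Type*} [AddCommGroup E] [Module ℂ E] [FiniteDimensional ℂ E]

/-- The flag whose `j`-th space is spanned by the first `j` vectors of a basis. -/
def CompleteFlag.ofBasis (e : Basis (Fin (finrank ℂ E)) ℂ E) : CompleteFlag E where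
  space j := Submodule.span ℂ (e '' {i | (i : ℕ) < j})
  mono := fun _ _ h => Submodule.span_mono (Set.image_mono fun _ hi => lt_of_lt_of_le hi h)
  finrank_space j := by
    classical
    have h := finrank_span_set_eq_card
      (s := e '' {i : Fin (finrank ℂ E) | (i : ℕ) < j})
      ((e.linearIndependent.comp (Subtype.val : {i : Fin (finrank ℂ E) | (i : ℕ) < j} → _)
        Subtype.val_injective).linearIndepOn_id' (by
          rw [Set.range_comp, Subtype.range_coe]))
    rw [h, Set.toFinset_card, ← Nat.card_eq_fintype_card,
      Nat.card_image_of_injective e.injective, Nat.card_eq_fintype_card]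
    have h2 := Fintype.card_subtype (fun i : Fin (finrank ℂ E) => (i : ℕ) < j)
    rw [Fin.card_filter_val_lt, min_comm] at h2
    exact h2

/-- The matrix entries of a tuple of bases of `E`, with respect to a fixed basis of `E`. -/
def frameCoords {s : ℕ} (e : Fin s → Basis (Fin (finrank ℂ E)) ℂ E) :
    Fin s × Fin (finrank ℂ E) × Fin (finrank ℂ E) → ℂ :=
  fun x => (finBasis ℂ E).repr (e x.1 x.2.1) x.2.2

/-- Zariski open sets of `s`-tuples of complete flags in `E`. The variety of such tuples is the
quotient of the space `GL(E)^s` of `s`-tuples of bases, with the quotient topology, so a set is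
open if and only if its preimage is a union of basic open sets `{p ≠ 0}` with `p` a polynomial in
the matrix entries. As this variety is irreducible, its dense open sets are the nonempty ones. -/
def IsZariskiOpen {s : ℕ} (U : Set (Fin s → CompleteFlag E)) : Prop :=
  ∀ e : Fin s → Basis (Fin (finrank ℂ E)) ℂ E, (fun i => CompleteFlag.ofBasis (e i)) ∈ U →
    ∃ p : MvPolynomial (Fin s × Fin (finrank ℂ E) × Fin (finrank ℂ E)) ℂ,
      MvPolynomial.eval (frameCoords e) p ≠ 0 ∧
      ∀ e' : Fin s → Basis (Fin (finrank ℂ E)) ℂ E,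
        MvPolynomial.eval (frameCoords e') p ≠ 0 → (fun i => CompleteFlag.ofBasis (e' i)) ∈ U

/-- The Schubert variety of the `k`-planes `H` in the `n`-dimensional space `E` with
`dim (H ∩ F_{n-k+j-λⱼ}) ≥ j` for `j = 1, …, k`. -/
def schubertVariety (k : ℕ) (p : ℕ → ℕ) (F : CompleteFlag E) : Set (Submodule ℂ E) :=
  {H | finrank ℂ H = k ∧ ∀ j < k,
    j + 1 ≤ finrank ℂ ↥(H ⊓ F.space (finrank ℂ E - k + (j + 1) - p j))}

/-- The set of solutions of the instance `F` of a Schubert problem in `Gr(k,E)`. -/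
def solutions (k : ℕ) {s : ℕ} (lam : Fin s → ℕ → ℕ) (F : Fin s → CompleteFlag E) :
    Set (Submodule ℂ E) :=
  {H | finrank ℂ H = k ∧ ∀ i, H ∈ schubertVariety k (lam i) (F i)}

end Flags

/-- What a fibration attaches to a tuple of flags in `E`: a subspace `V`, a tuple of flags in `V`,
and, for each subspace `h` of `V`, a tuple of flags in `W = E/V`. -/
structure InducedInstances (E : Type*) [AddCommGroup E] [Module ℂ E] [FiniteDimensional ℂ E]
    (t u : ℕ) where
  V : Submodule ℂ E
  base : Fin t → CompleteFlag V
  fiber : Submodule ℂ V → Fin u → CompleteFlag (E ⧸ V)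

/-- For Schubert problems `lam` in `Gr(k+a,n+b)`, `mu` in `Gr(k,n)` and `nu` in `Gr(a,b)`:
`lam` is fibered over `mu` with fiber `nu`. The general instances are those in a dense Zariski
open set `U`, and `Φ` is the construction of `V`, `ℰ` and the `𝒢(h)` from a general instance.
The intersection `H ∩ V` is `H.comap V.subtype`, a subspace of `V`, and `H/(H ∩ V)`, seen in
`W = ℂ^{n+b}/V`, is `H.map V.mkQ`. -/
def IsFiberedOver (k n a b : ℕ) {s t u : ℕ}
    (lam : Fin s → ℕ → ℕ) (mu : Fin t → ℕ → ℕ) (nu : Fin u → ℕ → ℕ) : Prop :=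
  ∃ (U : Set (Fin s → CompleteFlag (Fin (n + b) → ℂ)))
    (Φ : (Fin s → CompleteFlag (Fin (n + b) → ℂ)) → InducedInstances (Fin (n + b) → ℂ) t u),
    IsZariskiOpen U ∧ U.Nonempty ∧
    (∀ F ∈ U,
      finrank ℂ (Φ F).V = n ∧
      -- part (1)
      (∀ H ∈ solutions (k + a) lam F,
        H.comap (Φ F).V.subtype ∈ solutions k mu (Φ F).base) ∧
      -- part (2)
      (∀ h ∈ solutions k mu (Φ F).base, ∀ H ∈ solutions (k + a) lam F,
        H.comap (Φ F).V.subtype = h →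
          H.map (Φ F).V.mkQ ∈ solutions a nu ((Φ F).fiber h)) ∧
      -- part (3)
      Set.BijOn (fun H => (H.comap (Φ F).V.subtype, H.map (Φ F).V.mkQ))
        (solutions (k + a) lam F)
        {x | x.1 ∈ solutions k mu (Φ F).base ∧ x.2 ∈ solutions a nu ((Φ F).fiber x.1)}) ∧
    -- part (4): for each `V`, all general `ℰ` arise; for general `ℰ` and each of its solutions `h`,
    -- all general tuples of flags in `W` arise as `𝒢(h)` from flags that induce `V` and `ℰ`
    (∀ V : Submodule ℂ (Fin (n + b) → ℂ), finrank ℂ V = n →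
      ∃ B : Set (Fin t → CompleteFlag V), IsZariskiOpen B ∧ B.Nonempty ∧
        ∀ E ∈ B,
          (∃ F ∈ U, ∃ G, Φ F = ⟨V, E, G⟩) ∧
          ∀ h ∈ solutions k mu E,
            ∃ C : Set (Fin u → CompleteFlag ((Fin (n + b) → ℂ) ⧸ V)),
              IsZariskiOpen C ∧ C.Nonempty ∧
              ∀ Gh ∈ C, ∃ F ∈ U, ∃ G, Φ F = ⟨V, E, G⟩ ∧ G h = Gh)

end

/-! Let `A`, `C`, `B`, `D` be the spaces of dimensions `4`, `b`, `2`, `b + 2` of the first four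
flags. In general position `E = A ⊕ C`, and `V` is the sum of the projections of `B` to `A` and to
`C`; intersecting the flags with `V` gives the instance of `□⁴`. Its solutions are the planes `h`
spanned by `p ∈ A` and `w ∈ C` with `p + w ∈ B` that meet `D`, so they correspond to the zeros of a
binary quadratic form. Every solution `H` of the large problem with `H ∩ V = h` is contained in the
space `X(h) = (A ∩ (D + h)) + (C ∩ (D + h))`. As `X(h) ∩ V = h` and `X(h)` maps onto `E / V`,
the map `H ↦ H / h` is a bijection between the subspaces with `h ⊆ H ⊆ X(h)` and those of `E / V`,
and it turns the Schubert conditions on `H` into those for the images of the `X(h) ∩ Fₜ`.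

What has to be general in this argument concerns the zeros of the quadratic form, and it holds where
certain resultants do not vanish. These are regular functions of bases of `E` that span the flags,
and so the general position is Zariski open. Conversely, flags that induce given instances arise by
shuffling bases of `V` with lifts of bases of `E / V`; that such instances exist in general position
is seen from explicit bases of `V`. -/

noncomputable section

/-! ### Linear algebra and flags -/

section LinearAlgebra

variable {K E W : Type*} [DivisionRing K] [AddCommGroup E] [Module K E]
  [AddCommGroup W] [Module K W]

theorem finrank_comap_subtype (V Y : Submodule K E) :
    finrank K (Y.comap V.subtype) = finrank K ↥(Y ⊓ V) := by
  rw [← Submodule.finrank_map_subtype_eq, Submodule.map_comap_subtype, inf_comm]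

theorem exists_ne_zero_of_one_le_finrank {S : Submodule K E} (h : 1 ≤ finrank K S) :
    ∃ x ∈ S, x ≠ 0 := by
  apply S.exists_mem_ne_zero_of_ne_bot
  rintro rfl
  simp at h

theorem eq_and_eq_of_add_eq_add {A C : Submodule K E} (h : A ⊓ C = ⊥) {a a' c c' : E} (ha : a ∈ A)
    (ha' : a' ∈ A) (hc : c ∈ C) (hc' : c' ∈ C) (heq : a + c = a' + c') : a = a' ∧ c = c' := by
  have hsub : a - a' = c' - c := by rw [sub_eq_sub_iff_add_eq_add, heq, add_comm]
  have hmem : a - a' ∈ A ⊓ C := ⟨A.sub_mem ha ha', hsub ▸ C.sub_mem hc' hc⟩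
  rw [h, Submodule.mem_bot] at hmem
  exact ⟨sub_eq_zero.1 hmem, (sub_eq_zero.1 (hsub.symm.trans hmem)).symm⟩

variable [FiniteDimensional K E]

theorem finrank_map_add_finrank_inf_ker (f : E →ₗ[K] W) (Y : Submodule K E) :
    finrank K (Y.map f) + finrank K ↥(Y ⊓ LinearMap.ker f) = finrank K Y := by
  have h := (f.domRestrict Y).finrank_range_add_finrank_ker
  rwa [LinearMap.range_domRestrict, LinearMap.ker_domRestrict, finrank_comap_subtype,
    inf_comm] at h

theorem finrank_inf_add_le {Y Y' : Submodule K E} (h : Y ≤ Y') (X : Submodule K E) :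
    finrank K ↥(Y' ⊓ X) + finrank K Y ≤ finrank K ↥(Y ⊓ X) + finrank K Y' := by
  have hmod := Submodule.finrank_sup_add_finrank_inf_eq (Y' ⊓ X) Y
  have hsup : finrank K ↥(Y' ⊓ X ⊔ Y) ≤ finrank K Y' :=
    Submodule.finrank_mono (sup_le inf_le_left h)
  rw [inf_right_comm, inf_eq_right.2 h] at hmod
  omega

theorem finrank_map_add_le (f : E →ₗ[K] W) {Y Y' : Submodule K E} (h : Y ≤ Y') :
    finrank K (Y'.map f) + finrank K Y ≤ finrank K (Y.map f) + finrank K Y' := by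
  have hY := finrank_map_add_finrank_inf_ker f Y
  have hY' := finrank_map_add_finrank_inf_ker f Y'
  have hker : finrank K ↥(Y ⊓ LinearMap.ker f) ≤ finrank K ↥(Y' ⊓ LinearMap.ker f) :=
    Submodule.finrank_mono (inf_le_inf_right _ h)
  omega

theorem one_le_finrank_of_mem {S : Submodule K E} {x : E} (hx : x ∈ S) (h0 : x ≠ 0) :
    1 ≤ finrank K S :=
  Submodule.one_le_finrank_iff.2 <| S.ne_bot_iff.2 ⟨x, hx, h0⟩

theorem finrank_inf_add_finrank_of_sup_eq_top {S T : Submodule K E} (h : S ⊔ T = ⊤) :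
    finrank K ↥(S ⊓ T) + finrank K E = finrank K S + finrank K T := by
  have := Submodule.finrank_sup_add_finrank_inf_eq S T
  rw [h, finrank_top] at this
  omega

theorem finrank_add_le_finrank_inf_add (S T : Submodule K E) :
    finrank K S + finrank K T ≤ finrank K ↥(S ⊓ T) + finrank K E := by
  have := Submodule.finrank_sup_add_finrank_inf_eq S T
  have := (S ⊔ T).finrank_le
  omega

theorem finrank_sup_of_inf_eq_bot {S T : Submodule K E} (h : S ⊓ T = ⊥) :
    finrank K ↥(S ⊔ T) = finrank K S + finrank K T := by
  have := Submodule.finrank_sup_add_finrank_inf_eq S T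
  rw [h, finrank_bot] at this
  omega

theorem sup_eq_top_of_not_le {S T : Submodule K E} (hT : finrank K E ≤ finrank K T + 1)
    (h : ¬ S ≤ T) : S ⊔ T = ⊤ := by
  apply Submodule.eq_top_of_finrank_eq
  have := Submodule.finrank_lt_finrank_of_lt (right_lt_sup.2 h)
  have := (S ⊔ T).finrank_le
  omega

end LinearAlgebra

section Chains

variable {W : Type*} [AddCommGroup W] [Module ℂ W]

/-- A chain of subspaces from `0` to `W` whose dimension increases by at most one in each step.
Spaces may repeat; removing the repetitions leaves a complete flag, see `flagOfChain`. -/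
structure IsFlagChain (S : ℕ → Submodule ℂ W) : Prop where
  mono : Monotone S
  zero : S 0 = ⊥
  step : ∀ m, finrank ℂ (S (m + 1)) ≤ finrank ℂ (S m) + 1
  top : ∃ N, S N = ⊤

theorem IsFlagChain.exists_finrank_eq {S : ℕ → Submodule ℂ W} (hS : IsFlagChain S) (j : ℕ) :
    ∃ m, finrank ℂ (S m) = min j (finrank ℂ W) := by
  obtain ⟨N, hN⟩ := hS.top
  classical
  induction j with
  | zero => exact ⟨0, by rw [hS.zero, finrank_bot, Nat.zero_min]⟩
  | succ j ih =>
    by_cases hj : finrank ℂ W ≤ j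
    · obtain ⟨m, hm⟩ := ih
      exact ⟨m, by omega⟩
    · have hex : ∃ m, j + 1 ≤ finrank ℂ (S m) := ⟨N, by rw [hN, finrank_top]; omega⟩
      refine ⟨Nat.find hex, ?_⟩
      have hfind := Nat.find_spec hex
      rcases h : Nat.find hex with _ | k
      · rw [h, hS.zero, finrank_bot] at hfind
        omega
      · have hmin := Nat.find_min hex (m := k) (by omega)
        have hstep := hS.step k
        rw [h] at hfind
        omega

variable [FiniteDimensional ℂ W]

theorem eq_of_finrank_eq_of_monotone {S : ℕ → Submodule ℂ W} (hS : Monotone S) {i j : ℕ}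
    (h : finrank ℂ (S i) = finrank ℂ (S j)) : S i = S j := by
  rcases le_total i j with hij | hij
  · exact Submodule.eq_of_le_of_finrank_le (hS hij) h.ge
  · exact (Submodule.eq_of_le_of_finrank_le (hS hij) h.le).symm

open Classical in
/-- The complete flag formed by the spaces of a chain; it has an arbitrary value on sequences of
subspaces that are not chains. -/
def flagOfChain (S : ℕ → Submodule ℂ W) : CompleteFlag W :=
  if hS : IsFlagChain S then
    { space := fun j => S (hS.exists_finrank_eq j).choose
      mono := fun i j hij => by
        have hi := (hS.exists_finrank_eq i).choose_spec
        have hj := (hS.exists_finrank_eq j).choose_spec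
        rcases le_total (hS.exists_finrank_eq i).choose (hS.exists_finrank_eq j).choose with h | h
        · exact hS.mono h
        · exact (Submodule.eq_of_le_of_finrank_le (hS.mono h) (by omega)).ge
      finrank_space := fun j => (hS.exists_finrank_eq j).choose_spec }
  else CompleteFlag.ofBasis (finBasis ℂ W)

theorem exists_flagOfChain_space_eq {S : ℕ → Submodule ℂ W} (hS : IsFlagChain S) (j : ℕ) :
    ∃ m, (flagOfChain S).space j = S m := by
  rw [flagOfChain, dif_pos hS]
  exact ⟨_, rfl⟩

theorem flagOfChain_space {S : ℕ → Submodule ℂ W} (hS : IsFlagChain S) {m j : ℕ}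
    (h : finrank ℂ (S m) = j) : (flagOfChain S).space j = S m := by
  obtain ⟨l, hl⟩ := exists_flagOfChain_space_eq hS j
  have hj := (flagOfChain S).finrank_space j
  have hm := (S m).finrank_le
  rw [hl] at hj ⊢
  exact eq_of_finrank_eq_of_monotone hS.mono (by omega)

namespace CompleteFlag

variable (F : CompleteFlag W)

theorem space_zero : F.space 0 = ⊥ := by
  simpa using F.finrank_space 0

theorem space_eq_top {j : ℕ} (hj : finrank ℂ W ≤ j) : F.space j = ⊤ :=
  Submodule.eq_top_of_finrank_eq (by rw [F.finrank_space]; omega)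

theorem finrank_space_succ_le (m : ℕ) :
    finrank ℂ (F.space (m + 1)) ≤ finrank ℂ (F.space m) + 1 := by
  rw [F.finrank_space, F.finrank_space]
  omega

end CompleteFlag

theorem flagOfChain_eq {S : ℕ → Submodule ℂ W} (hS : IsFlagChain S) (G : CompleteFlag W)
    (hG : ∀ m, ∃ j, S m = G.space j) : flagOfChain S = G := by
  ext1
  funext j
  obtain ⟨m, hm⟩ := exists_flagOfChain_space_eq hS j
  obtain ⟨l, hl⟩ := hG m
  have hj := (flagOfChain S).finrank_space j
  rw [hm, hl] at hj ⊢
  exact eq_of_finrank_eq_of_monotone G.mono (hj.trans (G.finrank_space j).symm)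

theorem isFlagChain_comap_subtype (F : CompleteFlag W) (V : Submodule ℂ W) :
    IsFlagChain fun m => (F.space m).comap V.subtype where
  mono _ _ h := Submodule.comap_mono (F.mono h)
  zero := by simp [F.space_zero]
  step m := by
    have hinf := finrank_inf_add_le (F.mono (Nat.le_add_right m 1)) V
    have hF := F.finrank_space_succ_le m
    simp only [finrank_comap_subtype]
    omega
  top := ⟨finrank ℂ W, by simp [F.space_eq_top le_rfl]⟩

theorem isFlagChain_map {W' : Type*} [AddCommGroup W'] [Module ℂ W'] (F : CompleteFlag W)
    (X : Submodule ℂ W) (f : W →ₗ[ℂ] W') (hf : X.map f = ⊤) :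
    IsFlagChain fun m => (X ⊓ F.space m).map f where
  mono _ _ h := Submodule.map_mono (inf_le_inf_left _ (F.mono h))
  zero := by simp [F.space_zero]
  step m := by
    have hmono := F.mono (Nat.le_add_right m 1)
    have hinf := finrank_inf_add_le hmono X
    have hF := F.finrank_space_succ_le m
    have hmap := finrank_map_add_le f (inf_le_inf_left X hmono)
    rw [inf_comm, inf_comm (F.space m)] at hinf
    omega
  top := ⟨finrank ℂ W, by simp [F.space_eq_top le_rfl, hf]⟩

end Chains

/-! ### Regular functions of tuples of bases -/

section Frames

variable {E : Type*} [AddCommGroup E] [Module ℂ E]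

/-- The vectors of a basis, indexed from `0` and continued by `0`. -/
def frameVec (e : Basis (Fin (finrank ℂ E)) ℂ E) (k : ℕ) : E :=
  if h : k < finrank ℂ E then e ⟨k, h⟩ else 0

/-- The coordinates with respect to a basis, indexed from `0` and continued by `0`. -/
def frameCoord (e : Basis (Fin (finrank ℂ E)) ℂ E) (k : ℕ) : E →ₗ[ℂ] ℂ :=
  if h : k < finrank ℂ E then e.coord ⟨k, h⟩ else 0

theorem frameCoord_frameVec (e : Basis (Fin (finrank ℂ E)) ℂ E) (k l : ℕ) :
    frameCoord e k (frameVec e l) = if k = l ∧ k < finrank ℂ E then 1 else 0 := by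
  unfold frameCoord frameVec
  split_ifs <;> simp_all
  all_goals omega

theorem sum_frameCoord_smul_frameVec (e : Basis (Fin (finrank ℂ E)) ℂ E) (x : E) :
    ∑ k ∈ Finset.range (finrank ℂ E), frameCoord e k x • frameVec e k = x := by
  rw [← Fin.sum_univ_eq_sum_range (fun k => frameCoord e k x • frameVec e k)]
  conv_rhs => rw [← e.sum_repr x]
  simp [frameCoord, frameVec]

variable [FiniteDimensional ℂ E]

theorem ofBasis_space (e : Basis (Fin (finrank ℂ E)) ℂ E) (j : ℕ) :
    (CompleteFlag.ofBasis e).space j = Submodule.span ℂ (e '' {i | (i : ℕ) < j}) := rfl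

theorem mem_ofBasis_space {e : Basis (Fin (finrank ℂ E)) ℂ E} {j : ℕ} {x : E} :
    x ∈ (CompleteFlag.ofBasis e).space j ↔ ∀ k, j ≤ k → frameCoord e k x = 0 := by
  rw [ofBasis_space, Basis.mem_span_image]
  constructor
  · intro h k hk
    unfold frameCoord
    split_ifs with hk'
    · by_contra hne
      have hlt : k < j := h (show (⟨k, hk'⟩ : Fin _) ∈ (e.repr x).support by simpa using hne)
      omega
    · rfl
  · intro h i hi
    by_contra hne
    have hzero := h i (by simpa using hne)
    simp only [frameCoord, i.isLt, dif_pos, Basis.coord_apply] at hzero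
    exact Finsupp.mem_support_iff.1 hi hzero

theorem frameVec_mem {e : Basis (Fin (finrank ℂ E)) ℂ E} {j k : ℕ} (h : k < j) :
    frameVec e k ∈ (CompleteFlag.ofBasis e).space j := by
  rw [mem_ofBasis_space]
  intro l hl
  rw [frameCoord_frameVec, if_neg (by omega)]

theorem mem_ofBasis_space_iff_sum {e : Basis (Fin (finrank ℂ E)) ℂ E} {j : ℕ} {x : E} :
    x ∈ (CompleteFlag.ofBasis e).space j ↔
      x = ∑ k ∈ Finset.range j, frameCoord e k x • frameVec e k := by
  constructor
  · intro h
    rw [mem_ofBasis_space] at h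
    conv_lhs => rw [← sum_frameCoord_smul_frameVec e x]
    rcases le_total j (finrank ℂ E) with hj | hj
    · refine (Finset.sum_subset (Finset.range_mono hj) fun k _ hk => ?_).symm
      rw [h k (by simpa using hk), zero_smul]
    · refine Finset.sum_subset (Finset.range_mono hj) fun k _ hk => ?_
      rw [frameVec, dif_neg (by simpa using hk), smul_zero]
  · intro h
    rw [h]
    exact Submodule.sum_mem _ fun k hk =>
      Submodule.smul_mem _ _ (frameVec_mem (by simpa using hk))

end Frames

/-- The tuples of bases of `E`: the variety `GL(E)^s`, whose quotient is the variety of tuples of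
flags. -/
abbrev Frames (s : ℕ) (E : Type*) [AddCommGroup E] [Module ℂ E] :=
  Fin s → Basis (Fin (finrank ℂ E)) ℂ E

section Regular

variable {s : ℕ} {E : Type*} [AddCommGroup E] [Module ℂ E]

/-- The tuple `d` of bases, moved by the automorphisms that take the bases `e i` to the bases
`e' i`. If `d` and `e` define the same flags, then so do the moved tuple and `e'`. -/
def moveFrames (e d e' : Frames s E) : Frames s E :=
  fun i => (d i).map ((e i).equiv (e' i) (Equiv.refl _))

theorem moveFrames_apply (e d e' : Frames s E) (i : Fin s) (j : Fin (finrank ℂ E)) :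
    moveFrames e d e' i j = ∑ k, (e i).repr (d i j) k • e' i k := by
  rw [moveFrames, Basis.map_apply]
  conv_lhs => rw [← (e i).sum_repr (d i j), map_sum]
  simp [-Basis.sum_repr]

theorem moveFrames_self (e d : Frames s E) : moveFrames e d e = d := by
  funext i
  ext j
  rw [moveFrames_apply, (e i).sum_repr]

variable [FiniteDimensional ℂ E]

/-- Regular functions of a tuple of bases: quotients of polynomials in the matrix entries with
nowhere vanishing denominator. -/
def IsRegularFun (f : Frames s E → ℂ) : Prop :=
  ∃ p q : MvPolynomial (Fin s × Fin (finrank ℂ E) × Fin (finrank ℂ E)) ℂ,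
    (∀ e : Frames s E, MvPolynomial.eval (frameCoords e) q ≠ 0) ∧
    ∀ e : Frames s E,
      f e * MvPolynomial.eval (frameCoords e) q = MvPolynomial.eval (frameCoords e) p

namespace IsRegularFun

theorem const (c : ℂ) : IsRegularFun (fun _ : Frames s E => c) :=
  ⟨MvPolynomial.C c, 1, by simp, by simp⟩

theorem coord (x : Fin s × Fin (finrank ℂ E) × Fin (finrank ℂ E)) :
    IsRegularFun (fun e : Frames s E => frameCoords e x) :=
  ⟨MvPolynomial.X x, 1, by simp, by simp⟩

variable {f g : Frames s E → ℂ}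

theorem add (hf : IsRegularFun f) (hg : IsRegularFun g) : IsRegularFun (fun e => f e + g e) := by
  obtain ⟨p, q, hq, hp⟩ := hf
  obtain ⟨p', q', hq', hp'⟩ := hg
  refine ⟨p * q' + p' * q, q * q', fun e => ?_, fun e => ?_⟩
  · rw [map_mul]; exact mul_ne_zero (hq e) (hq' e)
  · simp only [map_mul, map_add, ← hp, ← hp']; ring

theorem mul (hf : IsRegularFun f) (hg : IsRegularFun g) : IsRegularFun (fun e => f e * g e) := by
  obtain ⟨p, q, hq, hp⟩ := hf
  obtain ⟨p', q', hq', hp'⟩ := hg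
  refine ⟨p * p', q * q', fun e => ?_, fun e => ?_⟩
  · rw [map_mul]; exact mul_ne_zero (hq e) (hq' e)
  · simp only [map_mul, ← hp, ← hp']; ring

theorem neg (hf : IsRegularFun f) : IsRegularFun (fun e => -f e) := by
  simpa using (const (-1)).mul hf

theorem sub (hf : IsRegularFun f) (hg : IsRegularFun g) : IsRegularFun (fun e => f e - g e) := by
  simpa [sub_eq_add_neg] using hf.add hg.neg

theorem pow (hf : IsRegularFun f) (n : ℕ) : IsRegularFun (fun e => f e ^ n) := by
  induction n with
  | zero => simpa using const 1
  | succ n ih => simpa [pow_succ] using ih.mul hf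

theorem inv (hf : IsRegularFun f) (h : ∀ e, f e ≠ 0) : IsRegularFun (fun e => (f e)⁻¹) := by
  obtain ⟨p, q, hq, hp⟩ := hf
  refine ⟨q, p, fun e => ?_, fun e => ?_⟩
  · rw [← hp]; exact mul_ne_zero (h e) (hq e)
  · rw [← hp, inv_mul_cancel_left₀ (h e)]

theorem sum {ι : Type*} (t : Finset ι) {f : ι → Frames s E → ℂ} (hf : ∀ i ∈ t, IsRegularFun (f i)) :
    IsRegularFun (fun e => ∑ i ∈ t, f i e) := by
  classical
  induction t using Finset.induction_on with
  | empty => simpa using const 0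
  | insert i t hi ih =>
    simp only [Finset.sum_insert hi]
    exact (hf i (by simp)).add (ih fun j hj => hf j (by simp [hj]))

theorem prod {ι : Type*} (t : Finset ι) {f : ι → Frames s E → ℂ}
    (hf : ∀ i ∈ t, IsRegularFun (f i)) : IsRegularFun (fun e => ∏ i ∈ t, f i e) := by
  classical
  induction t using Finset.induction_on with
  | empty => simpa using const 1
  | insert i t hi ih =>
    simp only [Finset.prod_insert hi]
    exact (hf i (by simp)).mul (ih fun j hj => hf j (by simp [hj]))

theorem det {ι : Type*} [Fintype ι] [DecidableEq ι] {M : Frames s E → Matrix ι ι ℂ}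
    (hM : ∀ i j, IsRegularFun (fun e => M e i j)) : IsRegularFun (fun e => (M e).det) := by
  simp only [Matrix.det_apply, Units.smul_def, zsmul_eq_mul]
  exact sum _ fun σ _ => (const _).mul (prod _ fun i _ => hM _ _)

theorem adjugate {ι : Type*} [Fintype ι] [DecidableEq ι] {M : Frames s E → Matrix ι ι ℂ}
    (hM : ∀ i j, IsRegularFun (fun e => M e i j)) (i j : ι) :
    IsRegularFun (fun e => (M e).adjugate i j) := by
  simp only [Matrix.adjugate_apply]
  refine det fun k l => ?_
  by_cases hk : k = j
  · subst hk
    simpa using const _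
  · simpa [Matrix.updateRow_apply, hk] using hM k l

theorem comp {s' : ℕ} {E' : Type*} [AddCommGroup E'] [Module ℂ E'] [FiniteDimensional ℂ E']
    {Θ : Frames s' E' → Frames s E} (hf : IsRegularFun f)
    (hΘ : ∀ i j k, IsRegularFun (fun e => (finBasis ℂ E).repr (Θ e i j) k)) :
    IsRegularFun (fun e => f (Θ e)) := by
  have key (p : MvPolynomial (Fin s × Fin (finrank ℂ E) × Fin (finrank ℂ E)) ℂ) :
      IsRegularFun (fun e => MvPolynomial.eval (frameCoords (Θ e)) p) := by
    induction p using MvPolynomial.induction_on with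
    | C a => simpa using const a
    | add p q hp hq => simpa using hp.add hq
    | mul_X p i hp => simpa [frameCoords] using hp.mul (hΘ i.1 i.2.1 i.2.2)
  obtain ⟨p, q, hq, hp⟩ := hf
  have : (fun e => f (Θ e)) = fun e => MvPolynomial.eval (frameCoords (Θ e)) p *
      (MvPolynomial.eval (frameCoords (Θ e)) q)⁻¹ := by
    funext e
    rw [← hp, mul_inv_cancel_right₀ (hq _)]
  rw [this]
  exact (key p).mul ((key q).inv fun e => hq _)

end IsRegularFun

/-- Regular vector-valued functions of a tuple of bases: those with regular coordinates. -/
def IsRegularVec {E' : Type*} [AddCommGroup E'] [Module ℂ E'] [FiniteDimensional ℂ E']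
    (v : Frames s E → E') : Prop :=
  ∀ k, IsRegularFun (fun e => (finBasis ℂ E').repr (v e) k)

namespace IsRegularVec

section

variable {E' E'' : Type*} [AddCommGroup E'] [Module ℂ E'] [FiniteDimensional ℂ E']
  [AddCommGroup E''] [Module ℂ E''] [FiniteDimensional ℂ E'']

theorem const (x : E') : IsRegularVec (fun _ : Frames s E => x) :=
  fun _ => IsRegularFun.const _

theorem basis (i : Fin s) (j : Fin (finrank ℂ E)) :
    IsRegularVec (fun e : Frames s E => e i j) :=
  fun k => IsRegularFun.coord (i, j, k)

theorem frameVec (i : Fin s) (j : ℕ) : IsRegularVec (fun e : Frames s E => frameVec (e i) j) := by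
  unfold _root_.frameVec
  split_ifs with h
  · exact basis i _
  · exact const 0

theorem add {v w : Frames s E → E'} (hv : IsRegularVec v) (hw : IsRegularVec w) :
    IsRegularVec (fun e => v e + w e) := fun k => by
  simpa using (hv k).add (hw k)

theorem smul {f : Frames s E → ℂ} {v : Frames s E → E'} (hf : IsRegularFun f)
    (hv : IsRegularVec v) : IsRegularVec (fun e => f e • v e) := fun k => by
  simpa using hf.mul (hv k)

theorem sub {v w : Frames s E → E'} (hv : IsRegularVec v) (hw : IsRegularVec w) :
    IsRegularVec (fun e => v e - w e) := fun k => by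
  simpa using (hv k).sub (hw k)

theorem sum {ι : Type*} (t : Finset ι) {v : ι → Frames s E → E'}
    (hv : ∀ i ∈ t, IsRegularVec (v i)) : IsRegularVec (fun e => ∑ i ∈ t, v i e) := fun k => by
  simpa using IsRegularFun.sum t fun i hi => hv i hi k

theorem map {v : Frames s E → E'} (hv : IsRegularVec v) (f : E' →ₗ[ℂ] E'') :
    IsRegularVec (fun e => f (v e)) := by
  have : (fun e => f (v e)) = fun e => ∑ k, (finBasis ℂ E').repr (v e) k • f (finBasis ℂ E' k) := by
    funext e
    conv_lhs => rw [← (finBasis ℂ E').sum_repr (v e), map_sum]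
    simp only [map_smul]
  rw [this]
  exact sum _ fun k _ => smul (hv k) (const _)

end

theorem toMatrix_finBasis (i : Fin s) (k l : Fin (finrank ℂ E)) :
    IsRegularFun (fun e : Frames s E => (e i).toMatrix (finBasis ℂ E) k l) := by
  have hM (k l) : IsRegularFun (fun e : Frames s E => (finBasis ℂ E).toMatrix (e i) k l) :=
    IsRegularFun.coord (i, l, k)
  have hdet (e : Frames s E) : ((finBasis ℂ E).toMatrix (e i)).det ≠ 0 := by
    have h := congrArg Matrix.det ((finBasis ℂ E).toMatrix_mul_toMatrix_flip (e i))
    rw [Matrix.det_mul, Matrix.det_one] at h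
    exact left_ne_zero_of_mul_eq_one h
  have cramer (e : Frames s E) : (e i).toMatrix (finBasis ℂ E) =
      ((finBasis ℂ E).toMatrix (e i)).det⁻¹ • ((finBasis ℂ E).toMatrix (e i)).adjugate := by
    have h := (finBasis ℂ E).toMatrix_mul_toMatrix_flip (e i)
    rw [← Matrix.inv_eq_right_inv h, Matrix.inv_def, Ring.inverse_eq_inv']
  simp only [cramer, Matrix.smul_apply, smul_eq_mul]
  exact ((IsRegularFun.det hM).inv hdet).mul (IsRegularFun.adjugate hM k l)

theorem repr_basis {v : Frames s E → E} (hv : IsRegularVec v) (i : Fin s)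
    (k : Fin (finrank ℂ E)) : IsRegularFun (fun e => (e i).repr (v e) k) := by
  have hrepr (e : Frames s E) : (e i).repr (v e) k =
      ∑ l, (e i).toMatrix (finBasis ℂ E) k l * (finBasis ℂ E).repr (v e) l :=
    (congrFun ((finBasis ℂ E).toMatrix_mulVec_repr (e i) (v e)) k).symm
  simp only [hrepr]
  exact IsRegularFun.sum _ fun l _ => (toMatrix_finBasis i k l).mul (hv l)

theorem frameCoord {v : Frames s E → E} (hv : IsRegularVec v) (i : Fin s) (k : ℕ) :
    IsRegularFun (fun e => frameCoord (e i) k (v e)) := by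
  unfold _root_.frameCoord
  split_ifs with h
  · exact hv.repr_basis i _
  · exact IsRegularFun.const 0

end IsRegularVec

/-- Zariski open sets of tuples of bases: unions of nonvanishing loci of regular functions. -/
def IsFrameOpen (S : Set (Frames s E)) : Prop :=
  ∀ e ∈ S, ∃ f : Frames s E → ℂ, IsRegularFun f ∧ f e ≠ 0 ∧ ∀ e', f e' ≠ 0 → e' ∈ S

namespace IsFrameOpen

theorem of_ne {f : Frames s E → ℂ} (hf : IsRegularFun f) : IsFrameOpen {e | f e ≠ 0} :=
  fun _ he => ⟨f, hf, he, fun _ h => h⟩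

theorem inter {S T : Set (Frames s E)} (hS : IsFrameOpen S) (hT : IsFrameOpen T) :
    IsFrameOpen (S ∩ T) := fun e he => by
  obtain ⟨f, hf, hfe, hfS⟩ := hS e he.1
  obtain ⟨g, hg, hge, hgT⟩ := hT e he.2
  exact ⟨_, hf.mul hg, mul_ne_zero hfe hge,
    fun e' h => ⟨hfS _ (left_ne_zero_of_mul h), hgT _ (right_ne_zero_of_mul h)⟩⟩

theorem iInter {ι : Type*} [Finite ι] {S : ι → Set (Frames s E)} (hS : ∀ i, IsFrameOpen (S i)) :
    IsFrameOpen (⋂ i, S i) := fun e he => by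
  cases nonempty_fintype ι
  choose f hf hfe hfS using fun i => hS i e (Set.mem_iInter.1 he i)
  exact ⟨_, IsRegularFun.prod Finset.univ fun i _ => hf i,
    Finset.prod_ne_zero_iff.2 fun i _ => hfe i,
    fun e' h => Set.mem_iInter.2 fun i => hfS i e' (Finset.prod_ne_zero_iff.1 h i (by simp))⟩

theorem preimage {s' : ℕ} {E' : Type*} [AddCommGroup E'] [Module ℂ E'] [FiniteDimensional ℂ E']
    {S : Set (Frames s E)} (hS : IsFrameOpen S) {Θ : Frames s' E' → Frames s E}
    (hΘ : ∀ i j, IsRegularVec (fun e => Θ e i j)) : IsFrameOpen (Θ ⁻¹' S) := fun e he => by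
  obtain ⟨f, hf, hfe, hfS⟩ := hS _ he
  exact ⟨_, hf.comp hΘ, hfe, fun e' h => hfS _ h⟩

end IsFrameOpen

theorem ofBasis_map_space (L : E ≃ₗ[ℂ] E) (e : Basis (Fin (finrank ℂ E)) ℂ E) (j : ℕ) :
    (CompleteFlag.ofBasis (e.map L)).space j =
      ((CompleteFlag.ofBasis e).space j).map L.toLinearMap := by
  simp only [ofBasis_space, Submodule.map_span, ← Set.image_comp]
  congr 2

theorem isRegularVec_moveFrames (e d : Frames s E) (i : Fin s) (j : Fin (finrank ℂ E)) :
    IsRegularVec (fun e' => moveFrames e d e' i j) := by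
  simp only [moveFrames_apply]
  exact IsRegularVec.sum _ fun k _ =>
    IsRegularVec.smul (IsRegularFun.const _) (IsRegularVec.basis i k)

theorem ofBasis_moveFrames {e d : Frames s E} {i : Fin s}
    (h : CompleteFlag.ofBasis (d i) = CompleteFlag.ofBasis (e i)) (e' : Frames s E) :
    CompleteFlag.ofBasis (moveFrames e d e' i) = CompleteFlag.ofBasis (e' i) := by
  have he' : (e i).map ((e i).equiv (e' i) (Equiv.refl _)) = e' i := by
    ext j
    simp
  ext1
  funext j
  conv_rhs => rw [← he', ofBasis_map_space, ← h, ← ofBasis_map_space]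
  rfl

theorem IsFrameOpen.isZariskiOpen {S : Set (Frames s E)} (hS : IsFrameOpen S) :
    IsZariskiOpen {F : Fin s → CompleteFlag E |
      ∃ e ∈ S, (fun i => CompleteFlag.ofBasis (e i)) = F} := by
  rintro e ⟨d, hd, hde⟩
  obtain ⟨f, ⟨p, q, hq, hp⟩, hfe, hfS⟩ :=
    hS.preimage (isRegularVec_moveFrames e d) e
    (by rwa [Set.mem_preimage, moveFrames_self])
  refine ⟨p, ?_, fun e' h => ⟨moveFrames e d e', hfS e' ?_,
    funext fun i => ofBasis_moveFrames (congrFun hde i) e'⟩⟩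
  · rw [← hp]
    exact mul_ne_zero hfe (hq _)
  · rw [← hp] at h
    exact left_ne_zero_of_mul h

end Regular

section Elimination

/-- The resultant of the binary quadratic forms `a s² + b s t + c t²` and
`a' s² + b' s t + c' t²`. -/
def quadraticResultant {R : Type*} [CommRing R] (a b c a' b' c' : R) : R :=
  (a * c' - a' * c) ^ 2 - (a * b' - a' * b) * (b * c' - b' * c)

theorem quadraticResultant_eq_zero {R : Type*} [CommRing R] [IsDomain R] {a b c a' b' c' s t : R}
    (hst : s ≠ 0 ∨ t ≠ 0) (h : a * s ^ 2 + b * s * t + c * t ^ 2 = 0)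
    (h' : a' * s ^ 2 + b' * s * t + c' * t ^ 2 = 0) : quadraticResultant a b c a' b' c' = 0 := by
  unfold quadraticResultant
  rcases hst with hs | ht
  · refine (mul_eq_zero.1 (?_ : s ^ 3 * _ = 0)).resolve_left (pow_ne_zero 3 hs)
    linear_combination
      (s * (a * c' - a' * c) - t * (b * c' - b' * c)) * (c' * h - c * h') -
        s * (b * c' - b' * c) * (b' * h - b * h')
  · refine (mul_eq_zero.1 (?_ : t ^ 3 * _ = 0)).resolve_left (pow_ne_zero 3 ht)
    linear_combination
      (s * (a * b' - a' * b) - t * (a * c' - a' * c)) * (a' * h - a * h') +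
        t * (a * b' - a' * b) * (b' * h - b * h')

variable {k : Type*} [Field k] [IsAlgClosed k]

theorem exists_root_quadratic {a : k} (ha : a ≠ 0) (b c : k) : ∃ r, a * r ^ 2 + b * r + c = 0 := by
  open Polynomial in
  obtain ⟨r, hr⟩ := IsAlgClosed.exists_root (C a * X ^ 2 + C b * X + C c)
    (by rw [degree_quadratic ha]; decide)
  exact ⟨r, by simpa using hr⟩

theorem exists_common_zero_of_quadraticResultant_eq_zero {a b c a' b' c' : k}
    (hR : quadraticResultant a b c a' b' c' = 0) :
    ∃ s t : k, (s ≠ 0 ∨ t ≠ 0) ∧ a * s ^ 2 + b * s * t + c * t ^ 2 = 0 ∧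
      a' * s ^ 2 + b' * s * t + c' * t ^ 2 = 0 := by
  unfold quadraticResultant at hR
  by_contra! h
  rcases eq_or_ne a 0 with rfl | ha
  · have h1 : a' ≠ 0 := by simpa using h 1 0 (by simp) (by ring)
    by_cases hbc : c ≠ 0 ∨ -b ≠ 0
    · exact mul_ne_zero h1 (h c (-b) hbc (by ring)) (by linear_combination hR)
    · obtain ⟨rfl, hb⟩ : c = 0 ∧ -b = 0 := by simpa only [not_or, not_not] using hbc
      obtain rfl := neg_eq_zero.1 hb
      obtain ⟨r, hr⟩ := exists_root_quadratic h1 b' c'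
      exact h r 1 (by simp) (by ring) (by linear_combination hr)
  · -- `(r, 1)` and `(-b - a r, a)` are the two zeros of the first form
    obtain ⟨r, hr⟩ := exists_root_quadratic ha b c
    obtain rfl : c = -(a * r ^ 2 + b * r) := by linear_combination hr
    exact mul_ne_zero (h r 1 (by simp) (by ring))
      (h (-b - a * r) a (by simp [ha]) (by ring)) (by linear_combination hR)

theorem quadraticResultant_ne_zero_iff (a b c a' b' c' : k) :
    quadraticResultant a b c a' b' c' ≠ 0 ↔ ∀ s t : k, (s ≠ 0 ∨ t ≠ 0) →
      a * s ^ 2 + b * s * t + c * t ^ 2 = 0 → a' * s ^ 2 + b' * s * t + c' * t ^ 2 ≠ 0 := by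
  refine ⟨fun hR s t hst h h' => hR (quadraticResultant_eq_zero hst h h'), fun h hR => ?_⟩
  obtain ⟨s, t, hst, h0, h1⟩ := exists_common_zero_of_quadraticResultant_eq_zero hR
  exact h s t hst h0 h1

end Elimination

/-! ### Transversals to four subspaces -/

section Position

variable {K E : Type*} [DivisionRing K] [AddCommGroup E] [Module K E]

/-- The span of the projections of `B` to the summands of `E = A ⊕ C`. -/
def crossSpace (A C B : Submodule K E) : Submodule K E :=
  A ⊓ (B ⊔ C) ⊔ C ⊓ (B ⊔ A)

/-- The span of the intersections of `D + h` with the summands of `E = A ⊕ C`. It contains every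
solution of the big problem that meets `crossSpace A C B` in `h`. -/
def liftSpace (A C D h : Submodule K E) : Submodule K E :=
  A ⊓ (D ⊔ h) ⊔ C ⊓ (D ⊔ h)

/-- General position of four subspaces: `E = A ⊕ C` with `dim A = m` and `dim C = b`, the space `B`
is a plane, `D` has codimension two, and `D` meets neither of the projections of `B` to `A` and to
`C`. -/
structure IsTransverse (m b : ℕ) (A C B D : Submodule K E) : Prop where
  finrank_total : finrank K E = b + m
  finrank_A : finrank K A = m
  finrank_C : finrank K C = b
  finrank_B : finrank K B = 2
  finrank_D : finrank K D + 2 = b + m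
  inf_eq_bot : A ⊓ C = ⊥
  proj_notMem : ∀ p ∈ A, ∀ w ∈ C, p + w ∈ B → p + w ≠ 0 → p ∉ D ∧ w ∉ D

/-- The planes spanned by `p ∈ A` and `w ∈ C` with `0 ≠ p + w ∈ B` that meet `D`: they are the
planes that meet each of `A`, `C`, `B` and `D`. -/
def IsTransversal (A C B D h : Submodule K E) : Prop :=
  ∃ p ∈ A, ∃ w ∈ C, p + w ∈ B ∧ p + w ≠ 0 ∧ h = Submodule.span K {p} ⊔ Submodule.span K {w} ∧
    h ⊓ D ≠ ⊥

variable {A C B D h : Submodule K E}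

theorem inf_eq_bot_of_le (hAC : A ⊓ C = ⊥) {X Y : Submodule K E} (hX : X ≤ A) (hY : Y ≤ C) :
    X ⊓ Y = ⊥ :=
  le_bot_iff.1 ((inf_le_inf hX hY).trans hAC.le)

theorem sup_inf_eq_left_of_le (hAC : A ⊓ C = ⊥) {X Y : Submodule K E} (hX : X ≤ A) (hY : Y ≤ C) :
    (X ⊔ Y) ⊓ A = X := by
  rw [sup_inf_assoc_of_le _ hX, inf_comm, inf_eq_bot_of_le hAC le_rfl hY, sup_bot_eq]

theorem sup_inf_sup_eq_of_le (hAC : A ⊓ C = ⊥) {X X' Y Y' : Submodule K E} (hX : X ≤ A)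
    (hX' : X' ≤ A) (hY : Y ≤ C) (hY' : Y' ≤ C) : (X ⊔ Y) ⊓ (X' ⊔ Y') = X ⊓ X' ⊔ Y ⊓ Y' := by
  apply le_antisymm
  · rintro x ⟨hx, hx'⟩
    obtain ⟨p, hp, w, hw, rfl⟩ := Submodule.mem_sup.1 hx
    obtain ⟨p', hp', w', hw', heq⟩ := Submodule.mem_sup.1 hx'
    obtain ⟨rfl, rfl⟩ := eq_and_eq_of_add_eq_add hAC (hX hp) (hX' hp') (hY hw) (hY' hw') heq.symm
    exact Submodule.add_mem_sup ⟨hp, hp'⟩ ⟨hw, hw'⟩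
  · exact le_inf (sup_le_sup inf_le_left inf_le_left) (sup_le_sup inf_le_right inf_le_right)

theorem finrank_span_sup_span [FiniteDimensional K E] (hAC : A ⊓ C = ⊥) {p w : E}
    (hp : p ∈ A) (hw : w ∈ C) (hp0 : p ≠ 0) (hw0 : w ≠ 0) :
    finrank K ↥(Submodule.span K {p} ⊔ Submodule.span K {w}) = 2 := by
  rw [finrank_sup_of_inf_eq_bot, finrank_span_singleton hp0, finrank_span_singleton hw0]
  exact inf_eq_bot_of_le hAC (by simpa using hp) (by simpa using hw)

theorem inf_sup_inf_eq_of_finrank_le [FiniteDimensional K E] (hAC : A ⊓ C = ⊥)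
    {H : Submodule K E} (hH : finrank K H ≤ finrank K ↥(H ⊓ A) + finrank K ↥(H ⊓ C)) :
    H ⊓ A ⊔ H ⊓ C = H :=
  Submodule.eq_of_le_of_finrank_le (sup_le inf_le_left inf_le_left) (by
    rwa [finrank_sup_of_inf_eq_bot (inf_eq_bot_of_le hAC inf_le_right inf_le_right)])

theorem crossSpace_comm : crossSpace A C B = crossSpace C A B :=
  sup_comm _ _

theorem crossSpace_inf_left (hAC : A ⊓ C = ⊥) : crossSpace A C B ⊓ A = A ⊓ (B ⊔ C) :=
  sup_inf_eq_left_of_le hAC inf_le_left inf_le_left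

theorem crossSpace_inf_right (hAC : A ⊓ C = ⊥) : crossSpace A C B ⊓ C = C ⊓ (B ⊔ A) := by
  rw [crossSpace_comm, crossSpace_inf_left (by rwa [inf_comm])]

theorem liftSpace_comm : liftSpace A C D h = liftSpace C A D h :=
  sup_comm _ _

theorem liftSpace_le : liftSpace A C D h ≤ D ⊔ h := sup_le inf_le_right inf_le_right

theorem liftSpace_inf_left (hAC : A ⊓ C = ⊥) : liftSpace A C D h ⊓ A = A ⊓ (D ⊔ h) :=
  sup_inf_eq_left_of_le hAC inf_le_left inf_le_left

theorem mem_inf_sup_iff {p : E} : p ∈ A ⊓ (B ⊔ C) ↔ p ∈ A ∧ ∃ w ∈ C, p + w ∈ B := by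
  rw [Submodule.mem_inf, Submodule.mem_sup]
  refine and_congr_right fun _ => ⟨?_, ?_⟩
  · rintro ⟨y, hy, z, hz, rfl⟩
    exact ⟨-z, C.neg_mem hz, by simpa using hy⟩
  · rintro ⟨w, hw, hy⟩
    exact ⟨p + w, hy, -w, C.neg_mem hw, by simp⟩

theorem mem_crossSpace_of_add_mem {p w : E} (hp : p ∈ A) (hw : w ∈ C) (hy : p + w ∈ B) :
    p ∈ crossSpace A C B ∧ w ∈ crossSpace A C B :=
  ⟨Submodule.mem_sup_left (mem_inf_sup_iff.2 ⟨hp, w, hw, hy⟩),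
    Submodule.mem_sup_right (mem_inf_sup_iff.2 ⟨hw, p, hp, by rwa [add_comm]⟩)⟩

namespace IsTransversal

theorem symm (hh : IsTransversal A C B D h) : IsTransversal C A B D h := by
  obtain ⟨p, hp, w, hw, hy, h0, rfl, hD⟩ := hh
  rw [add_comm] at hy h0
  exact ⟨w, hw, p, hp, hy, h0, sup_comm _ _, hD⟩

theorem le_crossSpace (hh : IsTransversal A C B D h) : h ≤ crossSpace A C B := by
  obtain ⟨p, hp, w, hw, hy, -, rfl, -⟩ := hh
  obtain ⟨hpV, hwV⟩ := mem_crossSpace_of_add_mem hp hw hy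
  exact sup_le (by simpa using hpV) (by simpa using hwV)

variable [FiniteDimensional K E]

theorem one_le_finrank_inf_B (hh : IsTransversal A C B D h) : 1 ≤ finrank K ↥(h ⊓ B) := by
  obtain ⟨p, -, w, -, hy, h0, rfl, -⟩ := hh
  have hmem := Submodule.add_mem_sup (Submodule.mem_span_singleton_self (R := K) p)
    (Submodule.mem_span_singleton_self (R := K) w)
  exact one_le_finrank_of_mem ⟨hmem, hy⟩ h0

theorem one_le_finrank_inf_D (hh : IsTransversal A C B D h) : 1 ≤ finrank K ↥(h ⊓ D) := by
  obtain ⟨-, -, -, -, -, -, -, hD⟩ := hh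
  exact Submodule.one_le_finrank_iff.2 hD

end IsTransversal

namespace IsTransverse

variable {m b : ℕ}

theorem symm (T : IsTransverse m b A C B D) : IsTransverse b m C A B D where
  finrank_total := by rw [T.finrank_total, add_comm]
  finrank_A := T.finrank_C
  finrank_C := T.finrank_A
  finrank_B := T.finrank_B
  finrank_D := by rw [T.finrank_D, add_comm]
  inf_eq_bot := by rw [inf_comm, T.inf_eq_bot]
  proj_notMem p hp w hw hy h0 := by
    rw [add_comm] at hy h0
    exact (T.proj_notMem w hw p hp hy h0).symm

theorem proj_ne_zero (T : IsTransverse m b A C B D) {p w : E} (hp : p ∈ A) (hw : w ∈ C)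
    (hy : p + w ∈ B) (h0 : p + w ≠ 0) : p ≠ 0 ∧ w ≠ 0 := by
  obtain ⟨hpD, hwD⟩ := T.proj_notMem p hp w hw hy h0
  exact ⟨fun h => hpD (h ▸ D.zero_mem), fun h => hwD (h ▸ D.zero_mem)⟩

theorem inf_B_C (T : IsTransverse m b A C B D) : B ⊓ C = ⊥ := by
  rw [Submodule.eq_bot_iff]
  rintro x ⟨hB, hC⟩
  by_contra h0
  exact (T.proj_ne_zero A.zero_mem hC (by simpa using hB) (by simpa using h0)).1 rfl

theorem proj_inf_D (T : IsTransverse m b A C B D) : A ⊓ (B ⊔ C) ⊓ D = ⊥ := by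
  rw [Submodule.eq_bot_iff]
  rintro p ⟨hp, hD⟩
  obtain ⟨hp, w, hw, hy⟩ := mem_inf_sup_iff.1 hp
  by_cases h0 : p + w = 0
  · exact (eq_and_eq_of_add_eq_add T.inf_eq_bot hp A.zero_mem hw C.zero_mem (by simpa using h0)).1
  · exact absurd hD (T.proj_notMem p hp w hw hy h0).1

variable [FiniteDimensional K E] (T : IsTransverse m b A C B D)

include T

theorem sup_eq_top : A ⊔ C = ⊤ := by
  apply Submodule.eq_top_of_finrank_eq
  rw [finrank_sup_of_inf_eq_bot T.inf_eq_bot, T.finrank_A, T.finrank_C, T.finrank_total, add_comm]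

theorem finrank_proj : finrank K ↥(A ⊓ (B ⊔ C)) = 2 := by
  have hinf := finrank_inf_add_finrank_of_sup_eq_top (S := A) (T := B ⊔ C) (by
    rw [sup_left_comm, T.sup_eq_top, sup_top_eq])
  rw [finrank_sup_of_inf_eq_bot T.inf_B_C, T.finrank_A, T.finrank_B, T.finrank_C,
    T.finrank_total] at hinf
  omega

theorem finrank_crossSpace : finrank K (crossSpace A C B) = 4 := by
  rw [crossSpace, finrank_sup_of_inf_eq_bot, T.finrank_proj, T.symm.finrank_proj]
  exact inf_eq_bot_of_le T.inf_eq_bot inf_le_left inf_le_left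

theorem B_le_crossSpace : B ≤ crossSpace A C B := fun y hy => by
  obtain ⟨p, hp, w, hw, rfl⟩ := Submodule.mem_sup.1 (T.sup_eq_top.ge (Submodule.mem_top (x := y)))
  obtain ⟨hpV, hwV⟩ := mem_crossSpace_of_add_mem hp hw hy
  exact add_mem hpV hwV

theorem finrank_proj_sup_crossSpace_inf_D :
    finrank K ↥(A ⊓ (B ⊔ C) ⊔ crossSpace A C B ⊓ D) = finrank K ↥(crossSpace A C B ⊓ D) + 2 := by
  rw [finrank_sup_of_inf_eq_bot (inf_eq_bot_of_le T.proj_inf_D le_rfl inf_le_right),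
    T.finrank_proj, add_comm]

theorem finrank_crossSpace_inf_D : finrank K ↥(crossSpace A C B ⊓ D) = 2 := by
  have hge := finrank_add_le_finrank_inf_add (crossSpace A C B) D
  have hle : finrank K ↥(A ⊓ (B ⊔ C) ⊔ crossSpace A C B ⊓ D) ≤ finrank K (crossSpace A C B) :=
    Submodule.finrank_mono (sup_le le_sup_left inf_le_left)
  have hD := T.finrank_D
  rw [T.finrank_crossSpace, T.finrank_total] at hge
  rw [T.finrank_crossSpace, T.finrank_proj_sup_crossSpace_inf_D] at hle
  omega

section Transversal

variable (hh : IsTransversal A C B D h)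

include hh

theorem finrank_eq_two : finrank K h = 2 := by
  obtain ⟨p, hp, w, hw, hy, h0, rfl, -⟩ := hh
  obtain ⟨hp0, hw0⟩ := T.proj_ne_zero hp hw hy h0
  exact finrank_span_sup_span T.inf_eq_bot hp hw hp0 hw0

theorem one_le_finrank_inf_A : 1 ≤ finrank K ↥(h ⊓ A) := by
  obtain ⟨p, hp, w, hw, hy, h0, rfl, -⟩ := hh
  have hmem : p ∈ Submodule.span K {p} ⊔ Submodule.span K {w} :=
    Submodule.mem_sup_left (Submodule.mem_span_singleton_self p)
  exact one_le_finrank_of_mem ⟨hmem, hp⟩ (T.proj_ne_zero hp hw hy h0).1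

theorem finrank_inf_A : finrank K ↥(h ⊓ A) = 1 := by
  have hA := T.one_le_finrank_inf_A hh
  have hC := T.symm.one_le_finrank_inf_A hh.symm
  have hsup : finrank K ↥(h ⊓ A ⊔ h ⊓ C) ≤ finrank K h :=
    Submodule.finrank_mono (sup_le inf_le_left inf_le_left)
  rw [finrank_sup_of_inf_eq_bot (inf_eq_bot_of_le T.inf_eq_bot inf_le_right inf_le_right),
    T.finrank_eq_two hh] at hsup
  omega

theorem inf_sup_inf_eq : h ⊓ A ⊔ h ⊓ C = h :=
  inf_sup_inf_eq_of_finrank_le T.inf_eq_bot (by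
    rw [T.finrank_eq_two hh, T.finrank_inf_A hh, T.symm.finrank_inf_A hh.symm])

theorem finrank_inf_D : finrank K ↥(h ⊓ D) = 1 := by
  have hge := hh.one_le_finrank_inf_D
  have htwo := T.finrank_eq_two hh
  have hlt : h ⊓ D < h := by
    refine lt_of_le_of_ne inf_le_left fun heq => ?_
    obtain ⟨p, hp, w, hw, hy, h0, rfl, -⟩ := hh
    refine (T.proj_notMem p hp w hw hy h0).1 (inf_eq_left.1 heq ?_)
    exact Submodule.mem_sup_left (Submodule.mem_span_singleton_self p)
  have := Submodule.finrank_lt_finrank_of_lt hlt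
  omega

theorem finrank_D_sup : finrank K ↥(D ⊔ h) = finrank K D + 1 := by
  have hmod := Submodule.finrank_sup_add_finrank_inf_eq D h
  rw [inf_comm, T.finrank_inf_D hh, T.finrank_eq_two hh] at hmod
  omega

theorem finrank_D_sup_inf_crossSpace : finrank K ↥((D ⊔ h) ⊓ crossSpace A C B) = 3 := by
  rw [sup_comm, sup_inf_assoc_of_le _ hh.le_crossSpace, inf_comm D]
  have hmod := Submodule.finrank_sup_add_finrank_inf_eq h (crossSpace A C B ⊓ D)
  rw [← inf_assoc, inf_eq_left.2 hh.le_crossSpace, T.finrank_inf_D hh, T.finrank_eq_two hh,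
    T.finrank_crossSpace_inf_D] at hmod
  omega

theorem proj_not_le : ¬ A ⊓ (B ⊔ C) ≤ D ⊔ h := fun hle => by
  have hmono : finrank K ↥(A ⊓ (B ⊔ C) ⊔ crossSpace A C B ⊓ D) ≤
      finrank K ↥((D ⊔ h) ⊓ crossSpace A C B) :=
    Submodule.finrank_mono (le_inf (sup_le hle (inf_le_right.trans le_sup_left))
      (sup_le le_sup_left inf_le_left))
  rw [T.finrank_D_sup_inf_crossSpace hh, T.finrank_proj_sup_crossSpace_inf_D,
    T.finrank_crossSpace_inf_D] at hmono
  omega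

theorem finrank_inf_D_sup {S : Submodule K E} (hS : ¬ S ≤ D ⊔ h) :
    finrank K ↥(S ⊓ (D ⊔ h)) + 1 = finrank K S := by
  have hsup := T.finrank_D_sup hh
  have hD := T.finrank_D
  have hE := T.finrank_total
  have hinf := finrank_inf_add_finrank_of_sup_eq_top
    (sup_eq_top_of_not_le (T := D ⊔ h) (by omega) hS)
  omega

theorem finrank_A_inf : finrank K ↥(A ⊓ (D ⊔ h)) + 1 = m := by
  rw [T.finrank_inf_D_sup hh fun hle => T.proj_not_le hh (inf_le_left.trans hle), T.finrank_A]

theorem finrank_liftSpace_inf_A : finrank K ↥(liftSpace A C D h ⊓ A) + 1 = m := by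
  rw [liftSpace_inf_left T.inf_eq_bot, T.finrank_A_inf hh]

theorem finrank_liftSpace : finrank K (liftSpace A C D h) + 2 = b + m := by
  have hA := T.finrank_A_inf hh
  have hC := T.symm.finrank_A_inf hh.symm
  rw [liftSpace, finrank_sup_of_inf_eq_bot
    (inf_eq_bot_of_le T.inf_eq_bot inf_le_left inf_le_left)]
  omega

theorem D_sup_inf_proj_eq : A ⊓ (D ⊔ h) ⊓ (A ⊓ (B ⊔ C)) = h ⊓ A := by
  have hle : h ⊓ A ≤ A ⊓ (D ⊔ h) ⊓ (A ⊓ (B ⊔ C)) :=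
    le_inf (le_inf inf_le_right (inf_le_left.trans le_sup_right))
      (crossSpace_inf_left T.inf_eq_bot ▸ inf_le_inf_right A hh.le_crossSpace)
  have hproj := T.finrank_inf_D_sup hh (T.proj_not_le hh)
  rw [T.finrank_proj] at hproj
  have hmono := Submodule.finrank_mono (s := A ⊓ (D ⊔ h) ⊓ (A ⊓ (B ⊔ C)))
    (t := A ⊓ (B ⊔ C) ⊓ (D ⊔ h)) (le_inf inf_le_right (inf_le_left.trans inf_le_right))
  refine (Submodule.eq_of_le_of_finrank_le hle ?_).symm
  rw [T.finrank_inf_A hh]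
  omega

theorem liftSpace_inf_crossSpace : liftSpace A C D h ⊓ crossSpace A C B = h := by
  rw [liftSpace, crossSpace,
    sup_inf_sup_eq_of_le T.inf_eq_bot inf_le_left inf_le_left inf_le_left inf_le_left,
    T.D_sup_inf_proj_eq hh, T.symm.D_sup_inf_proj_eq hh.symm, T.inf_sup_inf_eq hh]

theorem le_liftSpace : h ≤ liftSpace A C D h :=
  (T.liftSpace_inf_crossSpace hh).ge.trans inf_le_left

theorem liftSpace_map_mkQ : (liftSpace A C D h).map (crossSpace A C B).mkQ = ⊤ := by
  have hmod := Submodule.finrank_sup_add_finrank_inf_eq (liftSpace A C D h) (crossSpace A C B)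
  have hlift := T.finrank_liftSpace hh
  have hE := T.finrank_total
  rw [T.liftSpace_inf_crossSpace hh, T.finrank_eq_two hh, T.finrank_crossSpace] at hmod
  rw [Submodule.map_mkQ_eq_top, sup_comm]
  apply Submodule.eq_top_of_finrank_eq
  omega

end Transversal

theorem isTransversal_of_finrank (h2 : finrank K h = 2)
    (hA : 1 ≤ finrank K ↥(h ⊓ A)) (hC : 1 ≤ finrank K ↥(h ⊓ C)) (hB : 1 ≤ finrank K ↥(h ⊓ B))
    (hD : 1 ≤ finrank K ↥(h ⊓ D)) : IsTransversal A C B D h := by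
  have hdec := inf_sup_inf_eq_of_finrank_le T.inf_eq_bot (H := h) (by omega)
  obtain ⟨y, ⟨hyh, hyB⟩, hy0⟩ := exists_ne_zero_of_one_le_finrank hB
  rw [← hdec] at hyh
  obtain ⟨p, ⟨hph, hp⟩, w, ⟨hwh, hw⟩, rfl⟩ := Submodule.mem_sup.1 hyh
  obtain ⟨hp0, hw0⟩ := T.proj_ne_zero hp hw hyB hy0
  refine ⟨p, hp, w, hw, hyB, hy0, ?_, Submodule.one_le_finrank_iff.1 hD⟩
  have hle : Submodule.span K {p} ⊔ Submodule.span K {w} ≤ h :=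
    sup_le (by simpa using hph) (by simpa using hwh)
  refine (Submodule.eq_of_le_of_finrank_eq hle ?_).symm
  rw [finrank_span_sup_span T.inf_eq_bot hp hw hp0 hw0, h2]

theorem isTransversal_iff_finrank : IsTransversal A C B D h ↔ finrank K h = 2 ∧
    1 ≤ finrank K ↥(h ⊓ A) ∧ 1 ≤ finrank K ↥(h ⊓ C) ∧ 1 ≤ finrank K ↥(h ⊓ B) ∧
      1 ≤ finrank K ↥(h ⊓ D) :=
  ⟨fun hh => ⟨T.finrank_eq_two hh, T.one_le_finrank_inf_A hh,
      T.symm.one_le_finrank_inf_A hh.symm, hh.one_le_finrank_inf_B, hh.one_le_finrank_inf_D⟩,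
    fun ⟨h2, hA, hC, hB, hD⟩ => T.isTransversal_of_finrank h2 hA hC hB hD⟩

section BigProblem

variable {H : Submodule K E} (hdec : H ⊓ A ⊔ H ⊓ C = H)
  (hD : finrank K H ≤ finrank K ↥(H ⊓ D) + 1)

include hdec hD

theorem exists_isTransversal_le (hB : 1 ≤ finrank K ↥(H ⊓ B)) :
    ∃ h ≤ H, IsTransversal A C B D h := by
  obtain ⟨y, ⟨hyH, hyB⟩, hy0⟩ := exists_ne_zero_of_one_le_finrank hB
  rw [← hdec] at hyH
  obtain ⟨p, ⟨hpH, hp⟩, w, ⟨hwH, hw⟩, rfl⟩ := Submodule.mem_sup.1 hyH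
  obtain ⟨hp0, hw0⟩ := T.proj_ne_zero hp hw hyB hy0
  have hle : Submodule.span K {p} ⊔ Submodule.span K {w} ≤ H :=
    sup_le (by simpa using hpH) (by simpa using hwH)
  refine ⟨_, hle, p, hp, w, hw, hyB, hy0, rfl, Submodule.one_le_finrank_iff.1 ?_⟩
  have htwo := finrank_span_sup_span T.inf_eq_bot hp hw hp0 hw0
  have hinf := finrank_inf_add_le hle D
  omega

theorem le_liftSpace_of_le (hh : IsTransversal A C B D h) (hle : h ≤ H) :
    H ≤ liftSpace A C D h := by
  have hmod := Submodule.finrank_sup_add_finrank_inf_eq D H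
  have hsup := T.finrank_D_sup hh
  have heq : D ⊔ h = D ⊔ H := Submodule.eq_of_le_of_finrank_le (sup_le_sup_left hle D) (by
    rw [inf_comm] at hmod
    omega)
  have hH : H ≤ D ⊔ h := heq ▸ le_sup_right
  conv_lhs => rw [← hdec]
  exact sup_le_sup (le_inf inf_le_right (inf_le_left.trans hH))
    (le_inf inf_le_right (inf_le_left.trans hH))

theorem exists_isTransversal (hB : 1 ≤ finrank K ↥(H ⊓ B)) :
    ∃ h, IsTransversal A C B D h ∧ H ⊓ crossSpace A C B = h ∧ H ≤ liftSpace A C D h := by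
  obtain ⟨h, hle, hh⟩ := T.exists_isTransversal_le hdec hD hB
  have hH := T.le_liftSpace_of_le hdec hD hh hle
  exact ⟨h, hh, le_antisymm ((inf_le_inf_right _ hH).trans (T.liftSpace_inf_crossSpace hh).le)
    (le_inf hle hh.le_crossSpace), hH⟩

end BigProblem

end IsTransverse

end Position

/-! ### Schubert conditions -/

section SchubertConditions

variable {E W : Type*} [AddCommGroup E] [Module ℂ E] [FiniteDimensional ℂ E]
  [AddCommGroup W] [Module ℂ W] [FiniteDimensional ℂ W]

namespace CompleteFlag

/-- The dimension of `H ∩ Fₜ`, as a function of `t`. -/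
def meetDim (F : CompleteFlag E) (H : Submodule ℂ E) (t : ℕ) : ℕ :=
  finrank ℂ ↥(H ⊓ F.space t)

variable (F : CompleteFlag E) (H : Submodule ℂ E)

theorem add_le_meetDim {t : ℕ} (ht : t ≤ finrank ℂ E) :
    finrank ℂ H + t ≤ F.meetDim H t + finrank ℂ E := by
  have hinf := finrank_add_le_finrank_inf_add H (F.space t)
  rwa [F.finrank_space, min_eq_left ht] at hinf

theorem meetDim_mono {t u : ℕ} (h : t ≤ u) : F.meetDim H t ≤ F.meetDim H u :=
  Submodule.finrank_mono (inf_le_inf_left _ (F.mono h))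

theorem meetDim_succ_le (t : ℕ) : F.meetDim H (t + 1) ≤ F.meetDim H t + 1 := by
  have hinf := finrank_inf_add_le (F.mono (Nat.le_add_right t 1)) H
  have hspace := F.finrank_space_succ_le t
  rw [meetDim, meetDim, inf_comm H, inf_comm H]
  omega

/-- The condition that the row `p j` of `p` imposes on the `k`-planes of a Schubert variety. -/
def MeetsRow (k : ℕ) (p : ℕ → ℕ) (j : ℕ) : Prop :=
  j + 1 ≤ F.meetDim H (finrank ℂ E - k + (j + 1) - p j)

end CompleteFlag

open CompleteFlag

variable {k a : ℕ} {p q : ℕ → ℕ} {F : CompleteFlag E} {G : CompleteFlag W} {H : Submodule ℂ E}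
  {K : Submodule ℂ W}

theorem le_meetDim_of_mem_schubertVariety (h : H ∈ schubertVariety k p F) {j t : ℕ} (hj : j < k)
    (ht : finrank ℂ E - k + (j + 1) - p j = t) : j + 1 ≤ F.meetDim H t :=
  ht ▸ h.2 j hj

theorem meetsRow_of_eq_zero (hH : finrank ℂ H = k) {j : ℕ} (hj : j < k) (hp : p j = 0) :
    F.MeetsRow H k p j := by
  have hle := H.finrank_le
  have hinf := F.add_le_meetDim H (t := finrank ℂ E - k + (j + 1)) (by omega)
  rw [MeetsRow, hp, Nat.sub_zero]
  omega

theorem mem_schubertVariety_iff_of_meetsRow_add {r d : ℕ} (hH : finrank ℂ H = k)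
    (hK : finrank ℂ K = a) (hr : r ≤ a) (hk : a + d ≤ k) (hq : ∀ j, r ≤ j → q j = 0)
    (hrow : ∀ j < r, G.MeetsRow K a q j ↔ F.MeetsRow H k p (j + d))
    (hfirst : K ∈ schubertVariety a q G → ∀ j < d, F.MeetsRow H k p j)
    (hlast : K ∈ schubertVariety a q G → ∀ j < k, r + d ≤ j → F.MeetsRow H k p j) :
    H ∈ schubertVariety k p F ↔ K ∈ schubertVariety a q G := by
  constructor
  · refine fun h => ⟨hK, fun j hj => ?_⟩
    rcases lt_or_ge j r with hjr | hjr
    · exact (hrow j hjr).2 (h.2 _ (by omega))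
    · exact meetsRow_of_eq_zero hK hj (hq j hjr)
  · refine fun h => ⟨hH, fun j hj => ?_⟩
    rcases lt_or_ge j d with hjd | hjd
    · exact hfirst h j hjd
    · rcases lt_or_ge j (r + d) with hjr | hjr
      · obtain ⟨i, rfl⟩ := Nat.exists_eq_add_of_le' hjd
        exact (hrow i (by omega)).1 (h.2 i (by omega))
      · exact hlast h j hj hjr

theorem eq_zero_of_antitone_of_le {f : ℕ → ℕ} (hf : Antitone f) {m n : ℕ} (hm : f m = 0)
    (h : m ≤ n) : f n = 0 :=
  Nat.le_zero.1 ((hf h).trans_eq hm)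

section Rows

variable {b : ℕ} (hab : a < b) (hE : finrank ℂ E = b + 4) (hW : finrank ℂ W = b)
  (hH : finrank ℂ H = 2 + a) (hK : finrank ℂ K = a)

include hab hE hW hH hK

theorem mem_schubertVariety_prependRows_two (ha : 0 < a) {κ : ℕ → ℕ} (hκ₁ : κ 0 ≤ b - a - 1)
    (hκ : Antitone κ) (hκa : κ (a - 1) = 0) (h4 : G.meetDim K 2 + 1 = F.meetDim H 4)
    (hrel : ∀ m, 5 ≤ m → m ≤ b + 2 → G.meetDim K (m - 3) + 1 = F.meetDim H m) :
    H ∈ schubertVariety (2 + a) (prependRows 2 (b - a) κ) F ↔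
      K ∈ schubertVariety a (prependRows 1 (b - a - 1) κ) G := by
  have hfour : G.MeetsRow K a (prependRows 1 (b - a - 1) κ) 0 ↔ 2 ≤ F.meetDim H 4 := by
    rw [MeetsRow, hW, prependRows, if_pos (by omega),
      show b - a + (0 + 1) - (b - a - 1) = 2 by omega]
    omega
  have hκ0 {j : ℕ} (hj : a - 1 ≤ j) : κ j = 0 := eq_zero_of_antitone_of_le hκ hκa hj
  refine mem_schubertVariety_iff_of_meetsRow_add (d := 1) hH hK le_rfl (by omega)
    (fun j hj => ?_) (fun j hj => ?_) (fun h j hj => ?_)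
    (fun _ j hj hja => meetsRow_of_eq_zero hH hj ?_)
  · rw [prependRows, if_neg (by omega), hκ0 (by omega)]
  · rcases j with _ | i
    · rw [hfour, MeetsRow, hE, prependRows, if_pos (by omega),
        show b + 4 - (2 + a) + (0 + 1 + 1) - (b - a) = 4 by omega]
    · by_cases hκi : κ i = 0
      · exact iff_of_true (meetsRow_of_eq_zero hK hj hκi) (meetsRow_of_eq_zero hH (by omega) hκi)
      · have hi := hκ (Nat.zero_le i)
        have := hrel (b + 4 - (2 + a) + (i + 1 + 1 + 1) - κ i) (by omega) (by omega)
        rw [MeetsRow, MeetsRow, hE, hW, prependRows, prependRows, if_neg (by omega),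
          if_neg (by omega), show i + 1 - 1 = i by omega, show i + 1 + 1 - 2 = i by omega, ← this,
          show b + 4 - (2 + a) + (i + 1 + 1 + 1) - κ i - 3 = b - a + (i + 1 + 1) - κ i by omega]
        omega
  · have hle := hfour.1 (h.2 0 ha)
    have hsucc : F.meetDim H 4 ≤ F.meetDim H 3 + 1 := F.meetDim_succ_le H 3
    rw [MeetsRow, hE, prependRows, if_pos (by omega),
      show b + 4 - (2 + a) + (j + 1) - (b - a) = 3 by omega]
    omega
  · rw [prependRows, if_neg (by omega), hκ0 (by omega)]

theorem mem_schubertVariety_prependRows_one {ν : ℕ → ℕ} (hν : Antitone ν) (hν₁ : ν 0 ≤ b - a)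
    (hνa : ν a = 0) (h2 : 1 ≤ F.meetDim H 2)
    (hrel : ∀ m, 3 ≤ m → m ≤ b + 2 → G.meetDim K (m - 3) + 1 = F.meetDim H m) :
    H ∈ schubertVariety (2 + a) (prependRows 1 (b - a + 1) ν) F ↔ K ∈ schubertVariety a ν G := by
  have hν0 {j : ℕ} (hj : a ≤ j) : ν j = 0 := eq_zero_of_antitone_of_le hν hνa hj
  refine mem_schubertVariety_iff_of_meetsRow_add (d := 1) hH hK le_rfl (by omega)
    (fun _ hj => hν0 hj) (fun j hj => ?_) (fun _ j hj => ?_)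
    (fun _ j hj hja => meetsRow_of_eq_zero hH hj ?_)
  · by_cases hνj : ν j = 0
    · exact iff_of_true (meetsRow_of_eq_zero hK hj hνj) (meetsRow_of_eq_zero hH (by omega) hνj)
    · have hj0 := hν (Nat.zero_le j)
      have := hrel (b + 4 - (2 + a) + (j + 1 + 1) - ν j) (by omega) (by omega)
      rw [MeetsRow, MeetsRow, hE, hW, prependRows, if_neg (by omega), Nat.add_sub_cancel, ← this,
        show b + 4 - (2 + a) + (j + 1 + 1) - ν j - 3 = b - a + (j + 1) - ν j by omega]
      omega
  · rwa [Nat.lt_one_iff.1 hj, MeetsRow, hE, prependRows, if_pos (by omega),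
      show b + 4 - (2 + a) + (0 + 1) - (b - a + 1) = 2 by omega]
  · rw [prependRows, if_neg (by omega), hν0 (by omega)]

theorem mem_schubertVariety_rect_two_add (ha : 0 < a) {ρ : ℕ → ℕ} (hρ : Antitone ρ)
    (hρ₁ : 1 < a → ρ 0 + 1 ≤ b - a) (hρa : ρ (a - 1) = 0)
    (hb : G.meetDim K (b - 2) + 1 = F.meetDim H b)
    (hrel : ∀ m, 1 ≤ m → m ≤ b - 1 → G.meetDim K (m - 1) = F.meetDim H m) :
    H ∈ schubertVariety (2 + a) (rect a 2 + ρ) F ↔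
      K ∈ schubertVariety a (rect (a - 1) 1 + ρ) G := by
  have hρ0 {j : ℕ} (hj : a - 1 ≤ j) : ρ j = 0 := eq_zero_of_antitone_of_le hρ hρa hj
  refine mem_schubertVariety_iff_of_meetsRow_add (r := a - 1) (d := 0) hH hK (by omega) (by omega)
    (fun j hj => ?_) (fun j hj => ?_) (fun _ j hj => absurd hj j.not_lt_zero) (fun h j hj hja => ?_)
  · rw [Pi.add_apply, rect, if_neg (by omega), hρ0 hj]
  · have hj0 := hρ (Nat.zero_le j)
    have hρ1 := hρ₁ (by omega)
    rw [MeetsRow, MeetsRow, hE, hW, add_zero, Pi.add_apply, Pi.add_apply, rect, rect,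
      if_pos (by omega), if_pos (by omega), ← hrel _ (by omega) (by omega),
      show b + 4 - (2 + a) + (j + 1) - (2 + ρ j) - 1 = b - a + (j + 1) - (1 + ρ j) by omega]
  · rcases hja.eq_or_lt with rfl | hja
    · rw [MeetsRow, hE, Pi.add_apply, rect, if_pos (by omega), add_zero, hρa,
        show b + 4 - (2 + a) + (a - 1 + 1) - (2 + 0) = b by omega, ← hb]
      by_cases ha1 : a = 1
      · omega
      · have hlast : G.MeetsRow K a (rect (a - 1) 1 + ρ) (a - 2) := h.2 (a - 2) (by omega)
        rw [MeetsRow, hW, Pi.add_apply, rect, if_pos (by omega)] at hlast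
        have hmono := G.meetDim_mono K
          (show b - a + (a - 2 + 1) - (1 + ρ (a - 2)) ≤ b - 2 by omega)
        omega
    · refine meetsRow_of_eq_zero hH hj ?_
      rw [Pi.add_apply, rect, if_neg (by omega), hρ0 (by omega)]

theorem mem_schubertVariety_rect_one_add {ν : ℕ → ℕ} (hν : Antitone ν) (hν₁ : ν 0 ≤ b - a)
    (hνa : ν a = 0) (hb : a + 1 ≤ F.meetDim H (b + 2))
    (hrel : ∀ m, 1 ≤ m → m ≤ b + 1 → G.meetDim K (m - 1) = F.meetDim H m) :
    H ∈ schubertVariety (2 + a) (rect (a + 1) 1 + ν) F ↔ K ∈ schubertVariety a ν G := by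
  have hν0 {j : ℕ} (hj : a ≤ j) : ν j = 0 := eq_zero_of_antitone_of_le hν hνa hj
  refine mem_schubertVariety_iff_of_meetsRow_add (d := 0) hH hK le_rfl (by omega)
    (fun _ hj => hν0 hj) (fun j hj => ?_) (fun _ j hj => absurd hj j.not_lt_zero)
    (fun _ j hj hja => ?_)
  · have hj0 := hν (Nat.zero_le j)
    rw [MeetsRow, MeetsRow, hE, hW, Pi.add_apply, rect, if_pos (by omega), add_zero,
      ← hrel _ (by omega) (by omega),
      show b + 4 - (2 + a) + (j + 1) - (1 + ν j) - 1 = b - a + (j + 1) - ν j by omega]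
  · rcases hja.eq_or_lt with rfl | hja
    · rwa [MeetsRow, hE, Pi.add_apply, rect, if_pos (by omega), add_zero, hνa,
        show b + 4 - (2 + a) + (a + 1) - (1 + 0) = b + 2 by omega]
    · refine meetsRow_of_eq_zero hH hj ?_
      rw [Pi.add_apply, rect, if_neg (by omega), hν0 (by omega)]

theorem mem_schubertVariety_same {ν : ℕ → ℕ} (hν : Antitone ν) (hν₁ : ν 0 ≤ b - a)
    (hνa : ν a = 0) (hrel : ∀ m, 2 ≤ m → m ≤ b + 2 → G.meetDim K (m - 2) = F.meetDim H m) :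
    H ∈ schubertVariety (2 + a) ν F ↔ K ∈ schubertVariety a ν G := by
  have hν0 {j : ℕ} (hj : a ≤ j) : ν j = 0 := eq_zero_of_antitone_of_le hν hνa hj
  refine mem_schubertVariety_iff_of_meetsRow_add (d := 0) hH hK le_rfl (by omega)
    (fun _ hj => hν0 hj) (fun j hj => ?_) (fun _ j hj => absurd hj j.not_lt_zero)
    (fun _ _ hj hja => meetsRow_of_eq_zero hH hj (hν0 hja))
  have hj0 := hν (Nat.zero_le j)
  rw [MeetsRow, MeetsRow, hE, hW, add_zero, ← hrel _ (by omega) (by omega),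
    show b + 4 - (2 + a) + (j + 1) - ν j - 2 = b - a + (j + 1) - ν j by omega]

end Rows

end SchubertConditions

/-! ### Instances in general position -/

section Quotient

variable {K E : Type*} [DivisionRing K] [AddCommGroup E] [Module K E] {V X h H H' : Submodule K E}

theorem map_subtype_comap_subtype (hV : H ⊓ V = h) : (H.comap V.subtype).map V.subtype = h := by
  rw [Submodule.map_comap_subtype, inf_comm, hV]

theorem map_inf_comap_mkQ (hX : X.map V.mkQ = ⊤) (L : Submodule K (E ⧸ V)) :
    (X ⊓ L.comap V.mkQ).map V.mkQ = L := by
  rw [← Submodule.map_inf_eq_map_inf_comap, hX, top_inf_eq]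

variable (hXV : X ⊓ V = h)

include hXV

theorem mem_of_mkQ_eq (hh : h ≤ H) (hHX : H ≤ X) {x y : E} (hx : x ∈ X) (hy : y ∈ H)
    (hxy : V.mkQ x = V.mkQ y) : x ∈ H := by
  have hsub : x - y ∈ X ⊓ V := ⟨X.sub_mem hx (hHX hy), (Submodule.Quotient.eq V).1 hxy⟩
  rw [hXV] at hsub
  simpa using H.add_mem (hh hsub) hy

theorem le_of_map_mkQ_le (hh : h ≤ H') (hHX : H ≤ X) (hHX' : H' ≤ X)
    (hmap : H.map V.mkQ ≤ H'.map V.mkQ) : H ≤ H' := fun _ hx => by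
  obtain ⟨y, hy, hxy⟩ := hmap (Submodule.mem_map_of_mem hx)
  exact mem_of_mkQ_eq hXV hh hHX' (hHX hx) hy hxy.symm

variable (hh : h ≤ H) (hHX : H ≤ X)

include hh hHX

theorem inf_eq_of_le_of_le : H ⊓ V = h :=
  le_antisymm (hXV ▸ inf_le_inf_right V hHX) (le_inf hh (hXV ▸ inf_le_right))

theorem map_mkQ_inf_map_mkQ (Y : Submodule K E) :
    H.map V.mkQ ⊓ (X ⊓ Y).map V.mkQ = (H ⊓ Y).map V.mkQ := by
  apply le_antisymm
  · rintro _ ⟨⟨x, hx, rfl⟩, y, hy, hxy⟩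
    exact ⟨y, ⟨mem_of_mkQ_eq hXV hh hHX hy.1 hx hxy, hy.2⟩, hxy⟩
  · exact le_inf (Submodule.map_mono inf_le_left) (Submodule.map_mono (inf_le_inf_right Y hHX))

variable [FiniteDimensional K E]

theorem finrank_map_mkQ_inf (Y : Submodule K E) :
    finrank K ((H ⊓ Y).map V.mkQ) + finrank K ↥(h ⊓ Y) = finrank K ↥(H ⊓ Y) := by
  rw [← finrank_map_add_finrank_inf_ker V.mkQ (H ⊓ Y), Submodule.ker_mkQ, inf_right_comm,
    inf_eq_of_le_of_le hXV hh hHX]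

theorem finrank_map_mkQ : finrank K (H.map V.mkQ) + finrank K h = finrank K H := by
  have := finrank_map_mkQ_inf hXV hh hHX ⊤
  rwa [inf_top_eq, inf_top_eq] at this

end Quotient

theorem meetDim_flagOfChain_map {E : Type*} [AddCommGroup E] [Module ℂ E] [FiniteDimensional ℂ E]
    {V X h H : Submodule ℂ E} (hXV : X ⊓ V = h) (hh : h ≤ H) (hHX : H ≤ X) (hX : X.map V.mkQ = ⊤)
    (F : CompleteFlag E) {t d r k : ℕ} (hd : F.meetDim X t + d = t) (hr : F.meetDim h t = r)
    (hk : d + r = k) :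
    (flagOfChain fun t => (X ⊓ F.space t).map V.mkQ).meetDim (H.map V.mkQ) (t - k) + r =
      F.meetDim H t := by
  have hdim : finrank ℂ ((X ⊓ F.space t).map V.mkQ) = t - k := by
    have := finrank_map_mkQ_inf hXV (hh.trans hHX) le_rfl (F.space t)
    rw [CompleteFlag.meetDim] at hd hr
    omega
  rw [CompleteFlag.meetDim, flagOfChain_space (isFlagChain_map F X V.mkQ hX) hdim,
    map_mkQ_inf_map_mkQ hXV hh hHX, ← hr]
  exact finrank_map_mkQ_inf hXV hh hHX _

section Generic

variable {E : Type*} [AddCommGroup E] [Module ℂ E] [FiniteDimensional ℂ E] {m : ℕ}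

theorem forall_fin_four_add {P : Fin (4 + m) → Prop} :
    (∀ i, P i) ↔ P (Fin.castAdd m 0) ∧ P (Fin.castAdd m 1) ∧ P (Fin.castAdd m 2) ∧
      P (Fin.castAdd m 3) ∧ ∀ j, P (Fin.natAdd 4 j) := by
  constructor
  · exact fun h => ⟨h _, h _, h _, h _, fun _ => h _⟩
  · rintro ⟨h0, h1, h2, h3, h⟩ i
    induction i using Fin.addCases with
    | left i => fin_cases i <;> assumption
    | right j => exact h j

/-- The four-dimensional space of the first flag. -/
def spaceA (F : Fin (4 + m) → CompleteFlag E) : Submodule ℂ E := (F (Fin.castAdd m 0)).space 4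

/-- The `b`-dimensional space of the second flag. -/
def spaceC (b : ℕ) (F : Fin (4 + m) → CompleteFlag E) : Submodule ℂ E :=
  (F (Fin.castAdd m 1)).space b

/-- The two-dimensional space of the third flag. -/
def spaceB (F : Fin (4 + m) → CompleteFlag E) : Submodule ℂ E := (F (Fin.castAdd m 2)).space 2

/-- The `(b + 2)`-dimensional space of the fourth flag. -/
def spaceD (b : ℕ) (F : Fin (4 + m) → CompleteFlag E) : Submodule ℂ E :=
  (F (Fin.castAdd m 3)).space (b + 2)

/-- The four-dimensional space `V` of a generic tuple of flags. -/
def baseSpace (b : ℕ) (F : Fin (4 + m) → CompleteFlag E) : Submodule ℂ E :=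
  crossSpace (spaceA F) (spaceC b F) (spaceB F)

/-- The space that contains all solutions whose intersection with `V` is `h`. -/
def solutionSpan (b : ℕ) (F : Fin (4 + m) → CompleteFlag E) (h : Submodule ℂ E) :
    Submodule ℂ E :=
  liftSpace (spaceA F) (spaceC b F) (spaceD b F) h

/-- The planes in `V` that solve the base problem, as subspaces of `E`. -/
def IsBaseSolution (b : ℕ) (F : Fin (4 + m) → CompleteFlag E) (h : Submodule ℂ E) : Prop :=
  IsTransversal (spaceA F) (spaceC b F) (spaceB F) (spaceD b F) h

/-- For all `t` from `lo` to `hi`, the space `Fₜ` meets `X` in codimension `d` (in `Fₜ`) and `h` in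
dimension `r`. -/
def HasProfile (F : CompleteFlag E) (X h : Submodule ℂ E) (lo hi d r : ℕ) : Prop :=
  ∀ t, lo ≤ t → t ≤ hi → F.meetDim X t + d = t ∧ F.meetDim h t = r

/-- Tuples of flags in general position: those for which the conditions of the big problem
translate into conditions on `H ∩ V` and `H / (H ∩ V)`. -/
structure IsGeneric (b : ℕ) (F : Fin (4 + m) → CompleteFlag E) : Prop where
  transverse : IsTransverse 4 b (spaceA F) (spaceC b F) (spaceB F) (spaceD b F)
  profile₁ : ∀ h, IsBaseSolution b F h →
    HasProfile (F (Fin.castAdd m 0)) (solutionSpan b F h) h 5 (b + 2) 2 1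
  profile₂ : ∀ h, IsBaseSolution b F h →
    HasProfile (F (Fin.castAdd m 1)) (solutionSpan b F h) h 1 (b - 1) 1 0
  profile₃ : ∀ h, IsBaseSolution b F h →
    HasProfile (F (Fin.castAdd m 2)) (solutionSpan b F h) h 3 (b + 2) 2 1
  profile₄ : ∀ h, IsBaseSolution b F h →
    HasProfile (F (Fin.castAdd m 3)) (solutionSpan b F h) h 1 (b + 1) 1 0
  profile : ∀ h, IsBaseSolution b F h → ∀ j,
    HasProfile (F (Fin.natAdd 4 j)) (solutionSpan b F h) h 2 (b + 2) 2 0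

/-- The flags in `V` formed by the intersections with `V`. -/
def baseFlags (F : Fin (4 + m) → CompleteFlag E) (V : Submodule ℂ E) (i : Fin 4) :
    CompleteFlag V :=
  flagOfChain fun t => ((F (Fin.castAdd m i)).space t).comap V.subtype

/-- The flags in `E/V` formed by the images of the intersections with `solutionSpan b F h`. -/
def fiberFlags (b : ℕ) (F : Fin (4 + m) → CompleteFlag E) (V h : Submodule ℂ E)
    (i : Fin (4 + m)) : CompleteFlag (E ⧸ V) :=
  flagOfChain fun t => (solutionSpan b F h ⊓ (F i).space t).map V.mkQ

/-- The instances induced on a subspace `V` and on the quotient by `V`. -/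
def inducedOn (b : ℕ) (F : Fin (4 + m) → CompleteFlag E) (V : Submodule ℂ E) :
    InducedInstances E 4 (4 + m) where
  V := V
  base := baseFlags F V
  fiber h := fiberFlags b F V (h.map V.subtype)

/-- The partitions of the problem in `Gr(2 + a, 4 + b)`. -/
def totalProblem (a b : ℕ) (κ ρ ν₃ ν₄ : ℕ → ℕ) (τ : Fin m → ℕ → ℕ) : Fin (4 + m) → ℕ → ℕ :=
  Fin.append ![prependRows 2 (b - a) κ, rect a 2 + ρ,
    prependRows 1 (b - a + 1) ν₃, rect (a + 1) 1 + ν₄] τ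

/-- The partitions of the problem in `Gr(a, b)`. -/
def fiberProblem (a b : ℕ) (κ ρ ν₃ ν₄ : ℕ → ℕ) (τ : Fin m → ℕ → ℕ) : Fin (4 + m) → ℕ → ℕ :=
  Fin.append ![prependRows 1 (b - a - 1) κ, rect (a - 1) 1 + ρ, ν₃, ν₄] τ

/-- The bounds on the partitions that form the fiber problem. -/
structure FiberBounds (a b : ℕ) (κ ρ ν₃ ν₄ : ℕ → ℕ) (τ : Fin m → ℕ → ℕ) : Prop where
  pos : 0 < a
  lt : a < b
  antitone_κ : Antitone κ
  κ_zero : κ 0 ≤ b - a - 1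
  κ_last : κ (a - 1) = 0
  antitone_ρ : Antitone ρ
  ρ_zero : 1 < a → ρ 0 + 1 ≤ b - a
  ρ_last : ρ (a - 1) = 0
  part₃ : IsPartitionFor a b ν₃
  part₄ : IsPartitionFor a b ν₄
  part : ∀ j, IsPartitionFor a b (τ j)

theorem mem_schubertVariety_rect_one_one_iff {F : CompleteFlag E} {h : Submodule ℂ E}
    (hE : finrank ℂ E = 4) (h2 : finrank ℂ h = 2) :
    h ∈ schubertVariety 2 (rect 1 1) F ↔ 1 ≤ F.meetDim h 2 := by
  refine ⟨fun hh => le_meetDim_of_mem_schubertVariety hh zero_lt_two (by rw [hE]; rfl),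
    fun hle => ⟨h2, fun j hj => ?_⟩⟩
  obtain rfl | rfl : j = 0 ∨ j = 1 := by omega
  · rw [hE]
    exact hle
  · exact meetsRow_of_eq_zero h2 hj rfl

theorem meetDim_baseFlags (F : Fin (4 + m) → CompleteFlag E) (V : Submodule ℂ E)
    (h : Submodule ℂ V) (i : Fin 4) {t d : ℕ}
    (ht : finrank ℂ ↥(V ⊓ (F (Fin.castAdd m i)).space t) = d) :
    (baseFlags F V i).meetDim h d = (F (Fin.castAdd m i)).meetDim (h.map V.subtype) t := by
  rw [CompleteFlag.meetDim, baseFlags, flagOfChain_space (isFlagChain_comap_subtype _ V)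
    (by rw [finrank_comap_subtype, inf_comm, ht]), CompleteFlag.meetDim,
    Submodule.map_inf_eq_map_inf_comap, Submodule.finrank_map_subtype_eq]

namespace IsGeneric

variable {a b : ℕ} {κ ρ ν₃ ν₄ : ℕ → ℕ} {τ : Fin m → ℕ → ℕ} {F : Fin (4 + m) → CompleteFlag E}
  (hF : IsGeneric b F)

include hF

theorem finrank_baseSpace : finrank ℂ (baseSpace b F) = 4 :=
  hF.transverse.finrank_crossSpace

theorem finrank_quotient : finrank ℂ (E ⧸ baseSpace b F) = b := by
  have := Submodule.finrank_quotient_add_finrank (baseSpace b F)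
  rw [hF.finrank_baseSpace, hF.transverse.finrank_total] at this
  omega

theorem mem_solutions_base_iff (h : Submodule ℂ (baseSpace b F)) :
    h ∈ solutions 2 (fun _ : Fin 4 => rect 1 1) (baseFlags F (baseSpace b F)) ↔
      IsBaseSolution b F (h.map (baseSpace b F).subtype) := by
  have T := hF.transverse
  rw [IsBaseSolution, T.isTransversal_iff_finrank, Submodule.finrank_map_subtype_eq]
  refine and_congr_right fun h2 => ?_
  have hmem (i : Fin 4) (t : ℕ)
      (ht : finrank ℂ ↥(baseSpace b F ⊓ (F (Fin.castAdd m i)).space t) = 2) :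
      h ∈ schubertVariety 2 (rect 1 1) (baseFlags F (baseSpace b F) i) ↔
        1 ≤ (F (Fin.castAdd m i)).meetDim (h.map (baseSpace b F).subtype) t := by
    rw [mem_schubertVariety_rect_one_one_iff hF.finrank_baseSpace h2, meetDim_baseFlags F _ h i ht]
  have hA := hmem 0 4 ((crossSpace_inf_left T.inf_eq_bot).symm ▸ T.finrank_proj)
  have hC := hmem 1 b ((crossSpace_inf_right T.inf_eq_bot).symm ▸ T.symm.finrank_proj)
  have hB := hmem 2 2 ((inf_eq_right.2 T.B_le_crossSpace).symm ▸ T.finrank_B)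
  have hD := hmem 3 (b + 2) T.finrank_crossSpace_inf_D
  refine ⟨fun hh => ⟨hA.1 (hh 0), hC.1 (hh 1), hB.1 (hh 2), hD.1 (hh 3)⟩, ?_⟩
  rintro ⟨h0, h1, h2, h3⟩ i
  fin_cases i
  exacts [hA.2 h0, hC.2 h1, hB.2 h2, hD.2 h3]

theorem solutionSpan_inf {h : Submodule ℂ E} (hh : IsBaseSolution b F h) :
    solutionSpan b F h ⊓ baseSpace b F = h :=
  hF.transverse.liftSpace_inf_crossSpace hh

theorem map_solutionSpan {h : Submodule ℂ E} (hh : IsBaseSolution b F h) :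
    (solutionSpan b F h).map (baseSpace b F).mkQ = ⊤ :=
  hF.transverse.liftSpace_map_mkQ hh

section FixedBaseSolution

variable (hB : FiberBounds a b κ ρ ν₃ ν₄ τ) {h H : Submodule ℂ E} (hh : IsBaseSolution b F h)
  (hH : h ≤ H) (hHX : H ≤ solutionSpan b F h)

include hh hH hHX

theorem finrank_map_add_two :
    finrank ℂ (H.map (baseSpace b F).mkQ) + 2 = finrank ℂ H := by
  rw [← finrank_map_mkQ (hF.solutionSpan_inf hh) hH hHX, hF.transverse.finrank_eq_two hh]

theorem meetDim_fiberFlags (i) {t d r k : ℕ} (hd : (F i).meetDim (solutionSpan b F h) t + d = t)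
    (hr : (F i).meetDim h t = r) (hk : d + r = k) :
    (fiberFlags b F (baseSpace b F) h i).meetDim (H.map (baseSpace b F).mkQ) (t - k) + r =
      (F i).meetDim H t :=
  meetDim_flagOfChain_map (hF.solutionSpan_inf hh) hH hHX (hF.map_solutionSpan hh) (F i) hd hr hk

theorem meetDim_fiberFlags_of_hasProfile (i) {lo hi d r : ℕ}
    (hp : HasProfile (F i) (solutionSpan b F h) h lo hi d r) {k : ℕ} (hk : d + r = k) (t : ℕ)
    (hlo : lo ≤ t) (hhi : t ≤ hi) :
    (fiberFlags b F (baseSpace b F) h i).meetDim (H.map (baseSpace b F).mkQ) (t - k) + r =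
      (F i).meetDim H t :=
  hF.meetDim_fiberFlags hh hH hHX i (hp t hlo hhi).1 (hp t hlo hhi).2 hk

variable (hH2 : finrank ℂ H = 2 + a)

include hH2

theorem finrank_map_eq : finrank ℂ (H.map (baseSpace b F).mkQ) = a := by
  have := hF.finrank_map_add_two hh hH hHX
  omega

include hB

theorem mem_schubertVariety_total_iff₁ :
    H ∈ schubertVariety (2 + a) (prependRows 2 (b - a) κ) (F (Fin.castAdd m 0)) ↔
      H.map (baseSpace b F).mkQ ∈ schubertVariety a (prependRows 1 (b - a - 1) κ)
        (fiberFlags b F (baseSpace b F) h (Fin.castAdd m 0)) := by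
  have T := hF.transverse
  have hA := hF.meetDim_fiberFlags hh hH hHX (Fin.castAdd m 0) (T.finrank_liftSpace_inf_A hh)
    (T.finrank_inf_A hh) rfl
  exact mem_schubertVariety_prependRows_two hB.lt T.finrank_total hF.finrank_quotient hH2
    (hF.finrank_map_eq hh hH hHX hH2) hB.pos hB.κ_zero hB.antitone_κ hB.κ_last hA
    (hF.meetDim_fiberFlags_of_hasProfile hh hH hHX _ (hF.profile₁ h hh) rfl)

theorem mem_schubertVariety_total_iff₂ :
    H ∈ schubertVariety (2 + a) (rect a 2 + ρ) (F (Fin.castAdd m 1)) ↔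
      H.map (baseSpace b F).mkQ ∈ schubertVariety a (rect (a - 1) 1 + ρ)
        (fiberFlags b F (baseSpace b F) h (Fin.castAdd m 1)) := by
  have T := hF.transverse
  have hC := hF.meetDim_fiberFlags hh hH hHX (Fin.castAdd m 1) (d := 1)
    (by
      rw [solutionSpan, liftSpace_comm]
      exact T.symm.finrank_liftSpace_inf_A hh.symm) (T.symm.finrank_inf_A hh.symm) rfl
  exact mem_schubertVariety_rect_two_add hB.lt T.finrank_total hF.finrank_quotient hH2
    (hF.finrank_map_eq hh hH hHX hH2) hB.pos hB.antitone_ρ hB.ρ_zero hB.ρ_last hC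
    (hF.meetDim_fiberFlags_of_hasProfile hh hH hHX _ (hF.profile₂ h hh) rfl)

theorem mem_schubertVariety_total_iff₃ :
    H ∈ schubertVariety (2 + a) (prependRows 1 (b - a + 1) ν₃) (F (Fin.castAdd m 2)) ↔
      H.map (baseSpace b F).mkQ ∈ schubertVariety a ν₃
        (fiberFlags b F (baseSpace b F) h (Fin.castAdd m 2)) :=
  mem_schubertVariety_prependRows_one hB.lt hF.transverse.finrank_total hF.finrank_quotient hH2
    (hF.finrank_map_eq hh hH hHX hH2) hB.part₃.1 hB.part₃.2.1 hB.part₃.2.2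
    (hh.one_le_finrank_inf_B.trans (Submodule.finrank_mono (inf_le_inf_right _ hH)))
    (hF.meetDim_fiberFlags_of_hasProfile hh hH hHX _ (hF.profile₃ h hh) rfl)

theorem mem_schubertVariety_total_iff₄ :
    H ∈ schubertVariety (2 + a) (rect (a + 1) 1 + ν₄) (F (Fin.castAdd m 3)) ↔
      H.map (baseSpace b F).mkQ ∈ schubertVariety a ν₄
        (fiberFlags b F (baseSpace b F) h (Fin.castAdd m 3)) := by
  have T := hF.transverse
  have hD : a + 1 ≤ (F (Fin.castAdd m 3)).meetDim H (b + 2) := by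
    have hmod := Submodule.finrank_sup_add_finrank_inf_eq H (spaceD b F)
    have hsup : finrank ℂ ↥(H ⊔ spaceD b F) ≤ finrank ℂ (spaceD b F) + 1 := by
      rw [← T.finrank_D_sup hh]
      exact Submodule.finrank_mono (sup_le (hHX.trans liftSpace_le) le_sup_left)
    change a + 1 ≤ finrank ℂ ↥(H ⊓ spaceD b F)
    omega
  exact mem_schubertVariety_rect_one_add hB.lt T.finrank_total hF.finrank_quotient hH2
    (hF.finrank_map_eq hh hH hHX hH2) hB.part₄.1 hB.part₄.2.1 hB.part₄.2.2 hD
    (hF.meetDim_fiberFlags_of_hasProfile hh hH hHX _ (hF.profile₄ h hh) rfl)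

theorem mem_schubertVariety_total_iff (j : Fin m) :
    H ∈ schubertVariety (2 + a) (τ j) (F (Fin.natAdd 4 j)) ↔
      H.map (baseSpace b F).mkQ ∈ schubertVariety a (τ j)
        (fiberFlags b F (baseSpace b F) h (Fin.natAdd 4 j)) :=
  mem_schubertVariety_same hB.lt hF.transverse.finrank_total hF.finrank_quotient hH2
    (hF.finrank_map_eq hh hH hHX hH2) (hB.part j).1 (hB.part j).2.1 (hB.part j).2.2
    (hF.meetDim_fiberFlags_of_hasProfile hh hH hHX _ (hF.profile h hh j) rfl)

theorem forall_mem_schubertVariety_total_iff :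
    (∀ i, H ∈ schubertVariety (2 + a) (totalProblem a b κ ρ ν₃ ν₄ τ i) (F i)) ↔
      ∀ i, H.map (baseSpace b F).mkQ ∈ schubertVariety a (fiberProblem a b κ ρ ν₃ ν₄ τ i)
        (fiberFlags b F (baseSpace b F) h i) := by
  rw [forall_fin_four_add, forall_fin_four_add]
  simp only [totalProblem, fiberProblem, Fin.append_left, Fin.append_right]
  exact and_congr (hF.mem_schubertVariety_total_iff₁ hB hh hH hHX hH2) <|
    and_congr (hF.mem_schubertVariety_total_iff₂ hB hh hH hHX hH2) <|
    and_congr (hF.mem_schubertVariety_total_iff₃ hB hh hH hHX hH2) <|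
    and_congr (hF.mem_schubertVariety_total_iff₄ hB hh hH hHX hH2) <|
    forall_congr' (hF.mem_schubertVariety_total_iff hB hh hH hHX hH2)

end FixedBaseSolution

variable (hB : FiberBounds a b κ ρ ν₃ ν₄ τ)

include hB

theorem mem_solutions_total_iff {h H : Submodule ℂ E} (hh : IsBaseSolution b F h) (hH : h ≤ H)
    (hHX : H ≤ solutionSpan b F h) :
    H ∈ solutions (2 + a) (totalProblem a b κ ρ ν₃ ν₄ τ) F ↔
      H.map (baseSpace b F).mkQ ∈ solutions a (fiberProblem a b κ ρ ν₃ ν₄ τ)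
        (fiberFlags b F (baseSpace b F) h) := by
  have hfin := hF.finrank_map_add_two hh hH hHX
  refine (and_congr_right fun h2 =>
    hF.forall_mem_schubertVariety_total_iff hB hh hH hHX h2).trans (and_congr_left' ?_)
  omega

theorem exists_isBaseSolution {H : Submodule ℂ E}
    (hH : H ∈ solutions (2 + a) (totalProblem a b κ ρ ν₃ ν₄ τ) F) :
    ∃ h, IsBaseSolution b F h ∧ H ⊓ baseSpace b F = h ∧ H ≤ solutionSpan b F h := by
  have T := hF.transverse
  have hE := T.finrank_total
  have ha := hB.pos
  have hab := hB.lt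
  obtain ⟨hH2, hi⟩ := hH
  rw [totalProblem, forall_fin_four_add] at hi
  simp only [Fin.append_left, Fin.append_right, Matrix.cons_val] at hi
  obtain ⟨h1, h2, h3, h4, -⟩ := hi
  have hA : 2 ≤ finrank ℂ ↥(H ⊓ spaceA F) :=
    le_meetDim_of_mem_schubertVariety h1 (j := 1) (by omega) (by
      rw [hE, prependRows, if_pos one_lt_two]
      omega)
  have hC : a - 1 + 1 ≤ finrank ℂ ↥(H ⊓ spaceC b F) :=
    le_meetDim_of_mem_schubertVariety h2 (by omega) (by
      rw [hE, Pi.add_apply, rect, if_pos (by omega), hB.ρ_last]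
      omega)
  have hB' : 1 ≤ finrank ℂ ↥(H ⊓ spaceB F) :=
    le_meetDim_of_mem_schubertVariety h3 (j := 0) (by omega) (by
      rw [hE, prependRows, if_pos one_pos]
      omega)
  have hD : a + 1 ≤ finrank ℂ ↥(H ⊓ spaceD b F) :=
    le_meetDim_of_mem_schubertVariety h4 (by omega) (by
      rw [hE, Pi.add_apply, rect, if_pos (by omega), hB.part₄.2.2]
      omega)
  exact T.exists_isTransversal (inf_sup_inf_eq_of_finrank_le T.inf_eq_bot (by omega)) (by omega) hB'

theorem comap_mem_solutions_base {H : Submodule ℂ E}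
    (hH : H ∈ solutions (2 + a) (totalProblem a b κ ρ ν₃ ν₄ τ) F) :
    H.comap (baseSpace b F).subtype ∈
      solutions 2 (fun _ : Fin 4 => rect 1 1) (baseFlags F (baseSpace b F)) := by
  obtain ⟨h, hh, hV, -⟩ := hF.exists_isBaseSolution hB hH
  rwa [hF.mem_solutions_base_iff, map_subtype_comap_subtype hV]

theorem map_mem_solutions_fiber {H : Submodule ℂ E}
    (hH : H ∈ solutions (2 + a) (totalProblem a b κ ρ ν₃ ν₄ τ) F) :
    H.map (baseSpace b F).mkQ ∈ solutions a (fiberProblem a b κ ρ ν₃ ν₄ τ)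
      (fiberFlags b F (baseSpace b F)
        ((H.comap (baseSpace b F).subtype).map (baseSpace b F).subtype)) := by
  obtain ⟨h, hh, hV, hX⟩ := hF.exists_isBaseSolution hB hH
  rw [map_subtype_comap_subtype hV]
  exact (hF.mem_solutions_total_iff hB hh (hV ▸ inf_le_left) hX).1 hH

theorem injOn_solutions :
    Set.InjOn (fun H : Submodule ℂ E =>
        (H.comap (baseSpace b F).subtype, H.map (baseSpace b F).mkQ))
      (solutions (2 + a) (totalProblem a b κ ρ ν₃ ν₄ τ) F) := by
  intro H hH H' hH' heq
  obtain ⟨h, hh, hV, hX⟩ := hF.exists_isBaseSolution hB hH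
  obtain ⟨h', hh', hV', hX'⟩ := hF.exists_isBaseSolution hB hH'
  obtain ⟨hcomap, hmap⟩ := Prod.mk.inj heq
  obtain rfl : h = h' := by
    rw [← map_subtype_comap_subtype hV, hcomap, map_subtype_comap_subtype hV']
  have hXV := hF.solutionSpan_inf hh
  exact le_antisymm (le_of_map_mkQ_le hXV (hV' ▸ inf_le_left) hX hX' hmap.le)
    (le_of_map_mkQ_le hXV (hV ▸ inf_le_left) hX' hX hmap.ge)

theorem exists_mem_solutions_total {h : Submodule ℂ (baseSpace b F)}
    (hh : h ∈ solutions 2 (fun _ : Fin 4 => rect 1 1) (baseFlags F (baseSpace b F)))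
    {K : Submodule ℂ (E ⧸ baseSpace b F)}
    (hK : K ∈ solutions a (fiberProblem a b κ ρ ν₃ ν₄ τ)
      (fiberFlags b F (baseSpace b F) (h.map (baseSpace b F).subtype))) :
    ∃ H ∈ solutions (2 + a) (totalProblem a b κ ρ ν₃ ν₄ τ) F,
      H.comap (baseSpace b F).subtype = h ∧ H.map (baseSpace b F).mkQ = K := by
  rw [hF.mem_solutions_base_iff] at hh
  have hXV := hF.solutionSpan_inf hh
  have hle : h.map (baseSpace b F).subtype ≤
      solutionSpan b F (h.map (baseSpace b F).subtype) ⊓ K.comap (baseSpace b F).mkQ :=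
    le_inf (hF.transverse.le_liftSpace hh)
      ((Submodule.map_subtype_le _ h).trans (Submodule.le_comap_mkQ _ K))
  have hHK := map_inf_comap_mkQ (hF.map_solutionSpan hh) K
  refine ⟨_, (hF.mem_solutions_total_iff hB hh hle inf_le_left).2 (hHK.symm ▸ hK), ?_, hHK⟩
  apply Submodule.map_injective_of_injective (baseSpace b F).injective_subtype
  rw [map_subtype_comap_subtype (inf_eq_of_le_of_le hXV hle inf_le_left)]

theorem bijOn_solutions :
    Set.BijOn (fun H : Submodule ℂ E =>
        (H.comap (baseSpace b F).subtype, H.map (baseSpace b F).mkQ))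
      (solutions (2 + a) (totalProblem a b κ ρ ν₃ ν₄ τ) F)
      {x | x.1 ∈ solutions 2 (fun _ : Fin 4 => rect 1 1) (baseFlags F (baseSpace b F)) ∧
        x.2 ∈ solutions a (fiberProblem a b κ ρ ν₃ ν₄ τ)
          (fiberFlags b F (baseSpace b F) (x.1.map (baseSpace b F).subtype))} := by
  refine ⟨fun H hH => ⟨hF.comap_mem_solutions_base hB hH, hF.map_mem_solutions_fiber hB hH⟩,
    hF.injOn_solutions hB, ?_⟩
  rintro ⟨h, K⟩ ⟨hh, hK⟩
  obtain ⟨H, hH, hcomap, hmap⟩ := hF.exists_mem_solutions_total hB hh hK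
  exact ⟨H, hH, Prod.ext hcomap hmap⟩

end IsGeneric

end Generic

/-! ### General position in terms of binary forms -/

/-- The flags spanned by a tuple of bases. -/
abbrev frameFlags {s : ℕ} {E : Type*} [AddCommGroup E] [Module ℂ E] [FiniteDimensional ℂ E]
    (e : Frames s E) : Fin s → CompleteFlag E :=
  fun i => CompleteFlag.ofBasis (e i)

section GoodFrames

variable {E : Type*} [AddCommGroup E] [Module ℂ E] {m : ℕ}

/-- The determinant formed by the coordinates `j` and `k` of `x` and of a second vector, as a
linear form in the second vector. -/
def coordMinor (e : Basis (Fin (finrank ℂ E)) ℂ E) (j k : ℕ) (x : E) : E →ₗ[ℂ] ℂ :=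
  frameCoord e j x • frameCoord e k - frameCoord e k x • frameCoord e j

theorem coordMinor_apply (e : Basis (Fin (finrank ℂ E)) ℂ E) (j k : ℕ) (x z : E) :
    coordMinor e j k x z =
      frameCoord e j x * frameCoord e k z - frameCoord e k x * frameCoord e j z :=
  rfl

theorem coordMinor_self (e : Basis (Fin (finrank ℂ E)) ℂ E) (j k : ℕ) (x : E) :
    coordMinor e j k x x = 0 := by
  rw [coordMinor_apply]; ring

/-- The matrix of the map `C → E / A` from the second distinguished space to the quotient by the
first one. It is invertible if and only if `A ∩ C = 0`. -/
def crossMatrix (b : ℕ) (e : Frames (4 + m) E) : Matrix (Fin b) (Fin b) ℂ :=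
  Matrix.of fun k l => frameCoord (e (Fin.castAdd m 0)) (4 + k) (frameVec (e (Fin.castAdd m 1)) l)

/-- The projection to `C` along `A`, multiplied by the determinant of `crossMatrix`. The adjugate
in place of the inverse makes it polynomial in the bases, and defined for all of them. -/
def projC (b : ℕ) (e : Frames (4 + m) E) : E →ₗ[ℂ] E :=
  ∑ l, ∑ k, (crossMatrix b e).adjugate l k •
    (frameCoord (e (Fin.castAdd m 0)) (4 + k)).smulRight (frameVec (e (Fin.castAdd m 1)) l)

/-- The projection to `A` along `C`, multiplied by the determinant of `crossMatrix`. -/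
def projA (b : ℕ) (e : Frames (4 + m) E) : E →ₗ[ℂ] E :=
  (crossMatrix b e).det • LinearMap.id - projC b e

/-- The point of the third distinguished space `B` with homogeneous coordinates `s`, `t`. -/
def pointB (e : Frames (4 + m) E) (s t : ℂ) : E :=
  s • frameVec (e (Fin.castAdd m 2)) 0 + t • frameVec (e (Fin.castAdd m 2)) 1

/-- The span of the projections of `pointB e s t` to `A` and `C`. The solutions of the base problem
are those planes of this form that meet `D`. -/
def pointPlane (b : ℕ) (e : Frames (4 + m) E) (s t : ℂ) : Submodule ℂ E :=
  Submodule.span ℂ {projA b e (pointB e s t), projC b e (pointB e s t)}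

/-- The linear form that vanishes on `D` and on the projection of `pointB e s t` to `A`. -/
def normalForm (b : ℕ) (e : Frames (4 + m) E) (s t : ℂ) : E →ₗ[ℂ] ℂ :=
  coordMinor (e (Fin.castAdd m 3)) (b + 2) (b + 3) (projA b e (pointB e s t))

/-- The binary quadratic form in `s`, `t` that vanishes if and only if `pointPlane b e s t` meets
`D`. -/
def baseForm (b : ℕ) (e : Frames (4 + m) E) (s t : ℂ) : ℂ :=
  normalForm b e s t (projC b e (pointB e s t))

/-- The determinant that decides whether `z₁` and `z₂` are independent modulo the span of the
solutions `H` that contain the plane `pointPlane b e s t`. -/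
def spanForm (b : ℕ) (e : Frames (4 + m) E) (s t : ℂ) (z₁ z₂ : E) : ℂ :=
  normalForm b e s t (projA b e z₁) * normalForm b e s t (projC b e z₂) -
    normalForm b e s t (projA b e z₂) * normalForm b e s t (projC b e z₁)

/-- The tuples of bases for which two binary forms have no common zero on the projective line. -/
def noCommonZero {s : ℕ} (q q' : Frames s E → ℂ → ℂ → ℂ) : Set (Frames s E) :=
  {e | ∀ s t : ℂ, (s ≠ 0 ∨ t ≠ 0) → q e s t = 0 → q' e s t ≠ 0}

/-- The tuples of bases whose flags are in general position, expressed by the absence of common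
zeros of binary forms, which amounts to the nonvanishing of resultants. Some pairs of linear
conditions are combined into a quadratic one by taking a product. -/
structure IsGood (b : ℕ) (e : Frames (4 + m) E) : Prop where
  det_ne : (crossMatrix b e).det ≠ 0
  projA_ne : e ∈ noCommonZero
    (fun e s t => frameCoord (e (Fin.castAdd m 3)) (b + 2) (projA b e (pointB e s t)))
    (fun e s t => frameCoord (e (Fin.castAdd m 3)) (b + 3) (projA b e (pointB e s t)))
  projC_ne : e ∈ noCommonZero
    (fun e s t => frameCoord (e (Fin.castAdd m 3)) (b + 2) (projC b e (pointB e s t)))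
    (fun e s t => frameCoord (e (Fin.castAdd m 3)) (b + 3) (projC b e (pointB e s t)))
  first_ne : e ∈ noCommonZero (baseForm b) fun e s t =>
    normalForm b e s t (projC b e (frameVec (e (Fin.castAdd m 0)) 4)) *
      frameCoord (e (Fin.castAdd m 0)) (b + 3) (projC b e (pointB e s t))
  second_ne : e ∈ noCommonZero (baseForm b) fun e s t =>
    normalForm b e s t (frameVec (e (Fin.castAdd m 1)) 0) *
      frameCoord (e (Fin.castAdd m 1)) (b - 1) (projC b e (pointB e s t))
  third_fourth_ne : e ∈ noCommonZero (baseForm b) fun e s t =>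
    normalForm b e s t (projA b e (frameVec (e (Fin.castAdd m 3)) 0)) *
      frameCoord (e (Fin.castAdd m 2)) (b + 3) (projA b e (pointB e s t))
  third_ne : e ∈ noCommonZero (baseForm b) fun e s t =>
    spanForm b e s t (pointB e 1 1) (frameVec (e (Fin.castAdd m 2)) 2)
  fourth_ne : e ∈ noCommonZero (baseForm b) fun e s t =>
    coordMinor (e (Fin.castAdd m 3)) (b + 1) (b + 2) (projA b e (pointB e s t))
      (projC b e (pointB e s t))
  span_ne : ∀ j, e ∈ noCommonZero (baseForm b) fun e s t =>
    spanForm b e s t (frameVec (e (Fin.natAdd 4 j)) 0) (frameVec (e (Fin.natAdd 4 j)) 1)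
  minor_ne : ∀ j, e ∈ noCommonZero (baseForm b) fun e s t =>
    coordMinor (e (Fin.natAdd 4 j)) (b + 2) (b + 3) (projA b e (pointB e s t))
      (projC b e (pointB e s t))

section Projections

variable {b : ℕ} {e : Frames (4 + m) E}

theorem projC_apply (x : E) :
    projC b e x = ∑ l : Fin b, ((crossMatrix b e).adjugate.mulVec
      fun k => frameCoord (e (Fin.castAdd m 0)) (4 + k) x) l •
        frameVec (e (Fin.castAdd m 1)) l := by
  simp [projC, Matrix.mulVec, dotProduct, Finset.sum_smul, mul_smul]

theorem projA_add_projC (x : E) : projA b e x + projC b e x = (crossMatrix b e).det • x := by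
  simp [projA]

theorem crossMatrix_mulVec (c : Fin b → ℂ) (k : Fin b) :
    (crossMatrix b e).mulVec c k = frameCoord (e (Fin.castAdd m 0)) (4 + k)
      (∑ l, c l • frameVec (e (Fin.castAdd m 1)) l) := by
  simp [Matrix.mulVec, dotProduct, crossMatrix, mul_comm]

theorem frameCoord_projC (hE : finrank ℂ E = b + 4) (x : E) {k : ℕ} (hk : 4 ≤ k) :
    frameCoord (e (Fin.castAdd m 0)) k (projC b e x) =
      (crossMatrix b e).det * frameCoord (e (Fin.castAdd m 0)) k x := by
  by_cases hk' : k < b + 4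
  · obtain ⟨k, rfl⟩ := Nat.exists_eq_add_of_le hk
    have hmul := crossMatrix_mulVec (b := b) (e := e) ((crossMatrix b e).adjugate.mulVec
      fun k => frameCoord (e (Fin.castAdd m 0)) (4 + k) x) ⟨k, by omega⟩
    rw [← projC_apply, Matrix.mulVec_mulVec, Matrix.mul_adjugate, Matrix.smul_mulVec,
      Matrix.one_mulVec] at hmul
    exact hmul.symm
  · simp [frameCoord, hE, hk']

variable [FiniteDimensional ℂ E]

theorem projC_mem (x : E) :
    projC b e x ∈ (CompleteFlag.ofBasis (e (Fin.castAdd m 1))).space b := by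
  rw [projC_apply]
  exact Submodule.sum_mem _ fun l _ => Submodule.smul_mem _ _ (frameVec_mem l.2)

theorem projA_mem (hE : finrank ℂ E = b + 4) (x : E) :
    projA b e x ∈ (CompleteFlag.ofBasis (e (Fin.castAdd m 0))).space 4 := by
  rw [mem_ofBasis_space]
  intro k hk
  simp [projA, frameCoord_projC hE x hk]

theorem crossMatrix_mulVec_eq_zero_iff (hE : finrank ℂ E = b + 4) (c : Fin b → ℂ) :
    (crossMatrix b e).mulVec c = 0 ↔ ∑ l, c l • frameVec (e (Fin.castAdd m 1)) l ∈
      (CompleteFlag.ofBasis (e (Fin.castAdd m 0))).space 4 := by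
  rw [mem_ofBasis_space]
  refine ⟨fun h k hk => ?_, fun h => funext fun k => ?_⟩
  · by_cases hk' : k < b + 4
    · obtain ⟨k, rfl⟩ := Nat.exists_eq_add_of_le hk
      exact (crossMatrix_mulVec c ⟨k, by omega⟩).symm.trans (congrFun h _)
    · simp [frameCoord, hE, hk']
  · rw [crossMatrix_mulVec, h _ (by omega), Pi.zero_apply]

theorem det_crossMatrix_ne_zero_iff (hE : finrank ℂ E = b + 4) :
    (crossMatrix b e).det ≠ 0 ↔ (CompleteFlag.ofBasis (e (Fin.castAdd m 0))).space 4 ⊓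
      (CompleteFlag.ofBasis (e (Fin.castAdd m 1))).space b = ⊥ := by
  rw [Ne, ← Matrix.exists_mulVec_eq_zero_iff, Submodule.eq_bot_iff]
  constructor
  · rintro h x ⟨hA, hC⟩
    rw [SetLike.mem_coe, mem_ofBasis_space_iff_sum, ← Fin.sum_univ_eq_sum_range
      (fun k => frameCoord (e (Fin.castAdd m 1)) k x • frameVec (e (Fin.castAdd m 1)) k)] at hC
    by_contra hx
    refine h ⟨fun l => frameCoord (e (Fin.castAdd m 1)) l x, fun h0 => hx ?_,
      (crossMatrix_mulVec_eq_zero_iff hE _).2 (hC ▸ hA)⟩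
    rw [hC]
    exact Finset.sum_eq_zero fun l _ => by rw [congrFun h0 l, Pi.zero_apply, zero_smul]
  · rintro h ⟨c, hc, hM⟩
    have hx := h _ ⟨(crossMatrix_mulVec_eq_zero_iff hE c).1 hM,
      Submodule.sum_mem _ fun l _ => Submodule.smul_mem _ _ (frameVec_mem l.2)⟩
    refine hc (funext fun l => ?_)
    have := congrArg (frameCoord (e (Fin.castAdd m 1)) l) hx
    simpa [frameCoord_frameVec, Fin.val_inj, hE, show (l : ℕ) < b + 4 by omega] using this

theorem proj_of_add (hE : finrank ℂ E = b + 4) (hdet : (crossMatrix b e).det ≠ 0) {p w : E}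
    (hp : p ∈ (CompleteFlag.ofBasis (e (Fin.castAdd m 0))).space 4)
    (hw : w ∈ (CompleteFlag.ofBasis (e (Fin.castAdd m 1))).space b) :
    projA b e (p + w) = (crossMatrix b e).det • p ∧
      projC b e (p + w) = (crossMatrix b e).det • w :=
  eq_and_eq_of_add_eq_add ((det_crossMatrix_ne_zero_iff hE).1 hdet) (projA_mem hE _)
    (Submodule.smul_mem _ _ hp) (projC_mem _) (Submodule.smul_mem _ _ hw)
    (by rw [projA_add_projC, smul_add])

end Projections

variable [FiniteDimensional ℂ E]

theorem mem_ofBasis_space_two {e : Basis (Fin (finrank ℂ E)) ℂ E} {y : E} :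
    y ∈ (CompleteFlag.ofBasis e).space 2 ↔ ∃ s t : ℂ, y = s • frameVec e 0 + t • frameVec e 1 := by
  constructor
  · intro h
    rw [mem_ofBasis_space_iff_sum, Finset.sum_range_succ, Finset.sum_range_one] at h
    exact ⟨_, _, h⟩
  · rintro ⟨s, t, rfl⟩
    exact add_mem (Submodule.smul_mem _ _ (frameVec_mem (by omega)))
      (Submodule.smul_mem _ _ (frameVec_mem (by omega)))

theorem pointB_mem (e : Frames (4 + m) E) (s t : ℂ) :
    pointB e s t ∈ (CompleteFlag.ofBasis (e (Fin.castAdd m 2))).space 2 :=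
  mem_ofBasis_space_two.2 ⟨s, t, rfl⟩

theorem exists_eq_pointB {e : Frames (4 + m) E} {y : E}
    (hy : y ∈ (CompleteFlag.ofBasis (e (Fin.castAdd m 2))).space 2) (h0 : y ≠ 0) :
    ∃ s t : ℂ, (s ≠ 0 ∨ t ≠ 0) ∧ y = pointB e s t := by
  obtain ⟨s, t, rfl⟩ := mem_ofBasis_space_two.1 hy
  refine ⟨s, t, ?_, rfl⟩
  by_contra! h
  exact h0 (by rw [h.1, h.2, zero_smul, zero_smul, add_zero])

theorem span_pair_inf_space_eq_bot_of_coordMinor_ne_zero {e : Basis (Fin (finrank ℂ E)) ℂ E}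
    {j k t : ℕ} (hj : t ≤ j) (hk : t ≤ k) {x z : E} (h : coordMinor e j k x z ≠ 0) :
    Submodule.span ℂ {x, z} ⊓ (CompleteFlag.ofBasis e).space t = ⊥ := by
  rw [Submodule.eq_bot_iff]
  rintro y ⟨hs, hy⟩
  obtain ⟨α, β, rfl⟩ := Submodule.mem_span_pair.1 hs
  have hyj := mem_ofBasis_space.1 hy j hj
  have hyk := mem_ofBasis_space.1 hy k hk
  simp only [map_add, map_smul, smul_eq_mul] at hyj hyk
  rw [coordMinor_apply] at h
  have hα : α = 0 := by
    apply mul_left_cancel₀ h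
    linear_combination frameCoord e k z * hyj - frameCoord e j z * hyk
  have hβ : β = 0 := by
    apply mul_left_cancel₀ h
    linear_combination frameCoord e j x * hyk - frameCoord e k x * hyj
  rw [hα, hβ, zero_smul, zero_smul, add_zero]

namespace IsGood

variable {b : ℕ} {e : Frames (4 + m) E} (he : IsGood b e) (hE : finrank ℂ E = b + 4)

include he hE

theorem isTransverse : IsTransverse 4 b (spaceA (frameFlags e)) (spaceC b (frameFlags e))
    (spaceB (frameFlags e)) (spaceD b (frameFlags e)) where
  finrank_total := hE
  finrank_A := by rw [spaceA, CompleteFlag.finrank_space]; omega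
  finrank_C := by rw [spaceC, CompleteFlag.finrank_space]; omega
  finrank_B := by rw [spaceB, CompleteFlag.finrank_space]; omega
  finrank_D := by rw [spaceD, CompleteFlag.finrank_space]; omega
  inf_eq_bot := (det_crossMatrix_ne_zero_iff hE).1 he.det_ne
  proj_notMem p hp w hw hy h0 := by
    obtain ⟨s, t, hst, hpt⟩ := exists_eq_pointB hy h0
    obtain ⟨hA, hC⟩ := proj_of_add hE he.det_ne hp hw
    rw [hpt] at hA hC
    refine ⟨fun hD => ?_, fun hD => ?_⟩
    · have hzero := mem_ofBasis_space.1 (hA ▸ Submodule.smul_mem _ _ hD)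
      exact he.projA_ne s t hst (hzero _ le_rfl) (hzero _ (by omega))
    · have hzero := mem_ofBasis_space.1 (hC ▸ Submodule.smul_mem _ _ hD)
      exact he.projC_ne s t hst (hzero _ le_rfl) (hzero _ (by omega))

theorem exists_eq_pointPlane {h : Submodule ℂ E} (hh : IsBaseSolution b (frameFlags e) h) :
    ∃ s t : ℂ, (s ≠ 0 ∨ t ≠ 0) ∧ baseForm b e s t = 0 ∧ h = pointPlane b e s t := by
  obtain ⟨p, hp, w, hw, hy, h0, rfl, hD⟩ := hh
  obtain ⟨s, t, hst, hpt⟩ := exists_eq_pointB hy h0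
  obtain ⟨hA, hC⟩ := proj_of_add hE he.det_ne hp hw
  rw [hpt] at hA hC
  have hplane : Submodule.span ℂ {p} ⊔ Submodule.span ℂ {w} = pointPlane b e s t := by
    rw [pointPlane, hA, hC, Submodule.span_insert,
      Submodule.span_singleton_smul_eq (IsUnit.mk0 _ he.det_ne),
      Submodule.span_singleton_smul_eq (IsUnit.mk0 _ he.det_ne)]
  refine ⟨s, t, hst, ?_, hplane⟩
  by_contra hne
  rw [hplane] at hD
  exact hD (span_pair_inf_space_eq_bot_of_coordMinor_ne_zero le_rfl (by omega) hne)

end IsGood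

end GoodFrames

section GoodFramesAreGeneric

variable {E : Type*} [AddCommGroup E] [Module ℂ E]

theorem finrank_inf_le_of_notMem [FiniteDimensional ℂ E] {S h : Submodule ℂ E} {x : E} {r : ℕ}
    (hh : finrank ℂ h = r + 1) (hx : x ∈ h) (hxS : x ∉ S) : finrank ℂ ↥(h ⊓ S) ≤ r := by
  have hlt : h ⊓ S < h := lt_of_le_of_ne inf_le_left fun heq => hxS (inf_eq_left.1 heq hx)
  have := Submodule.finrank_lt_finrank_of_lt hlt
  omega

theorem finrank_add_two_le_of_det_ne_zero [FiniteDimensional ℂ E] {X Y : Submodule ℂ E}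
    (hXY : X ≤ Y) {f g : E →ₗ[ℂ] ℂ} (hf : ∀ x ∈ X, f x = 0) (hg : ∀ x ∈ X, g x = 0) {z₁ z₂ : E}
    (h₁ : z₁ ∈ Y) (h₂ : z₂ ∈ Y) (hdet : f z₁ * g z₂ - f z₂ * g z₁ ≠ 0) :
    finrank ℂ X + 2 ≤ finrank ℂ Y := by
  have htop : Y.map (f.prod g) = ⊤ := by
    refine eq_top_iff.2 fun ⟨α, β⟩ _ => ⟨(f z₁ * g z₂ - f z₂ * g z₁)⁻¹ •
      ((α * g z₂ - β * f z₂) • z₁ + (β * f z₁ - α * g z₁) • z₂), Submodule.smul_mem _ _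
        (add_mem (Submodule.smul_mem _ _ h₁) (Submodule.smul_mem _ _ h₂)), Prod.ext ?_ ?_⟩ <;>
    · simp only [LinearMap.prod_apply, Function.prod_apply, map_smul, map_add, Prod.smul_mk,
        Prod.mk_add_mk, smul_eq_mul]
      field
  have hker : X ≤ Y ⊓ (f.prod g).ker := fun x hx => ⟨hXY hx, Prod.ext (hf x hx) (hg x hx)⟩
  have hrank := finrank_map_add_finrank_inf_ker (f.prod g) Y
  rw [htop, finrank_top, finrank_prod, finrank_self] at hrank
  have := Submodule.finrank_mono hker
  omega

theorem inf_ofBasis_space_succ_le [FiniteDimensional ℂ E] {e : Basis (Fin (finrank ℂ E)) ℂ E}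
    {k : ℕ} {X : Submodule ℂ E} {f : E →ₗ[ℂ] ℂ} (hX : ∀ x ∈ X, f x = 0)
    (hk : ∀ x ∈ (CompleteFlag.ofBasis e).space k, f x = 0) (hf : f (frameVec e k) ≠ 0) :
    X ⊓ (CompleteFlag.ofBasis e).space (k + 1) ≤ (CompleteFlag.ofBasis e).space k := by
  rintro x ⟨hxX, hx⟩
  have hsum := mem_ofBasis_space_iff_sum.1 hx
  rw [Finset.sum_range_succ] at hsum
  have hlow : ∑ j ∈ Finset.range k, frameCoord e j x • frameVec e j ∈
      (CompleteFlag.ofBasis e).space k :=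
    Submodule.sum_mem _ fun j hj => Submodule.smul_mem _ _ (frameVec_mem (Finset.mem_range.1 hj))
  have hzero := hX x hxX
  rw [hsum, map_add, hk _ hlow, zero_add, map_smul, smul_eq_mul, mul_eq_zero] at hzero
  rw [hsum, hzero.resolve_right hf, zero_smul, add_zero]
  exact hlow

theorem meetDim_ofBasis_one_eq_zero [FiniteDimensional ℂ E] {e : Basis (Fin (finrank ℂ E)) ℂ E}
    {X : Submodule ℂ E} {f : E →ₗ[ℂ] ℂ} (hX : ∀ x ∈ X, f x = 0) (hf : f (frameVec e 0) ≠ 0) :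
    (CompleteFlag.ofBasis e).meetDim X 1 = 0 := by
  have hbot : X ⊓ (CompleteFlag.ofBasis e).space 1 ≤ (CompleteFlag.ofBasis e).space 0 := by
    refine inf_ofBasis_space_succ_le hX (fun x hx => ?_) hf
    rw [CompleteFlag.space_zero, Submodule.mem_bot] at hx
    rw [hx, map_zero]
  rw [CompleteFlag.space_zero, le_bot_iff] at hbot
  rw [CompleteFlag.meetDim, hbot, finrank_bot]

theorem hasProfile_of_bounds [FiniteDimensional ℂ E] {F : CompleteFlag E} {X h : Submodule ℂ E}
    {lo hi d r : ℕ} (hhi : hi ≤ finrank ℂ E)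
    (hlow : ∀ t, lo ≤ t → t ≤ hi → t ≤ F.meetDim X t + d) (hup : F.meetDim X lo + d ≤ lo)
    (hr : r ≤ F.meetDim h lo) (hr' : F.meetDim h hi ≤ r) : HasProfile F X h lo hi d r := by
  intro t h₁ h₂
  have hX := finrank_inf_add_le (F.mono h₁) X
  have hmono := F.meetDim_mono h h₁
  have hmono' := F.meetDim_mono h h₂
  have ht := hlow t h₁ h₂
  rw [F.finrank_space, F.finrank_space, inf_comm, inf_comm _ X] at hX
  simp only [CompleteFlag.meetDim] at *
  omega

variable {m b : ℕ} {e : Frames (4 + m) E} {s t : ℂ}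

theorem projA_mem_pointPlane : projA b e (pointB e s t) ∈ pointPlane b e s t :=
  Submodule.subset_span (Set.mem_insert _ _)

theorem projC_mem_pointPlane : projC b e (pointB e s t) ∈ pointPlane b e s t :=
  Submodule.subset_span (Set.mem_insert_of_mem _ rfl)

variable [FiniteDimensional ℂ E]

theorem normalForm_eq_zero_of_mem (hq : baseForm b e s t = 0) {x : E}
    (hx : x ∈ spaceD b (frameFlags e) ⊔ pointPlane b e s t) : normalForm b e s t x = 0 := by
  obtain ⟨d, hd, y, hy, rfl⟩ := Submodule.mem_sup.1 hx
  obtain ⟨α, β, rfl⟩ := Submodule.mem_span_pair.1 hy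
  have hd₀ : normalForm b e s t d = 0 := by
    have hD := mem_ofBasis_space.1 hd
    rw [normalForm, coordMinor_apply, hD _ le_rfl, hD _ (by omega)]
    ring
  have hA₀ : normalForm b e s t (projA b e (pointB e s t)) = 0 := coordMinor_self _ _ _ _
  have hC₀ : normalForm b e s t (projC b e (pointB e s t)) = 0 := hq
  simp only [map_add, map_smul, hd₀, hA₀, hC₀, smul_zero, add_zero]

namespace IsGood

variable (he : IsGood b e) (hE : finrank ℂ E = b + 4)

include he hE

theorem normalForm_proj_eq_zero_of_mem (hq : baseForm b e s t = 0) {x : E}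
    (hx : x ∈ solutionSpan b (frameFlags e) (pointPlane b e s t)) :
    normalForm b e s t (projA b e x) = 0 ∧ normalForm b e s t (projC b e x) = 0 := by
  obtain ⟨p, hp, w, hw, rfl⟩ := Submodule.mem_sup.1 hx
  obtain ⟨hA, hC⟩ := proj_of_add hE he.det_ne hp.1 hw.1
  rw [hA, hC]
  exact ⟨normalForm_eq_zero_of_mem hq (Submodule.smul_mem _ _ hp.2),
    normalForm_eq_zero_of_mem hq (Submodule.smul_mem _ _ hw.2)⟩

theorem meetDim_solutionSpan_add_two_le (hq : baseForm b e s t = 0) {F : CompleteFlag E} {k : ℕ}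
    (hk : k ≤ finrank ℂ E) {z₁ z₂ : E} (h₁ : z₁ ∈ F.space k) (h₂ : z₂ ∈ F.space k)
    (hz : spanForm b e s t z₁ z₂ ≠ 0) :
    F.meetDim (solutionSpan b (frameFlags e) (pointPlane b e s t)) k + 2 ≤ k := by
  have hle := finrank_add_two_le_of_det_ne_zero
    (X := solutionSpan b (frameFlags e) (pointPlane b e s t) ⊓ F.space k) inf_le_right
    (f := normalForm b e s t ∘ₗ projA b e) (g := normalForm b e s t ∘ₗ projC b e)
    (fun _ hx => (he.normalForm_proj_eq_zero_of_mem hE hq hx.1).1)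
    (fun _ hx => (he.normalForm_proj_eq_zero_of_mem hE hq hx.1).2) h₁ h₂ hz
  rwa [F.finrank_space, min_eq_left hk] at hle

variable {h : Submodule ℂ E} (hh : IsBaseSolution b (frameFlags e) h)

include hh

theorem le_meetDim_solutionSpan_add_two (F : CompleteFlag E) {k : ℕ} (hk : k ≤ b + 4) :
    k ≤ F.meetDim (solutionSpan b (frameFlags e) h) k + 2 := by
  have hmeet := F.add_le_meetDim (solutionSpan b (frameFlags e) h) (hE ▸ hk)
  have hdim : finrank ℂ (solutionSpan b (frameFlags e) h) + 2 = b + 4 :=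
    (he.isTransverse hE).finrank_liftSpace hh
  omega

theorem hasProfile₁ : HasProfile (frameFlags e (Fin.castAdd m 0))
    (solutionSpan b (frameFlags e) h) h 5 (b + 2) 2 1 := by
  have T := he.isTransverse hE
  obtain ⟨s, t, hst, hq, rfl⟩ := he.exists_eq_pointPlane hE hh
  have hne := he.first_ne s t hst hq
  refine hasProfile_of_bounds (by omega)
    (fun k _ hk => he.le_meetDim_solutionSpan_add_two hE hh _ (by omega)) ?_ ?_ ?_
  · have hA : solutionSpan b (frameFlags e) (pointPlane b e s t) ⊓
        (frameFlags e (Fin.castAdd m 0)).space 5 ≤ spaceA (frameFlags e) := by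
      refine inf_ofBasis_space_succ_le (f := normalForm b e s t ∘ₗ projC b e)
        (fun x hx => (he.normalForm_proj_eq_zero_of_mem hE hq hx).2) (fun x hx => ?_)
        (left_ne_zero_of_mul hne)
      have hC := (proj_of_add hE he.det_ne hx (Submodule.zero_mem _)).2
      rw [add_zero, smul_zero] at hC
      rw [LinearMap.comp_apply, hC, map_zero]
    have hdim : finrank ℂ ↥(solutionSpan b (frameFlags e) (pointPlane b e s t) ⊓
      spaceA (frameFlags e)) + 1 = 4 := T.finrank_liftSpace_inf_A hh
    rw [CompleteFlag.meetDim]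
    exact (Nat.add_le_add_right (Submodule.finrank_mono (le_inf inf_le_left hA)) 2).trans
      (Nat.succ_le_succ hdim.le)
  · exact (T.one_le_finrank_inf_A hh).trans (CompleteFlag.meetDim_mono _ _ (by omega))
  · exact finrank_inf_le_of_notMem (T.finrank_eq_two hh) projC_mem_pointPlane fun hmem =>
      right_ne_zero_of_mul hne (mem_ofBasis_space.1 hmem _ (by omega))

theorem le_meetDim_solutionSpan_add_one_of_le_spaceC {k : ℕ} (hk : k ≤ b) :
    k ≤ (frameFlags e (Fin.castAdd m 1)).meetDim (solutionSpan b (frameFlags e) h) k + 1 := by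
  have T := he.isTransverse hE
  have hle : (frameFlags e (Fin.castAdd m 1)).space k ≤ spaceC b (frameFlags e) :=
    CompleteFlag.mono _ hk
  have hmeet := finrank_inf_add_le hle (spaceD b (frameFlags e) ⊔ h)
  have hC := T.symm.finrank_A_inf hh.symm
  have hlift := Submodule.finrank_mono (le_inf
    ((inf_le_inf_right (spaceD b (frameFlags e) ⊔ h) hle).trans le_sup_right) inf_le_left :
    _ ≤ solutionSpan b (frameFlags e) h ⊓ (frameFlags e (Fin.castAdd m 1)).space k)
  rw [CompleteFlag.finrank_space, T.finrank_C] at hmeet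
  rw [CompleteFlag.meetDim]
  omega

theorem hasProfile₂ (hb : 2 ≤ b) : HasProfile (frameFlags e (Fin.castAdd m 1))
    (solutionSpan b (frameFlags e) h) h 1 (b - 1) 1 0 := by
  have T := he.isTransverse hE
  obtain ⟨s, t, hst, hq, rfl⟩ := he.exists_eq_pointPlane hE hh
  have hne := he.second_ne s t hst hq
  refine hasProfile_of_bounds (by omega)
    (fun k _ hk => he.le_meetDim_solutionSpan_add_one_of_le_spaceC hE hh (by omega)) ?_
    (Nat.zero_le _) ?_
  · rw [meetDim_ofBasis_one_eq_zero (X := solutionSpan b (frameFlags e) (pointPlane b e s t))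
      (fun x hx => normalForm_eq_zero_of_mem hq (liftSpace_le hx)) (left_ne_zero_of_mul hne)]
  · have hbot : pointPlane b e s t ⊓ (frameFlags e (Fin.castAdd m 1)).space (b - 1) = ⊥ := by
      rw [Submodule.eq_bot_iff]
      rintro x ⟨hx, hxC⟩
      obtain ⟨α, β, rfl⟩ := Submodule.mem_span_pair.1 hx
      have hα := (eq_and_eq_of_add_eq_add T.inf_eq_bot
        (Submodule.smul_mem _ α (projA_mem hE (pointB e s t))) (Submodule.zero_mem _)
        (Submodule.smul_mem _ β (projC_mem (pointB e s t)))
        (CompleteFlag.mono _ (by omega) hxC) (zero_add _).symm).1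
      have hβ := mem_ofBasis_space.1 hxC _ le_rfl
      rw [hα, zero_add, map_smul, smul_eq_mul, mul_eq_zero] at hβ
      rw [hα, hβ.resolve_right (right_ne_zero_of_mul hne), zero_smul, add_zero]
    rw [CompleteFlag.meetDim, hbot, finrank_bot]

theorem hasProfile₃ : HasProfile (frameFlags e (Fin.castAdd m 2))
    (solutionSpan b (frameFlags e) h) h 3 (b + 2) 2 1 := by
  have T := he.isTransverse hE
  obtain ⟨s, t, hst, hq, rfl⟩ := he.exists_eq_pointPlane hE hh
  refine hasProfile_of_bounds (by omega)
    (fun k _ hk => he.le_meetDim_solutionSpan_add_two hE hh _ (by omega)) ?_ ?_ ?_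
  · exact he.meetDim_solutionSpan_add_two_le hE hq (by omega)
      (CompleteFlag.mono _ (by omega) (pointB_mem e 1 1)) (frameVec_mem (by omega))
      (he.third_ne s t hst hq)
  · exact hh.one_le_finrank_inf_B.trans (CompleteFlag.meetDim_mono _ _ (by omega))
  · exact finrank_inf_le_of_notMem (T.finrank_eq_two hh) projA_mem_pointPlane fun hmem =>
      right_ne_zero_of_mul (he.third_fourth_ne s t hst hq)
        (mem_ofBasis_space.1 hmem _ (by omega))

theorem le_meetDim_solutionSpan_add_one_of_le_spaceD {k : ℕ} (hk : k ≤ b + 2) :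
    k ≤ (frameFlags e (Fin.castAdd m 3)).meetDim (solutionSpan b (frameFlags e) h) k + 1 := by
  have T := he.isTransverse hE
  have hle : (frameFlags e (Fin.castAdd m 3)).space k ≤ spaceD b (frameFlags e) :=
    CompleteFlag.mono _ hk
  have hmeet := finrank_inf_add_le hle (solutionSpan b (frameFlags e) h)
  have hsum := Submodule.finrank_sup_add_finrank_inf_eq (spaceD b (frameFlags e))
    (solutionSpan b (frameFlags e) h)
  have hsup := Submodule.finrank_mono (sup_le le_sup_left liftSpace_le :
    spaceD b (frameFlags e) ⊔ solutionSpan b (frameFlags e) h ≤ spaceD b (frameFlags e) ⊔ h)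
  have hdim : finrank ℂ (solutionSpan b (frameFlags e) h) + 2 = b + 4 := T.finrank_liftSpace hh
  have hD := T.finrank_D
  rw [T.finrank_D_sup hh] at hsup
  rw [CompleteFlag.finrank_space] at hmeet
  rw [CompleteFlag.meetDim, inf_comm]
  omega

theorem hasProfile₄ : HasProfile (frameFlags e (Fin.castAdd m 3))
    (solutionSpan b (frameFlags e) h) h 1 (b + 1) 1 0 := by
  obtain ⟨s, t, hst, hq, rfl⟩ := he.exists_eq_pointPlane hE hh
  refine hasProfile_of_bounds (by omega)
    (fun k _ hk => he.le_meetDim_solutionSpan_add_one_of_le_spaceD hE hh (by omega)) ?_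
    (Nat.zero_le _) ?_
  · rw [meetDim_ofBasis_one_eq_zero (f := normalForm b e s t ∘ₗ projA b e)
      (fun x hx => (he.normalForm_proj_eq_zero_of_mem hE hq hx).1)
      (left_ne_zero_of_mul (he.third_fourth_ne s t hst hq))]
  · rw [CompleteFlag.meetDim, pointPlane, span_pair_inf_space_eq_bot_of_coordMinor_ne_zero le_rfl
      (by omega) (he.fourth_ne s t hst hq), finrank_bot]

theorem hasProfile (j : Fin m) : HasProfile (frameFlags e (Fin.natAdd 4 j))
    (solutionSpan b (frameFlags e) h) h 2 (b + 2) 2 0 := by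
  obtain ⟨s, t, hst, hq, rfl⟩ := he.exists_eq_pointPlane hE hh
  refine hasProfile_of_bounds (by omega)
    (fun k _ hk => he.le_meetDim_solutionSpan_add_two hE hh _ (by omega)) ?_ (Nat.zero_le _) ?_
  · exact he.meetDim_solutionSpan_add_two_le hE hq (by omega) (frameVec_mem (by omega))
      (frameVec_mem (by omega)) (he.span_ne j s t hst hq)
  · rw [CompleteFlag.meetDim, pointPlane, span_pair_inf_space_eq_bot_of_coordMinor_ne_zero le_rfl
      (by omega) (he.minor_ne j s t hst hq), finrank_bot]

end IsGood

theorem IsGood.isGeneric (he : IsGood b e) (hE : finrank ℂ E = b + 4) (hb : 2 ≤ b) :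
    IsGeneric b (frameFlags e) where
  transverse := he.isTransverse hE
  profile₁ _ hh := he.hasProfile₁ hE hh
  profile₂ _ hh := he.hasProfile₂ hE hh hb
  profile₃ _ hh := he.hasProfile₃ hE hh
  profile₄ _ hh := he.hasProfile₄ hE hh
  profile _ hh j := he.hasProfile hE hh j

end GoodFramesAreGeneric

section Openness

variable {E : Type*} [AddCommGroup E] [Module ℂ E] [FiniteDimensional ℂ E]

/-- Families of binary linear forms with regular coefficients. -/
def IsRegularLinear {n : ℕ} (ℓ : Frames n E → ℂ → ℂ → ℂ) : Prop :=
  ∃ f g : Frames n E → ℂ, IsRegularFun f ∧ IsRegularFun g ∧ ∀ e s t, ℓ e s t = s * f e + t * g e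

/-- Families of binary quadratic forms with regular coefficients. -/
def IsRegularQuadratic {n : ℕ} (q : Frames n E → ℂ → ℂ → ℂ) : Prop :=
  ∃ f g h : Frames n E → ℂ, IsRegularFun f ∧ IsRegularFun g ∧ IsRegularFun h ∧
    ∀ e s t, q e s t = f e * s ^ 2 + g e * s * t + h e * t ^ 2

section BinaryForms

variable {n : ℕ} {ℓ ℓ' q q' : Frames n E → ℂ → ℂ → ℂ}

theorem IsRegularLinear.mul (h : IsRegularLinear ℓ) (h' : IsRegularLinear ℓ') :
    IsRegularQuadratic fun e s t => ℓ e s t * ℓ' e s t := by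
  obtain ⟨f, g, hf, hg, hℓ⟩ := h
  obtain ⟨f', g', hf', hg', hℓ'⟩ := h'
  refine ⟨_, _, _, hf.mul hf', (hf.mul hg').add (hg.mul hf'), hg.mul hg', fun e s t => ?_⟩
  simp only [hℓ, hℓ']; ring

theorem IsRegularLinear.sub (h : IsRegularLinear ℓ) (h' : IsRegularLinear ℓ') :
    IsRegularLinear fun e s t => ℓ e s t - ℓ' e s t := by
  obtain ⟨f, g, hf, hg, hℓ⟩ := h
  obtain ⟨f', g', hf', hg', hℓ'⟩ := h'
  refine ⟨_, _, hf.sub hf', hg.sub hg', fun e s t => ?_⟩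
  simp only [hℓ, hℓ']; ring

theorem IsRegularLinear.mul_fun (h : IsRegularLinear ℓ) {f : Frames n E → ℂ}
    (hf : IsRegularFun f) : IsRegularLinear fun e s t => ℓ e s t * f e := by
  obtain ⟨g, g', hg, hg', hℓ⟩ := h
  refine ⟨_, _, hg.mul hf, hg'.mul hf, fun e s t => ?_⟩
  simp only [hℓ]; ring

theorem IsRegularQuadratic.sub (h : IsRegularQuadratic q) (h' : IsRegularQuadratic q') :
    IsRegularQuadratic fun e s t => q e s t - q' e s t := by
  obtain ⟨f, g, k, hf, hg, hk, hq⟩ := h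
  obtain ⟨f', g', k', hf', hg', hk', hq'⟩ := h'
  refine ⟨_, _, _, hf.sub hf', hg.sub hg', hk.sub hk', fun e s t => ?_⟩
  simp only [hq, hq']; ring

theorem IsRegularQuadratic.isFrameOpen_noCommonZero (h : IsRegularQuadratic q)
    (h' : IsRegularQuadratic q') : IsFrameOpen (noCommonZero q q') := by
  obtain ⟨f, g, k, hf, hg, hk, hq⟩ := h
  obtain ⟨f', g', k', hf', hg', hk', hq'⟩ := h'
  have hres : noCommonZero q q' =
      {e | quadraticResultant (f e) (g e) (k e) (f' e) (g' e) (k' e) ≠ 0} := by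
    ext e
    rw [Set.mem_ofPred_eq, quadraticResultant_ne_zero_iff, noCommonZero, Set.mem_ofPred_eq]
    simp only [hq, hq']
  rw [hres]
  exact IsFrameOpen.of_ne ((((hf.mul hk').sub (hf'.mul hk)).pow 2).sub
    (((hf.mul hg').sub (hf'.mul hg)).mul ((hg.mul hk').sub (hg'.mul hk))))

theorem IsRegularLinear.isFrameOpen_noCommonZero (h : IsRegularLinear ℓ)
    (h' : IsRegularLinear ℓ') : IsFrameOpen (noCommonZero ℓ ℓ') := by
  have hsq : noCommonZero ℓ ℓ' =
      noCommonZero (fun e s t => ℓ e s t * ℓ e s t) (fun e s t => ℓ' e s t * ℓ' e s t) := by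
    simp only [noCommonZero, ne_eq, mul_self_eq_zero]
  rw [hsq]
  exact (h.mul h).isFrameOpen_noCommonZero (h'.mul h')

end BinaryForms

variable {m : ℕ} (b : ℕ)

theorem isRegularFun_crossMatrix (k l : Fin b) :
    IsRegularFun fun e : Frames (4 + m) E => crossMatrix b e k l :=
  (IsRegularVec.frameVec _ _).frameCoord _ _

theorem IsRegularVec.projC {v : Frames (4 + m) E → E} (hv : IsRegularVec v) :
    IsRegularVec fun e => projC b e (v e) := by
  simp only [_root_.projC, LinearMap.sum_apply, LinearMap.smul_apply, LinearMap.smulRight_apply]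
  exact IsRegularVec.sum _ fun l _ => IsRegularVec.sum _ fun k _ =>
    IsRegularVec.smul (IsRegularFun.adjugate (isRegularFun_crossMatrix b) l k)
      (IsRegularVec.smul (hv.frameCoord _ _) (IsRegularVec.frameVec _ _))

theorem IsRegularVec.projA {v : Frames (4 + m) E → E} (hv : IsRegularVec v) :
    IsRegularVec fun e => projA b e (v e) := by
  simp only [_root_.projA, LinearMap.sub_apply, LinearMap.smul_apply, LinearMap.id_apply]
  exact (IsRegularVec.smul (IsRegularFun.det (isRegularFun_crossMatrix b)) hv).sub (hv.projC b)

theorem isRegularLinear_frameCoord_projA (i : Fin (4 + m)) (k : ℕ) :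
    IsRegularLinear fun (e : Frames (4 + m) E) s t =>
      frameCoord (e i) k (projA b e (pointB e s t)) :=
  ⟨_, _, ((IsRegularVec.frameVec (Fin.castAdd m 2) 0).projA b).frameCoord i k,
    ((IsRegularVec.frameVec (Fin.castAdd m 2) 1).projA b).frameCoord i k,
    fun e s t => by simp only [pointB, map_add, map_smul, smul_eq_mul]⟩

theorem isRegularLinear_frameCoord_projC (i : Fin (4 + m)) (k : ℕ) :
    IsRegularLinear fun (e : Frames (4 + m) E) s t =>
      frameCoord (e i) k (projC b e (pointB e s t)) :=
  ⟨_, _, ((IsRegularVec.frameVec (Fin.castAdd m 2) 0).projC b).frameCoord i k,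
    ((IsRegularVec.frameVec (Fin.castAdd m 2) 1).projC b).frameCoord i k,
    fun e s t => by simp only [pointB, map_add, map_smul, smul_eq_mul]⟩

theorem isRegularQuadratic_coordMinor (i : Fin (4 + m)) (j k : ℕ) :
    IsRegularQuadratic fun (e : Frames (4 + m) E) s t =>
      coordMinor (e i) j k (projA b e (pointB e s t)) (projC b e (pointB e s t)) :=
  ((isRegularLinear_frameCoord_projA b i j).mul (isRegularLinear_frameCoord_projC b i k)).sub
    ((isRegularLinear_frameCoord_projA b i k).mul (isRegularLinear_frameCoord_projC b i j))

theorem isRegularQuadratic_baseForm :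
    IsRegularQuadratic (baseForm b : Frames (4 + m) E → ℂ → ℂ → ℂ) :=
  isRegularQuadratic_coordMinor b _ _ _

theorem isRegularLinear_normalForm {v : Frames (4 + m) E → E} (hv : IsRegularVec v) :
    IsRegularLinear fun e s t => normalForm b e s t (v e) :=
  ((isRegularLinear_frameCoord_projA b _ _).mul_fun (hv.frameCoord _ _)).sub
    ((isRegularLinear_frameCoord_projA b _ _).mul_fun (hv.frameCoord _ _))

theorem isRegularQuadratic_spanForm {v w : Frames (4 + m) E → E} (hv : IsRegularVec v)
    (hw : IsRegularVec w) : IsRegularQuadratic fun e s t => spanForm b e s t (v e) (w e) :=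
  ((isRegularLinear_normalForm b (hv.projA b)).mul
      (isRegularLinear_normalForm b (hw.projC b))).sub
    ((isRegularLinear_normalForm b (hw.projA b)).mul (isRegularLinear_normalForm b (hv.projC b)))

theorem isRegularVec_pointB (s t : ℂ) :
    IsRegularVec fun e : Frames (4 + m) E => pointB e s t :=
  (IsRegularVec.smul (IsRegularFun.const s) (IsRegularVec.frameVec _ 0)).add
    (IsRegularVec.smul (IsRegularFun.const t) (IsRegularVec.frameVec _ 1))

theorem isFrameOpen_isGood : IsFrameOpen {e : Frames (4 + m) E | IsGood b e} := by
  have hbase := isRegularQuadratic_baseForm (E := E) (m := m) b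
  have hv (i : Fin (4 + m)) (k : ℕ) := IsRegularVec.frameVec (E := E) i k
  have hA (i : Fin (4 + m)) (k : ℕ) := isRegularLinear_frameCoord_projA (E := E) b i k
  have hC (i : Fin (4 + m)) (k : ℕ) := isRegularLinear_frameCoord_projC (E := E) b i k
  have hdet := IsFrameOpen.of_ne (IsRegularFun.det (isRegularFun_crossMatrix (E := E) (m := m) b))
  have hprojA := (hA (Fin.castAdd m 3) (b + 2)).isFrameOpen_noCommonZero
    (hA (Fin.castAdd m 3) (b + 3))
  have hprojC := (hC (Fin.castAdd m 3) (b + 2)).isFrameOpen_noCommonZero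
    (hC (Fin.castAdd m 3) (b + 3))
  have hfirst := hbase.isFrameOpen_noCommonZero
    ((isRegularLinear_normalForm b ((hv (Fin.castAdd m 0) 4).projC b)).mul
      (hC (Fin.castAdd m 0) (b + 3)))
  have hsecond := hbase.isFrameOpen_noCommonZero
    ((isRegularLinear_normalForm b (hv (Fin.castAdd m 1) 0)).mul (hC (Fin.castAdd m 1) (b - 1)))
  have hthirdFourth := hbase.isFrameOpen_noCommonZero
    ((isRegularLinear_normalForm b ((hv (Fin.castAdd m 3) 0).projA b)).mul
      (hA (Fin.castAdd m 2) (b + 3)))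
  have hthird := hbase.isFrameOpen_noCommonZero
    (isRegularQuadratic_spanForm b (isRegularVec_pointB 1 1) (hv (Fin.castAdd m 2) 2))
  have hfourth := hbase.isFrameOpen_noCommonZero
    (isRegularQuadratic_coordMinor b (Fin.castAdd m 3) (b + 1) (b + 2))
  have hspan := IsFrameOpen.iInter fun j : Fin m => hbase.isFrameOpen_noCommonZero
    (isRegularQuadratic_spanForm b (hv (Fin.natAdd 4 j) 0) (hv (Fin.natAdd 4 j) 1))
  have hminor := IsFrameOpen.iInter fun j : Fin m => hbase.isFrameOpen_noCommonZero
    (isRegularQuadratic_coordMinor b (Fin.natAdd 4 j) (b + 2) (b + 3))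
  convert hdet.inter <| hprojA.inter <| hprojC.inter <| hfirst.inter <| hsecond.inter <|
    hthirdFourth.inter <| hthird.inter <| hfourth.inter <| hspan.inter hminor using 1
  ext e
  simp only [Set.mem_inter_iff, Set.mem_iInter]
  exact ⟨fun ⟨h₁, h₂, h₃, h₄, h₅, h₆, h₇, h₈, h₉, h₁₀⟩ =>
      ⟨h₁, h₂, h₃, h₄, h₅, h₆, h₇, h₈, h₉, h₁₀⟩,
    fun ⟨h₁, h₂, h₃, h₄, h₅, h₆, h₇, h₈, h₉, h₁₀⟩ =>
      ⟨h₁, h₂, h₃, h₄, h₅, h₆, h₇, h₈, h₉, h₁₀⟩⟩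

end Openness

/-! ### Shuffles of bases -/

section Shuffle

/-- Weakly increasing sequences bounded by `b`, which describe shuffles of `n` and `b` symbols: the
`j`-th of the first symbols comes after `r j` of the other symbols. -/
structure IsShuffle (b : ℕ) (r : ℕ → ℕ) : Prop where
  mono : Monotone r
  le : ∀ j, r j ≤ b

/-- The position of the `k`-th of the other symbols in a shuffle. -/
def slot (n : ℕ) (r : ℕ → ℕ) (k : ℕ) : ℕ := k + ((Finset.range n).filter (r · ≤ k)).card

variable {n b : ℕ} {r : ℕ → ℕ}

theorem slot_strictMono : StrictMono (slot n r) := fun k l hkl => by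
  have : ((Finset.range n).filter (r · ≤ k)).card ≤ ((Finset.range n).filter (r · ≤ l)).card :=
    Finset.card_le_card (Finset.monotone_filter_right _ fun j _ hj => le_trans hj hkl.le)
  unfold slot
  omega

theorem slot_le_add (k : ℕ) : slot n r k ≤ k + n := by
  have := Finset.card_filter_le (Finset.range n) (r · ≤ k)
  rw [Finset.card_range] at this
  unfold slot
  omega

theorem add_le_slot {k c : ℕ} (hcn : c ≤ n) (hc : ∀ j < c, r j ≤ k) : k + c ≤ slot n r k := by
  have : Finset.range c ⊆ (Finset.range n).filter (r · ≤ k) := fun j hj => by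
    rw [Finset.mem_range] at hj
    rw [Finset.mem_filter, Finset.mem_range]
    exact ⟨by omega, hc j hj⟩
  have := Finset.card_le_card this
  rw [Finset.card_range] at this
  unfold slot
  omega

namespace IsShuffle

variable (h : IsShuffle b r)

include h

theorem strictMono : StrictMono fun j => j + r j := fun i j hij => by
  have := h.mono hij.le
  dsimp only
  omega

theorem slot_le {k c : ℕ} (hc : k < r c) : slot n r k ≤ k + c := by
  have : (Finset.range n).filter (r · ≤ k) ⊆ Finset.range c := fun j hj => by
    rw [Finset.mem_filter] at hj
    rw [Finset.mem_range]
    by_contra! hcj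
    have := h.mono hcj
    omega
  have := Finset.card_le_card this
  rw [Finset.card_range] at this
  unfold slot
  omega

theorem ne_slot {j : ℕ} (hj : j < n) (k : ℕ) : j + r j ≠ slot n r k := by
  rcases lt_or_ge k (r j) with hk | hk
  · have := h.slot_le (n := n) hk
    omega
  · have := add_le_slot (n := n) (r := r) (k := k) (c := j + 1) (by omega)
      fun i hi => (h.mono (by omega : i ≤ j)).trans hk
    omega

/-- The bijection given by a shuffle, from the disjoint union of the two kinds of symbols to the
positions. -/
def equiv {N : ℕ} (hN : N = b + n) : Fin n ⊕ Fin b ≃ Fin N :=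
  Equiv.ofBijective
    (Sum.elim (fun j => ⟨j + r j, by have := h.le j; omega⟩)
      (fun k => ⟨slot n r k, by have := slot_le_add (n := n) (r := r) k; omega⟩)) <| by
    rw [Fintype.bijective_iff_injective_and_card]
    refine ⟨?_, by simp [hN, add_comm]⟩
    rintro (i | i) (j | j) hij <;> simp only [Sum.elim_inl, Sum.elim_inr, Fin.mk.injEq] at hij
    · rw [Fin.ext (h.strictMono.injective hij)]
    · exact absurd hij (h.ne_slot i.2 _)
    · exact absurd hij.symm (h.ne_slot j.2 _)
    · rw [Fin.ext (slot_strictMono.injective hij)]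

end IsShuffle

theorem exists_forall_le_iff_le {f : ℕ → ℕ} (hf : StrictMono f) (t : ℕ) :
    ∃ α, ∀ j, t ≤ f j ↔ α ≤ j := by
  classical
  have hex : ∃ α, t ≤ f α := ⟨t, hf.id_le t⟩
  exact ⟨Nat.find hex, fun j => ⟨Nat.find_min' hex,
    fun h => (Nat.find_spec hex).trans (hf.monotone h)⟩⟩

end Shuffle

section Interleave

variable {E : Type*} [AddCommGroup E] [Module ℂ E] {V : Submodule ℂ E}
  {σ : (E ⧸ V) →ₗ[ℂ] E} (hσ : V.mkQ ∘ₗ σ = LinearMap.id)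

include hσ

theorem mkQ_section (w : E ⧸ V) : V.mkQ (σ w) = w := LinearMap.congr_fun hσ w

theorem mkQ_add_section (v : V) (w : E ⧸ V) : V.mkQ (v + σ w) = w := by
  rw [map_add, mkQ_section hσ, V.mkQ_apply, (Submodule.Quotient.mk_eq_zero V).2 v.2, zero_add]

theorem exists_add_section (x : E) : ∃ (v : V) (w : E ⧸ V), (v : E) + σ w = x :=
  ⟨⟨x - σ (V.mkQ x), by
    rw [← Submodule.Quotient.mk_eq_zero V, ← V.mkQ_apply, map_sub, mkQ_section hσ, sub_self]⟩,
    V.mkQ x, by simp⟩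

/-- The decomposition of `E` as a product given by a section `σ` of the quotient map. -/
def splitEquiv : (V × (E ⧸ V)) ≃ₗ[ℂ] E :=
  LinearEquiv.ofBijective (V.subtype.coprod σ) <| by
    constructor
    · rw [← LinearMap.ker_eq_bot, LinearMap.ker_eq_bot']
      rintro ⟨v, w⟩ hvw
      have hvw' : (v : E) + σ w = 0 := hvw
      have hw := mkQ_add_section hσ v w
      rw [hvw', map_zero] at hw
      subst hw
      simpa using hvw'
    · intro x
      obtain ⟨v, w, h⟩ := exists_add_section hσ x
      exact ⟨(v, w), h⟩

theorem splitEquiv_apply (v : V) (w : E ⧸ V) : splitEquiv hσ (v, w) = v + σ w := rfl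

variable [FiniteDimensional ℂ E] {r : ℕ → ℕ} (hr : IsShuffle (finrank ℂ (E ⧸ V)) r)

/-- The basis of `E` obtained by shuffling a basis of `V` and a basis of `E/V`, the latter lifted
to `E` by the section `σ`. -/
def interleave (e : Basis (Fin (finrank ℂ V)) ℂ V)
    (g : Basis (Fin (finrank ℂ (E ⧸ V))) ℂ (E ⧸ V)) :
    Basis (Fin (finrank ℂ E)) ℂ E :=
  ((e.prod g).map (splitEquiv hσ)).reindex
    (hr.equiv (Submodule.finrank_quotient_add_finrank V).symm)

variable (e : Basis (Fin (finrank ℂ V)) ℂ V) (g : Basis (Fin (finrank ℂ (E ⧸ V))) ℂ (E ⧸ V))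

theorem interleave_apply (k : Fin (finrank ℂ E)) :
    interleave hσ hr e g k =
      Sum.elim (fun j => (e j : E)) (fun j => σ (g j))
        ((hr.equiv (Submodule.finrank_quotient_add_finrank V).symm).symm k) := by
  rw [interleave, Basis.reindex_apply]
  rcases (hr.equiv (Submodule.finrank_quotient_add_finrank V).symm).symm k with j | j <;>
    simp [splitEquiv_apply, Basis.prod_apply]

theorem frameVec_interleave {j : ℕ} (hj : j < finrank ℂ V) :
    frameVec (interleave hσ hr e g) (j + r j) = frameVec e j := by
  have hN := Submodule.finrank_quotient_add_finrank V
  have := hr.le j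
  rw [frameVec, dif_pos (by omega), frameVec, dif_pos hj, interleave_apply]
  have : (hr.equiv hN.symm) (Sum.inl ⟨j, hj⟩) = ⟨j + r j, by omega⟩ := rfl
  rw [← this, Equiv.symm_apply_apply]
  rfl

theorem frameCoord_interleave_add_section {j : ℕ} (hj : j < finrank ℂ V) (v : V) (w : E ⧸ V) :
    frameCoord (interleave hσ hr e g) (j + r j) (v + σ w) = frameCoord e j v := by
  have hN := Submodule.finrank_quotient_add_finrank V
  have := hr.le j
  rw [frameCoord, dif_pos (by omega), frameCoord, dif_pos hj]
  have : (hr.equiv hN.symm) (Sum.inl ⟨j, hj⟩) = ⟨j + r j, by omega⟩ := rfl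
  rw [← this, Basis.coord_apply, interleave, Basis.repr_reindex_apply, Equiv.symm_apply_apply,
    ← splitEquiv_apply hσ]
  simp

theorem frameCoord_interleave {j : ℕ} (hj : j < finrank ℂ V) (v : V) :
    frameCoord (interleave hσ hr e g) (j + r j) v = frameCoord e j v := by
  simpa using frameCoord_interleave_add_section hσ hr e g hj v 0

theorem frameCoord_slot_interleave {k : ℕ} (hk : k < finrank ℂ (E ⧸ V)) (v : V) (w : E ⧸ V) :
    frameCoord (interleave hσ hr e g) (slot (finrank ℂ V) r k) (v + σ w) = frameCoord g k w := by
  have hN := Submodule.finrank_quotient_add_finrank V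
  have := slot_le_add (n := finrank ℂ V) (r := r) k
  rw [frameCoord, dif_pos (by omega), frameCoord, dif_pos hk]
  have : (hr.equiv hN.symm) (Sum.inr ⟨k, hk⟩) = ⟨slot (finrank ℂ V) r k, by omega⟩ := rfl
  rw [← this, Basis.coord_apply, interleave, Basis.repr_reindex_apply, Equiv.symm_apply_apply,
    ← splitEquiv_apply hσ]
  simp

theorem add_section_mem_interleave_space {t α β : ℕ} (hα : ∀ j < finrank ℂ V, t ≤ j + r j ↔ α ≤ j)
    (hβ : ∀ k < finrank ℂ (E ⧸ V), t ≤ slot (finrank ℂ V) r k ↔ β ≤ k) {v : V} {w : E ⧸ V} :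
    (v : E) + σ w ∈ (CompleteFlag.ofBasis (interleave hσ hr e g)).space t ↔
      v ∈ (CompleteFlag.ofBasis e).space α ∧ w ∈ (CompleteFlag.ofBasis g).space β := by
  have hN := Submodule.finrank_quotient_add_finrank V
  simp only [mem_ofBasis_space]
  constructor
  · refine fun h => ⟨fun j hj => ?_, fun k hk => ?_⟩
    · by_cases hj' : j < finrank ℂ V
      · rw [← frameCoord_interleave_add_section hσ hr e g hj' v w]
        exact h _ ((hα j hj').2 hj)
      · simp [frameCoord, hj']
    · by_cases hk' : k < finrank ℂ (E ⧸ V)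
      · rw [← frameCoord_slot_interleave hσ hr e g hk' v w]
        exact h _ ((hβ k hk').2 hk)
      · simp [frameCoord, hk']
  · rintro ⟨h1, h2⟩ l hl
    by_cases hl' : l < finrank ℂ E
    · obtain ⟨x, hx⟩ := (hr.equiv hN.symm).surjective ⟨l, hl'⟩
      have hx' := congrArg Fin.val hx
      rcases x with j | k
      · have hj : (j : ℕ) + r j = l := hx'
        rw [← hj, frameCoord_interleave_add_section hσ hr e g j.2]
        exact h1 _ ((hα j j.2).1 (hj ▸ hl))
      · have hk : slot (finrank ℂ V) r k = l := hx'
        rw [← hk, frameCoord_slot_interleave hσ hr e g k.2]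
        exact h2 _ ((hβ k k.2).1 (hk ▸ hl))
    · simp [frameCoord, hl']

theorem add_section_mem_interleave_space_add {α β : ℕ} (hα : α ≤ finrank ℂ V)
    (hle : ∀ j < α, r j ≤ β) (hge : β ≤ r α) {v : V} {w : E ⧸ V} :
    (v : E) + σ w ∈ (CompleteFlag.ofBasis (interleave hσ hr e g)).space (α + β) ↔
      v ∈ (CompleteFlag.ofBasis e).space α ∧ w ∈ (CompleteFlag.ofBasis g).space β := by
  refine add_section_mem_interleave_space hσ hr e g (fun j _ => ⟨fun h => ?_, fun h => ?_⟩)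
    fun k _ => ⟨fun h => ?_, fun h => ?_⟩
  · by_contra! hj
    have := hle j hj
    omega
  · have := hr.mono h
    omega
  · by_contra! hk
    have := hr.slot_le (n := finrank ℂ V) (hk.trans_le hge)
    omega
  · have := add_le_slot (k := k) hα fun j hj => (hle j hj).trans h
    omega

theorem exists_add_section_mem_interleave_space (t : ℕ) :
    ∃ α β, ∀ (v : V) (w : E ⧸ V),
      (v : E) + σ w ∈ (CompleteFlag.ofBasis (interleave hσ hr e g)).space t ↔
        v ∈ (CompleteFlag.ofBasis e).space α ∧ w ∈ (CompleteFlag.ofBasis g).space β := by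
  obtain ⟨α, hα⟩ := exists_forall_le_iff_le hr.strictMono t
  obtain ⟨β, hβ⟩ := exists_forall_le_iff_le (slot_strictMono (n := finrank ℂ V) (r := r)) t
  exact ⟨α, β, fun v w => add_section_mem_interleave_space hσ hr e g (fun j _ => hα j)
    fun k _ => hβ k⟩

theorem flagOfChain_comap_interleave :
    (flagOfChain fun t => ((CompleteFlag.ofBasis (interleave hσ hr e g)).space t).comap V.subtype) =
      CompleteFlag.ofBasis e := by
  refine flagOfChain_eq (isFlagChain_comap_subtype _ _) _ fun t => ?_
  obtain ⟨α, β, h⟩ := exists_add_section_mem_interleave_space hσ hr e g t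
  refine ⟨α, ?_⟩
  ext v
  have := h v 0
  rw [map_zero, add_zero] at this
  rw [Submodule.mem_comap, Submodule.subtype_apply, this, and_iff_left (Submodule.zero_mem _)]

theorem flagOfChain_map_interleave {X : Submodule ℂ E} (hX : ∀ w, σ w ∈ X) :
    (flagOfChain fun t =>
      (X ⊓ (CompleteFlag.ofBasis (interleave hσ hr e g)).space t).map V.mkQ) =
      CompleteFlag.ofBasis g := by
  have hX' : X.map V.mkQ = ⊤ := by
    rw [eq_top_iff]
    exact fun w _ => ⟨σ w, hX w, mkQ_section hσ w⟩
  refine flagOfChain_eq (isFlagChain_map _ _ _ hX') _ fun t => ?_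
  obtain ⟨α, β, h⟩ := exists_add_section_mem_interleave_space hσ hr e g t
  refine ⟨β, ?_⟩
  ext w
  constructor
  · rintro ⟨x, hx, rfl⟩
    obtain ⟨v, w, rfl⟩ := exists_add_section hσ x
    rw [mkQ_add_section hσ]
    exact ((h v w).1 hx.2).2
  · intro hw
    have := (h 0 w).2 ⟨Submodule.zero_mem _, hw⟩
    rw [Submodule.coe_zero, zero_add] at this
    exact ⟨σ w, ⟨hX w, this⟩, mkQ_section hσ w⟩

end Interleave

section InterleaveTuples

/-- The shuffles for which interleaving inverts the construction of the induced instances. -/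
def shuffleSeq {m : ℕ} (b : ℕ) : Fin (4 + m) → ℕ → ℕ :=
  Fin.append ![fun j => if j < 2 then 0 else if j < 3 then 2 else b,
    fun j => if j < 1 then 0 else if j < 2 then b - 2 else b,
    fun j => if j < 3 then 0 else b,
    fun j => if j < 1 then 0 else b] fun _ j => if j < 2 then 0 else b

theorem isShuffle_shuffleSeq {m b : ℕ} (hb : 2 ≤ b) (i : Fin (4 + m)) :
    IsShuffle b (shuffleSeq b i) := by
  revert i
  rw [forall_fin_four_add]
  simp only [shuffleSeq, Fin.append_left, Fin.append_right, Matrix.cons_val]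
  refine ⟨?_, ?_, ?_, ?_, fun _ => ?_⟩
  all_goals exact ⟨fun i j hij => by split_ifs <;> omega, fun j => by split_ifs <;> omega⟩

variable {E : Type*} [AddCommGroup E] [Module ℂ E] [FiniteDimensional ℂ E] {V : Submodule ℂ E}
  {m b : ℕ} {σ : (E ⧸ V) →ₗ[ℂ] E} (hσ : V.mkQ ∘ₗ σ = LinearMap.id)
  (hr : ∀ i : Fin (4 + m), IsShuffle (finrank ℂ (E ⧸ V)) (shuffleSeq b i))
  (n : Basis (Fin (finrank ℂ V)) ℂ V)

/-- The tuple of bases obtained by shuffling bases of `V` and of `E/V`. Only four bases of `V` vary,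
as the base problem has four conditions; the remaining bases of `E` use the fixed basis `n`. -/
def interleaveFrames (e : Frames 4 V) (g : Frames (4 + m) (E ⧸ V)) : Frames (4 + m) E :=
  fun i => interleave hσ (hr i) (Fin.append e (fun _ : Fin m => n) i) (g i)

theorem isRegularVec_interleaveFrames_left (g : Frames (4 + m) (E ⧸ V)) (i j) :
    IsRegularVec fun e : Frames 4 V => interleaveFrames hσ hr n e g i j := by
  simp only [interleaveFrames, interleave_apply]
  rcases ((hr i).equiv (Submodule.finrank_quotient_add_finrank V).symm).symm j with k | k
  · simp only [Sum.elim_inl]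
    induction i using Fin.addCases with
    | left i =>
      simp only [Fin.append_left]
      exact (IsRegularVec.basis i k).map V.subtype
    | right i =>
      simp only [Fin.append_right]
      exact IsRegularVec.const _
  · exact IsRegularVec.const _

theorem isRegularVec_interleaveFrames_right (e : Frames 4 V) (i j) :
    IsRegularVec fun g : Frames (4 + m) (E ⧸ V) => interleaveFrames hσ hr n e g i j := by
  simp only [interleaveFrames, interleave_apply]
  rcases ((hr i).equiv (Submodule.finrank_quotient_add_finrank V).symm).symm j with k | k
  · exact IsRegularVec.const _
  · exact (IsRegularVec.basis i k).map σ

variable (e : Frames 4 V) (g : Frames (4 + m) (E ⧸ V))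

section Spaces

variable (hV : finrank ℂ V = 4) (v : V) (w : E ⧸ V)

include hV

theorem add_section_mem_spaceA_iff :
    (v : E) + σ w ∈ spaceA (frameFlags (interleaveFrames hσ hr n e g)) ↔
      v ∈ (CompleteFlag.ofBasis (e 0)).space 2 ∧
        w ∈ (CompleteFlag.ofBasis (g (Fin.castAdd m 0))).space 2 := by
  rw [← add_section_mem_interleave_space_add hσ (hr (Fin.castAdd m 0)) (e 0) _ (by omega)
    (fun j hj => by simp [shuffleSeq, Fin.append_left, show j ≤ 1 by omega])
    (by simp [shuffleSeq, Fin.append_left]), spaceA]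
  simp only [frameFlags, interleaveFrames, Fin.append_left]

theorem add_section_mem_spaceC_iff (hb : 2 ≤ b) :
    (v : E) + σ w ∈ spaceC b (frameFlags (interleaveFrames hσ hr n e g)) ↔
      v ∈ (CompleteFlag.ofBasis (e 1)).space 2 ∧
        w ∈ (CompleteFlag.ofBasis (g (Fin.castAdd m 1))).space (b - 2) := by
  rw [← add_section_mem_interleave_space_add hσ (hr (Fin.castAdd m 1)) (e 1) _ (by omega)
    (fun j hj => by
      simp only [shuffleSeq, Fin.append_left, Matrix.cons_val]
      split_ifs <;> omega)
    (by simp [shuffleSeq, Fin.append_left]), Nat.add_sub_cancel' hb, spaceC]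
  simp only [frameFlags, interleaveFrames, Fin.append_left]

theorem add_section_mem_spaceB_iff :
    (v : E) + σ w ∈ spaceB (frameFlags (interleaveFrames hσ hr n e g)) ↔
      v ∈ (CompleteFlag.ofBasis (e 2)).space 2 ∧ w = 0 := by
  have h := add_section_mem_interleave_space_add hσ (hr (Fin.castAdd m 2)) (e 2)
    (g (Fin.castAdd m 2)) (α := 2) (β := 0) (v := v) (w := w) (by omega)
    (fun j hj => by simp [shuffleSeq, Fin.append_left, show j < 3 by omega]) (Nat.zero_le _)
  rw [CompleteFlag.space_zero, Submodule.mem_bot] at h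
  rw [← h, spaceB]
  simp only [frameFlags, interleaveFrames, Fin.append_left]

theorem section_mem_spaceD (hW : finrank ℂ (E ⧸ V) = b) :
    σ w ∈ spaceD b (frameFlags (interleaveFrames hσ hr n e g)) := by
  have h := add_section_mem_interleave_space_add hσ (hr (Fin.castAdd m 3)) (e 3)
    (g (Fin.castAdd m 3)) (α := 2) (β := b) (v := 0) (w := w) (by omega)
    (fun j _ => ((hr (Fin.castAdd m 3)).le j).trans hW.le)
    (by simp [shuffleSeq, Fin.append_left])
  rw [CompleteFlag.space_eq_top _ hW.le, Submodule.coe_zero, zero_add, add_comm 2] at h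
  rw [spaceD]
  simp only [frameFlags, interleaveFrames, Fin.append_left]
  exact h.2 ⟨Submodule.zero_mem _, trivial⟩

end Spaces

section Induced

variable (hb : 2 ≤ b) (hV : finrank ℂ V = 4) (hW : finrank ℂ (E ⧸ V) = b)

include hb hV

section Complement

variable (hAC : spaceA (frameFlags (interleaveFrames hσ hr n e g)) ⊓
  spaceC b (frameFlags (interleaveFrames hσ hr n e g)) = ⊥)

include hAC

theorem space_two_sup_space_two_eq_top :
    (CompleteFlag.ofBasis (e 0)).space 2 ⊔ (CompleteFlag.ofBasis (e 1)).space 2 = ⊤ := by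
  refine Submodule.eq_top_of_disjoint _ _ ?_ (disjoint_iff.2 (eq_bot_iff.2 ?_))
  · rw [CompleteFlag.finrank_space, CompleteFlag.finrank_space]
    omega
  · rintro v ⟨h0, h1⟩
    have h := hAC.le ⟨(add_section_mem_spaceA_iff hσ hr n e g hV v 0).2 ⟨h0, zero_mem _⟩,
      (add_section_mem_spaceC_iff hσ hr n e g hV v 0 hb).2 ⟨h1, zero_mem _⟩⟩
    simpa using h

include hW

theorem space_two_sup_space_sub_two_eq_top :
    (CompleteFlag.ofBasis (g (Fin.castAdd m 0))).space 2 ⊔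
      (CompleteFlag.ofBasis (g (Fin.castAdd m 1))).space (b - 2) = ⊤ := by
  refine Submodule.eq_top_of_disjoint _ _ ?_ (disjoint_iff.2 (eq_bot_iff.2 ?_))
  · rw [CompleteFlag.finrank_space, CompleteFlag.finrank_space]
    omega
  · rintro w ⟨h0, h1⟩
    have h := hAC.le ⟨(add_section_mem_spaceA_iff hσ hr n e g hV 0 w).2 ⟨zero_mem _, h0⟩,
      (add_section_mem_spaceC_iff hσ hr n e g hV 0 w hb).2 ⟨zero_mem _, h1⟩⟩
    rw [Submodule.coe_zero, zero_add, Submodule.mem_bot] at h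
    rw [Submodule.mem_bot, ← mkQ_section hσ w, h, map_zero]

theorem section_mem_solutionSpan (h : Submodule ℂ E) (w : E ⧸ V) :
    σ w ∈ solutionSpan b (frameFlags (interleaveFrames hσ hr n e g)) h := by
  have hA (w) := add_section_mem_spaceA_iff hσ hr n e g hV 0 w
  have hC (w) := add_section_mem_spaceC_iff hσ hr n e g hV 0 w hb
  have hD (w) := section_mem_spaceD hσ hr n e g hV w hW
  simp only [Submodule.coe_zero, zero_add, Submodule.zero_mem, true_and] at hA hC
  obtain ⟨w₁, h1, w₂, h2, rfl⟩ := Submodule.mem_sup.1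
    ((space_two_sup_space_sub_two_eq_top hσ hr n e g hb hV hW hAC).ge (Submodule.mem_top (x := w)))
  rw [map_add]
  exact add_mem (Submodule.mem_sup_left ⟨(hA w₁).2 h1, Submodule.mem_sup_left (hD w₁)⟩)
    (Submodule.mem_sup_right ⟨(hC w₂).2 h2, Submodule.mem_sup_left (hD w₂)⟩)

end Complement

variable (T : IsTransverse 4 b (spaceA (frameFlags (interleaveFrames hσ hr n e g)))
  (spaceC b (frameFlags (interleaveFrames hσ hr n e g)))
  (spaceB (frameFlags (interleaveFrames hσ hr n e g)))
  (spaceD b (frameFlags (interleaveFrames hσ hr n e g))))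

include T

theorem baseSpace_interleaveFrames :
    baseSpace b (frameFlags (interleaveFrames hσ hr n e g)) = V := by
  have mem_V {p w : E} (hp : p ∈ spaceA (frameFlags (interleaveFrames hσ hr n e g)))
      (hw : w ∈ spaceC b (frameFlags (interleaveFrames hσ hr n e g)))
      (hpw : p + w ∈ spaceB (frameFlags (interleaveFrames hσ hr n e g))) : p ∈ V ∧ w ∈ V := by
    obtain ⟨v, z, hvz⟩ := exists_add_section hσ (p + w)
    rw [← hvz] at hpw
    obtain ⟨-, rfl⟩ := (add_section_mem_spaceB_iff hσ hr n e g hV v z).1 hpw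
    obtain ⟨v₁, h1, v₂, h2, rfl⟩ := Submodule.mem_sup.1
      ((space_two_sup_space_two_eq_top hσ hr n e g hb hV T.inf_eq_bot).ge
        (Submodule.mem_top (x := v)))
    have hA := (add_section_mem_spaceA_iff hσ hr n e g hV v₁ 0).2 ⟨h1, zero_mem _⟩
    have hC := (add_section_mem_spaceC_iff hσ hr n e g hV v₂ 0 hb).2 ⟨h2, zero_mem _⟩
    rw [map_zero, add_zero] at hA hC hvz
    obtain ⟨rfl, rfl⟩ := eq_and_eq_of_add_eq_add T.inf_eq_bot hp hA hw hC hvz.symm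
    exact ⟨v₁.2, v₂.2⟩
  refine Submodule.eq_of_le_of_finrank_eq (sup_le (fun p hp => ?_) fun w hw => ?_)
    (T.finrank_crossSpace.trans hV.symm)
  · obtain ⟨hp, w, hw, hpw⟩ := mem_inf_sup_iff.1 hp
    exact (mem_V hp hw hpw).1
  · obtain ⟨hw, p, hp, hwp⟩ := mem_inf_sup_iff.1 hw
    exact (mem_V hp hw (add_comm w p ▸ hwp)).2

include hW

theorem inducedOn_interleaveFrames :
    inducedOn b (frameFlags (interleaveFrames hσ hr n e g))
      (baseSpace b (frameFlags (interleaveFrames hσ hr n e g))) =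
    ⟨V, frameFlags e, fun _ => frameFlags g⟩ := by
  rw [baseSpace_interleaveFrames hσ hr n e g hb hV T]
  have h1 : baseFlags (frameFlags (interleaveFrames hσ hr n e g)) V = frameFlags e := by
    funext i
    have := flagOfChain_comap_interleave hσ (hr (Fin.castAdd m i)) (e i) (g (Fin.castAdd m i))
    simpa only [baseFlags, frameFlags, interleaveFrames, Fin.append_left] using this
  have h2 (h : Submodule ℂ E) :
      fiberFlags b (frameFlags (interleaveFrames hσ hr n e g)) V h = frameFlags g := by
    funext i
    exact flagOfChain_map_interleave hσ (hr i) _ (g i)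
      (section_mem_solutionSpan hσ hr n e g hb hV hW T.inf_eq_bot h)
  simp only [inducedOn, h1, h2]

end Induced

end InterleaveTuples

/-! ### A model in general position -/

section BasisOfMatrix

theorem exists_basis_of_mul_eq_one {V : Type*} [AddCommGroup V] [Module ℂ V] {n : ℕ}
    (v : Basis (Fin n) ℂ V) {M N : Matrix (Fin n) (Fin n) ℂ} (hMN : M * N = 1) :
    ∃ e : Basis (Fin (finrank ℂ V)) ℂ V, (∀ i : Fin n, frameVec e i = v.equivFun.symm (M i)) ∧
      ∀ (i : Fin n) (x : Fin n → ℂ), frameCoord e i (v.equivFun.symm x) = Matrix.vecMul x N i := by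
  obtain rfl : finrank ℂ V = n := by simpa using finrank_eq_card_basis v
  have hNM := mul_eq_one_comm.1 hMN
  let T : (Fin (finrank ℂ V) → ℂ) ≃ₗ[ℂ] (Fin (finrank ℂ V) → ℂ) :=
    LinearEquiv.ofLinearMap (Matrix.vecMulLinear N) (Matrix.vecMulLinear M)
      (LinearMap.ext fun x => by simp [Matrix.vecMul_vecMul, hMN])
      (LinearMap.ext fun x => by simp [Matrix.vecMul_vecMul, hNM])
  let L : V ≃ₗ[ℂ] (Fin (finrank ℂ V) → ℂ) := v.equivFun.trans T
  refine ⟨Basis.ofEquivFun L, fun i => ?_, fun i x => ?_⟩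
  · rw [frameVec, dif_pos i.2, Basis.coe_ofEquivFun]
    simp [L, T]
  · have hL : L (v.equivFun.symm x) = Matrix.vecMul x N := by
      simp only [L, LinearEquiv.trans_apply, LinearEquiv.apply_symm_apply]
      rfl
    rw [frameCoord, dif_pos i.2, Basis.coord_apply, Basis.ofEquivFun_repr_apply, hL]

end BasisOfMatrix

section ModelTuple

variable {E : Type*} [AddCommGroup E] [Module ℂ E] {m : ℕ}

/-- An explicit tuple of bases in general position, given by the coordinates in `V` with respect to
a parametrization `u` of `V`: the spaces `A` and `C` meet `V` in the coordinate planes, and `B` is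
spanned by `u ![1, 0, 1, 0]` and `u ![0, 1, 0, 1]`. Only the vectors and coordinates that enter the
conditions of `IsGood` are recorded. -/
structure IsModelTuple (b : ℕ) (u : (Fin 4 → ℂ) →ₗ[ℂ] E) (f : Frames (4 + m) E) : Prop where
  det_ne : (crossMatrix b f).det ≠ 0
  projA_apply : ∀ x, projA b f (u x) = (crossMatrix b f).det • u ![x 0, x 1, 0, 0]
  projC_apply : ∀ x, projC b f (u x) = (crossMatrix b f).det • u ![0, 0, x 2, x 3]
  vec_first : frameVec (f (Fin.castAdd m 0)) 4 = u ![0, 0, 1, 1]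
  vec_second : frameVec (f (Fin.castAdd m 1)) 0 = u ![0, 0, 1, 1]
  vec_third_zero : frameVec (f (Fin.castAdd m 2)) 0 = u ![1, 0, 1, 0]
  vec_third_one : frameVec (f (Fin.castAdd m 2)) 1 = u ![0, 1, 0, 1]
  vec_third_two : frameVec (f (Fin.castAdd m 2)) 2 = u ![1, 1, 0, 0]
  vec_fourth : frameVec (f (Fin.castAdd m 3)) 0 = u ![-1, 1, 1, 1]
  vec_last_zero : ∀ j, frameVec (f (Fin.natAdd 4 j)) 0 = u ![1, 1, 0, 0]
  vec_last_one : ∀ j, frameVec (f (Fin.natAdd 4 j)) 1 = u ![0, 0, 1, 1]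
  coord_first : ∀ x, frameCoord (f (Fin.castAdd m 0)) (b + 3) (u x) = x 3 - x 2
  coord_second : ∀ x, frameCoord (f (Fin.castAdd m 1)) (b - 1) (u x) = x 3 - x 2
  coord_third : ∀ x, frameCoord (f (Fin.castAdd m 2)) (b + 3) (u x) = x 1 - x 3 - x 0 + x 2
  coord_fourth_one : ∀ x, frameCoord (f (Fin.castAdd m 3)) (b + 1) (u x) = x 3 - x 2
  coord_fourth_two : ∀ x,
    frameCoord (f (Fin.castAdd m 3)) (b + 2) (u x) = x 0 + x 2 - x 1 + x 3
  coord_fourth_three : ∀ x, frameCoord (f (Fin.castAdd m 3)) (b + 3) (u x) = x 1 - x 3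
  coord_last_two : ∀ j x, frameCoord (f (Fin.natAdd 4 j)) (b + 2) (u x) = x 1 - x 0
  coord_last_three : ∀ j x, frameCoord (f (Fin.natAdd 4 j)) (b + 3) (u x) = x 3 - x 2

namespace IsModelTuple

variable {b : ℕ} {u : (Fin 4 → ℂ) →ₗ[ℂ] E} {f : Frames (4 + m) E} (hf : IsModelTuple b u f)

include hf

theorem pointB_eq (s t : ℂ) : pointB f s t = u ![s, t, s, t] := by
  rw [pointB, hf.vec_third_zero, hf.vec_third_one, ← map_smul, ← map_smul, ← map_add]
  simp

theorem projA_pointB (s t : ℂ) :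
    projA b f (pointB f s t) = (crossMatrix b f).det • u ![s, t, 0, 0] := by
  rw [hf.pointB_eq, hf.projA_apply]
  rfl

theorem projC_pointB (s t : ℂ) :
    projC b f (pointB f s t) = (crossMatrix b f).det • u ![0, 0, s, t] := by
  rw [hf.pointB_eq, hf.projC_apply]
  rfl

theorem normalForm_apply (s t : ℂ) (x : Fin 4 → ℂ) : normalForm b f s t (u x) =
    (crossMatrix b f).det * ((s - t) * (x 1 - x 3) - t * (x 0 + x 2 - x 1 + x 3)) := by
  simp only [normalForm, coordMinor_apply, hf.projA_pointB, map_smul, hf.coord_fourth_two,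
    hf.coord_fourth_three, smul_eq_mul, Matrix.cons_val]
  ring

theorem baseForm_eq (s t : ℂ) : baseForm b f s t = -2 * (crossMatrix b f).det ^ 2 * (s * t) := by
  simp only [baseForm, hf.projC_pointB, map_smul, hf.normalForm_apply, smul_eq_mul,
    Matrix.cons_val]
  ring

theorem spanForm_apply (s t : ℂ) (x y : Fin 4 → ℂ) : spanForm b f s t (u x) (u y) =
    (crossMatrix b f).det ^ 4 *
      (((s - t) * x 1 - t * (x 0 - x 1)) * (-(s - t) * y 3 - t * (y 2 + y 3)) -
        ((s - t) * y 1 - t * (y 0 - y 1)) * (-(s - t) * x 3 - t * (x 2 + x 3))) := by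
  simp only [spanForm, hf.projA_apply, hf.projC_apply, map_smul, hf.normalForm_apply, smul_eq_mul,
    Matrix.cons_val]
  ring

theorem mem_noCommonZero_baseForm {q : Frames (4 + m) E → ℂ → ℂ → ℂ} {c d k : ℂ}
    (hc : c ≠ 0) (hd : d ≠ 0) (hq : ∀ s t, q f s t = c * s ^ 2 + k * (s * t) + d * t ^ 2) :
    f ∈ noCommonZero (baseForm b) q := fun s t hst h0 => by
  rw [hf.baseForm_eq] at h0
  rcases mul_eq_zero.1 ((mul_eq_zero.1 h0).resolve_left (by simp [hf.det_ne])) with rfl | rfl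
  · rw [hq]
    simpa [hd] using hst
  · rw [hq]
    simpa [hc] using hst

theorem projA_mem_noCommonZero : f ∈ noCommonZero
    (fun e s t => frameCoord (e (Fin.castAdd m 3)) (b + 2) (projA b e (pointB e s t)))
    (fun e s t => frameCoord (e (Fin.castAdd m 3)) (b + 3) (projA b e (pointB e s t))) := by
  intro s t hst h0
  simp only [hf.projA_pointB, map_smul, hf.coord_fourth_two, hf.coord_fourth_three, smul_eq_mul,
    Matrix.cons_val] at h0 ⊢
  obtain rfl : s = t := by simpa [hf.det_ne, sub_eq_zero] using h0
  simpa [hf.det_ne] using hst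

theorem projC_mem_noCommonZero : f ∈ noCommonZero
    (fun e s t => frameCoord (e (Fin.castAdd m 3)) (b + 2) (projC b e (pointB e s t)))
    (fun e s t => frameCoord (e (Fin.castAdd m 3)) (b + 3) (projC b e (pointB e s t))) := by
  intro s t hst h0
  simp only [hf.projC_pointB, map_smul, hf.coord_fourth_two, hf.coord_fourth_three, smul_eq_mul,
    Matrix.cons_val] at h0 ⊢
  obtain rfl : s = -t := eq_neg_of_add_eq_zero_left (by simpa [hf.det_ne] using h0)
  simpa [hf.det_ne] using hst

theorem isGood : IsGood b f := by
  have hdet (k : ℕ) : (crossMatrix b f).det ^ k ≠ 0 := pow_ne_zero k hf.det_ne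
  have hneg (k : ℕ) : -(crossMatrix b f).det ^ k ≠ 0 := neg_ne_zero.2 (hdet k)
  refine ⟨hf.det_ne, hf.projA_mem_noCommonZero, hf.projC_mem_noCommonZero, ?_, ?_, ?_, ?_,
    ?_, fun j => ?_, fun j => ?_⟩
  · refine hf.mem_noCommonZero_baseForm (hdet 3) (hneg 3) (k := 0) fun s t => ?_
    simp only [hf.vec_first, hf.projC_apply, hf.normalForm_apply, hf.projC_pointB, map_smul,
      hf.coord_first, smul_eq_mul, Matrix.cons_val]
    ring
  · refine hf.mem_noCommonZero_baseForm (hdet 2) (hneg 2) (k := 0) fun s t => ?_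
    simp only [hf.vec_second, hf.normalForm_apply, hf.projC_pointB, map_smul,
      hf.coord_second, smul_eq_mul, Matrix.cons_val]
    ring
  · refine hf.mem_noCommonZero_baseForm (hneg 3) (hdet 3) (k := 0) fun s t => ?_
    simp only [hf.vec_fourth, hf.projA_apply, hf.normalForm_apply, hf.projA_pointB, map_smul,
      hf.coord_third, smul_eq_mul, Matrix.cons_val]
    ring
  · refine hf.mem_noCommonZero_baseForm (hdet 4) (hneg 4) (k := 0) fun s t => ?_
    simp only [hf.vec_third_two, hf.pointB_eq, hf.spanForm_apply, Matrix.cons_val]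
    ring
  · refine hf.mem_noCommonZero_baseForm (hdet 2) (hdet 2) (k := -2 * (crossMatrix b f).det ^ 2)
      fun s t => ?_
    simp only [coordMinor_apply, hf.projA_pointB, hf.projC_pointB, map_smul, hf.coord_fourth_one,
      hf.coord_fourth_two, smul_eq_mul, Matrix.cons_val]
    ring
  · refine hf.mem_noCommonZero_baseForm (hneg 4) (hdet 4) (k := 0) fun s t => ?_
    simp only [hf.vec_last_zero, hf.vec_last_one, hf.spanForm_apply, Matrix.cons_val]
    ring
  · refine hf.mem_noCommonZero_baseForm (hdet 2) (hdet 2) (k := -2 * (crossMatrix b f).det ^ 2)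
      fun s t => ?_
    simp only [coordMinor_apply, hf.projA_pointB, hf.projC_pointB, map_smul, hf.coord_last_two,
      hf.coord_last_three, smul_eq_mul, Matrix.cons_val]
    ring

end IsModelTuple

end ModelTuple

section ModelBases

/-- The rows are the coordinates of the bases of a four-dimensional space from which the model tuple
is built. All conditions after the fourth share one basis. -/
def modelMatrix {m : ℕ} : Fin (4 + m) → Matrix (Fin 4) (Fin 4) ℂ :=
  Fin.append ![!![1, 0, 0, 0; 0, 1, 0, 0; 0, 0, 1, 1; 0, 0, 0, 1],
    !![0, 0, 1, 1; 0, 0, 0, 1; 1, 0, 0, 0; 0, 1, 0, 0],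
    !![1, 0, 1, 0; 0, 1, 0, 1; 1, 1, 0, 0; 0, 1, 0, 0],
    !![-1, 1, 1, 1; 0, 1, 0, 1; 1, 0, 0, 0; 1, 1, 0, 0]]
    fun _ => !![1, 1, 0, 0; 0, 0, 1, 1; 0, 1, 0, 0; 0, 0, 0, 1]

/-- The inverses of the matrices `modelMatrix`; their columns are the coordinate forms. -/
def modelInverse {m : ℕ} : Fin (4 + m) → Matrix (Fin 4) (Fin 4) ℂ :=
  Fin.append ![!![1, 0, 0, 0; 0, 1, 0, 0; 0, 0, 1, -1; 0, 0, 0, 1],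
    !![0, 0, 1, 0; 0, 0, 0, 1; 1, -1, 0, 0; 0, 1, 0, 0],
    !![0, 0, 1, -1; 0, 0, 0, 1; 1, 0, -1, 1; 0, 1, 0, -1],
    !![0, 0, 1, 0; 0, 0, -1, 1; 1, -1, 1, 0; 0, 1, 1, -1]]
    fun _ => !![1, 0, -1, 0; 0, 0, 1, 0; 0, 1, 0, -1; 0, 0, 0, 1]

theorem modelMatrix_mul_modelInverse {m : ℕ} (i : Fin (4 + m)) :
    modelMatrix i * modelInverse i = 1 := by
  revert i
  rw [forall_fin_four_add]
  simp only [modelMatrix, modelInverse, Fin.append_left, Fin.append_right, Matrix.cons_val]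
  refine ⟨?_, ?_, ?_, ?_, fun _ => ?_⟩
  all_goals
    ext i j
    fin_cases i <;> fin_cases j <;> simp [Matrix.mul_apply, Fin.sum_univ_four]

variable {V : Type*} [AddCommGroup V] [Module ℂ V]

/-- The four bases `e i` and the basis `n` of `V` have the rows of `modelMatrix` as coordinates with
respect to `v`. -/
structure IsModelFrames (m : ℕ) (v : Basis (Fin 4) ℂ V) (e : Frames 4 V)
    (n : Basis (Fin (finrank ℂ V)) ℂ V) : Prop where
  frameVec_eq : ∀ (i : Fin (4 + m)) (j : Fin 4),
    frameVec (Fin.append e (fun _ => n) i) j = v.equivFun.symm (modelMatrix i j)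
  frameCoord_eq : ∀ (i : Fin (4 + m)) (j : Fin 4) (x : Fin 4 → ℂ),
    frameCoord (Fin.append e (fun _ => n) i) j (v.equivFun.symm x) =
      Matrix.vecMul x (modelInverse i) j

theorem exists_isModelFrames (m : ℕ) (v : Basis (Fin 4) ℂ V) : ∃ e n, IsModelFrames m v e n := by
  choose f hvec hcoord using fun i : Fin (4 + 1) =>
    exists_basis_of_mul_eq_one v (modelMatrix_mul_modelInverse i)
  refine ⟨fun i => f (Fin.castAdd 1 i), f (Fin.natAdd 4 0), fun i => ?_, fun i => ?_⟩
  · induction i using Fin.addCases with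
    | left i => simpa only [modelMatrix, Fin.append_left] using hvec (Fin.castAdd 1 i)
    | right j => simpa only [modelMatrix, Fin.append_right] using hvec (Fin.natAdd 4 0)
  · induction i using Fin.addCases with
    | left i => simpa only [modelInverse, Fin.append_left] using hcoord (Fin.castAdd 1 i)
    | right j => simpa only [modelInverse, Fin.append_right] using hcoord (Fin.natAdd 4 0)

end ModelBases

section ModelInterleaved

variable {E : Type*} [AddCommGroup E] [Module ℂ E] {V : Submodule ℂ E}

/-- The parametrization of `V`, as a subspace of `E`, by coordinates with respect to `v`. -/
def coordMap (v : Basis (Fin 4) ℂ V) : (Fin 4 → ℂ) →ₗ[ℂ] E :=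
  V.subtype ∘ₗ v.equivFun.symm.toLinearMap

theorem coordMap_apply (v : Basis (Fin 4) ℂ V) (x : Fin 4 → ℂ) :
    coordMap v x = (v.equivFun.symm x : E) :=
  rfl

variable [FiniteDimensional ℂ E] {m b : ℕ} {v : Basis (Fin 4) ℂ V} {e : Frames 4 V}
  {n : Basis (Fin (finrank ℂ V)) ℂ V}

theorem mem_ofBasis_space_two_iff {f : Basis (Fin (finrank ℂ V)) ℂ V} (hV : finrank ℂ V = 4)
    {y : V} :
    y ∈ (CompleteFlag.ofBasis f).space 2 ↔ frameCoord f 2 y = 0 ∧ frameCoord f 3 y = 0 := by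
  rw [mem_ofBasis_space]
  refine ⟨fun h => ⟨h 2 le_rfl, h 3 (by omega)⟩, fun ⟨h2, h3⟩ k hk => ?_⟩
  by_cases hk4 : k < 4
  · obtain rfl | rfl : k = 2 ∨ k = 3 := by omega
    exacts [h2, h3]
  · simp [frameCoord, hV, hk4]

namespace IsModelFrames

variable (he : IsModelFrames m v e n) (hV : finrank ℂ V = 4)

include he hV

theorem mem_space_first_iff (x : Fin 4 → ℂ) :
    v.equivFun.symm x ∈ (CompleteFlag.ofBasis (e 0)).space 2 ↔ x 2 = 0 ∧ x 3 = 0 := by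
  have h2 : frameCoord (e 0) 2 (v.equivFun.symm x) = x 2 := by
    simpa [modelInverse, Fin.append_left, Matrix.vecMul, dotProduct, Fin.sum_univ_four,
      -Basis.equivFun_symm_apply] using he.frameCoord_eq (Fin.castAdd m 0) 2 x
  have h3 : frameCoord (e 0) 3 (v.equivFun.symm x) = -x 2 + x 3 := by
    simpa [modelInverse, Fin.append_left, Matrix.vecMul, dotProduct, Fin.sum_univ_four,
      -Basis.equivFun_symm_apply] using he.frameCoord_eq (Fin.castAdd m 0) 3 x
  rw [mem_ofBasis_space_two_iff hV, h2, h3]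
  exact and_congr_right fun h => by rw [h, neg_zero, zero_add]

theorem mem_space_second_iff (x : Fin 4 → ℂ) :
    v.equivFun.symm x ∈ (CompleteFlag.ofBasis (e 1)).space 2 ↔ x 0 = 0 ∧ x 1 = 0 := by
  have h2 : frameCoord (e 1) 2 (v.equivFun.symm x) = x 0 := by
    simpa [modelInverse, Fin.append_left, Matrix.vecMul, dotProduct, Fin.sum_univ_four,
      -Basis.equivFun_symm_apply] using he.frameCoord_eq (Fin.castAdd m 1) 2 x
  have h3 : frameCoord (e 1) 3 (v.equivFun.symm x) = x 1 := by
    simpa [modelInverse, Fin.append_left, Matrix.vecMul, dotProduct, Fin.sum_univ_four,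
      -Basis.equivFun_symm_apply] using he.frameCoord_eq (Fin.castAdd m 1) 3 x
  rw [mem_ofBasis_space_two_iff hV, h2, h3]

variable {σ : (E ⧸ V) →ₗ[ℂ] E} (hσ : V.mkQ ∘ₗ σ = LinearMap.id)
  (hr : ∀ i : Fin (4 + m), IsShuffle (finrank ℂ (E ⧸ V)) (shuffleSeq b i))
  (g : Frames (4 + m) (E ⧸ V))

theorem frameVec_interleaveFrames (i : Fin (4 + m)) (j : Fin 4) {l : ℕ}
    (hl : j + shuffleSeq b i j = l) :
    frameVec (interleaveFrames hσ hr n e g i) l = coordMap v (modelMatrix i j) := by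
  rw [← hl, interleaveFrames, frameVec_interleave hσ _ _ _ (by rw [hV]; exact j.2),
    he.frameVec_eq, coordMap_apply]

theorem frameCoord_interleaveFrames (i : Fin (4 + m)) (j : Fin 4) {l : ℕ}
    (hl : j + shuffleSeq b i j = l) (x : Fin 4 → ℂ) :
    frameCoord (interleaveFrames hσ hr n e g i) l (coordMap v x) =
      Matrix.vecMul x (modelInverse i) j := by
  rw [← hl, interleaveFrames, coordMap_apply,
    frameCoord_interleave hσ _ _ _ (by rw [hV]; exact j.2), he.frameCoord_eq]

variable (hb : 2 ≤ b) (hE : finrank ℂ E = b + 4)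
  (hg : (CompleteFlag.ofBasis (g (Fin.castAdd m 0))).space 2 ⊓
    (CompleteFlag.ofBasis (g (Fin.castAdd m 1))).space (b - 2) = ⊥)

include hb hE hg

theorem det_crossMatrix_ne_zero : (crossMatrix b (interleaveFrames hσ hr n e g)).det ≠ 0 := by
  rw [det_crossMatrix_ne_zero_iff hE, Submodule.eq_bot_iff]
  rintro x ⟨hA, hC⟩
  obtain ⟨y, w, rfl⟩ := exists_add_section hσ x
  obtain ⟨x, rfl⟩ := v.equivFun.symm.surjective y
  obtain ⟨hxA, hwA⟩ := (add_section_mem_spaceA_iff hσ hr n e g hV _ _).1 hA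
  obtain ⟨hxC, hwC⟩ := (add_section_mem_spaceC_iff hσ hr n e g hV _ _ hb).1 hC
  obtain ⟨h2, h3⟩ := (he.mem_space_first_iff hV x).1 hxA
  obtain ⟨h0, h1⟩ := (he.mem_space_second_iff hV x).1 hxC
  have hx : x = 0 := funext fun i => by fin_cases i <;> assumption
  rw [(Submodule.eq_bot_iff _).1 hg w ⟨hwA, hwC⟩, hx]
  simp

theorem proj_coordMap (x : Fin 4 → ℂ) :
    projA b (interleaveFrames hσ hr n e g) (coordMap v x) =
        (crossMatrix b (interleaveFrames hσ hr n e g)).det • coordMap v ![x 0, x 1, 0, 0] ∧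
      projC b (interleaveFrames hσ hr n e g) (coordMap v x) =
        (crossMatrix b (interleaveFrames hσ hr n e g)).det • coordMap v ![0, 0, x 2, x 3] := by
  have hA := (add_section_mem_spaceA_iff hσ hr n e g hV _ _).2
    ⟨(he.mem_space_first_iff hV ![x 0, x 1, 0, 0]).2 ⟨rfl, rfl⟩, Submodule.zero_mem _⟩
  have hC := (add_section_mem_spaceC_iff hσ hr n e g hV _ _ hb).2
    ⟨(he.mem_space_second_iff hV ![0, 0, x 2, x 3]).2 ⟨rfl, rfl⟩, Submodule.zero_mem _⟩
  rw [map_zero, add_zero, ← coordMap_apply] at hA hC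
  have hx : ![x 0, x 1, 0, 0] + ![0, 0, x 2, x 3] = x := by
    funext i
    fin_cases i <;> simp
  have h := proj_of_add hE (he.det_crossMatrix_ne_zero hV hσ hr g hb hE hg) hA hC
  rwa [← map_add, hx] at h

theorem isModelTuple : IsModelTuple b (coordMap v) (interleaveFrames hσ hr n e g) := by
  have hvec := he.frameVec_interleaveFrames hV hσ hr g
  have hcoord := he.frameCoord_interleaveFrames hV hσ hr g
  have hproj := he.proj_coordMap hV hσ hr g hb hE hg
  refine ⟨he.det_crossMatrix_ne_zero hV hσ hr g hb hE hg, fun x => (hproj x).1,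
    fun x => (hproj x).2,
    hvec _ 2 ?_, hvec _ 0 ?_, hvec _ 0 ?_, hvec _ 1 ?_, hvec _ 2 ?_, hvec _ 0 ?_,
    fun k => (hvec _ 0 ?_).trans ?_, fun k => (hvec _ 1 ?_).trans ?_,
    fun x => (hcoord _ 3 ?_ x).trans ?_, fun x => (hcoord _ 1 ?_ x).trans ?_,
    fun x => (hcoord _ 3 ?_ x).trans ?_, fun x => (hcoord _ 1 ?_ x).trans ?_,
    fun x => (hcoord _ 2 ?_ x).trans ?_, fun x => (hcoord _ 3 ?_ x).trans ?_,
    fun k x => (hcoord _ 2 ?_ x).trans ?_, fun k x => (hcoord _ 3 ?_ x).trans ?_⟩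
  all_goals
    simp only [shuffleSeq, modelMatrix, modelInverse, Fin.append_left, Fin.append_right,
      Matrix.cons_val, Matrix.of_apply, Matrix.vecMul, dotProduct, Fin.sum_univ_four,
      Fin.coe_ofNat_eq_mod, Nat.reduceMod, Nat.reduceLT, if_true, if_false]
  all_goals first | omega | rfl | ring

end IsModelFrames

theorem exists_transverse_frames {W : Type*} [AddCommGroup W] [Module ℂ W] [FiniteDimensional ℂ W]
    (hW : finrank ℂ W = b) : ∃ g : Frames (4 + m) W,
      (CompleteFlag.ofBasis (g (Fin.castAdd m 0))).space 2 ⊓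
        (CompleteFlag.ofBasis (g (Fin.castAdd m 1))).space (b - 2) = ⊥ := by
  refine ⟨Fin.append ![finBasis ℂ W, (finBasis ℂ W).reindex Fin.revPerm, finBasis ℂ W,
    finBasis ℂ W] fun _ => finBasis ℂ W, ?_⟩
  simp only [Fin.append_left, Matrix.cons_val, Submodule.eq_bot_iff]
  rintro x ⟨h1, h2⟩
  rw [SetLike.mem_coe, mem_ofBasis_space] at h1 h2
  refine (finBasis ℂ W).ext_elem fun i => ?_
  rcases lt_or_ge (i : ℕ) 2 with hi | hi
  · have h := h2 (Fin.rev i) (by rw [Fin.val_rev]; omega)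
    rw [frameCoord, dif_pos (Fin.rev i).2, Fin.eta] at h
    simpa using h
  · have h := h1 i hi
    rw [frameCoord, dif_pos i.2] at h
    simpa using h

theorem exists_isGood_interleaveFrames {σ : (E ⧸ V) →ₗ[ℂ] E} (hσ : V.mkQ ∘ₗ σ = LinearMap.id)
    (hr : ∀ i : Fin (4 + m), IsShuffle (finrank ℂ (E ⧸ V)) (shuffleSeq b i)) (hb : 2 ≤ b)
    (hV : finrank ℂ V = 4) (hE : finrank ℂ E = b + 4) :
    ∃ n e g, IsGood b (interleaveFrames hσ hr n e g) := by
  have hW : finrank ℂ (E ⧸ V) = b := by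
    have := Submodule.finrank_quotient_add_finrank V
    omega
  obtain ⟨e, n, he⟩ := exists_isModelFrames m ((finBasis ℂ V).reindex (finCongr hV))
  obtain ⟨g, hg⟩ := exists_transverse_frames (m := m) hW
  exact ⟨n, e, g, (he.isModelTuple hV hσ hr g hb hE hg).isGood⟩

end ModelInterleaved

/-! ### The fibration -/

section Partitions

theorem sum_rect {r n : ℕ} (hr : r ≤ n) (c : ℕ) : ∑ j ∈ Finset.range n, rect r c j = r * c := by
  simp only [rect, ← Finset.mem_range, ← Finset.sum_filter]
  rw [Finset.filter_mem_eq_inter, Finset.inter_eq_right.2 (Finset.range_mono hr),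
    Finset.sum_const, Finset.card_range, smul_eq_mul]

theorem sum_prependRows (r n c : ℕ) (p : ℕ → ℕ) :
    ∑ j ∈ Finset.range (r + n), prependRows r c p j = r * c + ∑ j ∈ Finset.range n, p j := by
  rw [Finset.sum_range_add]
  congr 1
  · rw [Finset.sum_congr rfl fun j hj => by rw [prependRows, if_pos (Finset.mem_range.1 hj)]]
    simp
  · simp [prependRows]

theorem sum_range_eq_of_antitone {p : ℕ → ℕ} (hp : Antitone p) {i j : ℕ} (h : p i = 0)
    (hij : i ≤ j) : ∑ k ∈ Finset.range j, p k = ∑ k ∈ Finset.range i, p k :=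
  (Finset.sum_subset (Finset.range_mono hij) fun _ _ hk =>
    eq_zero_of_antitone_of_le hp h (by simpa using hk)).symm

theorem isPartitionFor_prependRows {r c k n : ℕ} {p : ℕ → ℕ} (hp : Antitone p) (h0 : p 0 ≤ c)
    (hc : c ≤ n - k) (hr : r ≤ k) (hk : p (k - r) = 0) :
    IsPartitionFor k n (prependRows r c p) := by
  refine ⟨fun i j hij => ?_, ?_, ?_⟩
  · have hi : p (i - r) ≤ p 0 := hp (Nat.zero_le _)
    have hj : p (j - r) ≤ p (i - r) := hp (by omega)
    unfold prependRows
    split_ifs <;> omega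
  · unfold prependRows
    split_ifs
    · exact hc
    · exact (hp (Nat.zero_le _)).trans (h0.trans hc)
  · rw [prependRows, if_neg hr.not_gt, hk]

theorem isPartitionFor_rect_add {r c k n : ℕ} {p : ℕ → ℕ} (hp : Antitone p)
    (hc : c + p 0 ≤ n - k) (hr : r ≤ k) (hk : p k = 0) : IsPartitionFor k n (rect r c + p) := by
  refine ⟨fun i j hij => ?_, ?_, by simp [rect, hr, hk]⟩
  · have hij' : p j ≤ p i := hp hij
    simp only [Pi.add_apply, rect]
    split_ifs <;> omega
  · simp only [Pi.add_apply, rect]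
    split_ifs <;> omega

variable {a b m : ℕ} {κ ρ ν₃ ν₄ : ℕ → ℕ} {τ : Fin m → ℕ → ℕ}

theorem fiberBounds_of_isSchubertProblem (ha : 0 < a) (hab : a < b) (hκ : Antitone κ)
    (hκ₁ : κ 0 ≤ b - a - 1) (hρ : Antitone ρ) (hρₐ : ρ (a - 1) = 0)
    (hν : IsSchubertProblem a b (fiberProblem a b κ ρ ν₃ ν₄ τ)) :
    FiberBounds a b κ ρ ν₃ ν₄ τ := by
  obtain ⟨-, h, -⟩ := hν
  rw [forall_fin_four_add] at h
  simp only [fiberProblem, Fin.append_left, Fin.append_right, Matrix.cons_val] at h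
  obtain ⟨h₁, h₂, h₃, h₄, hτ⟩ := h
  refine ⟨ha, hab, hκ, hκ₁, ?_, hρ, fun ha1 => ?_, hρₐ, h₃, h₄, hτ⟩
  · have := h₁.2.2
    rwa [prependRows, if_neg (by omega)] at this
  · have := h₂.2.1
    rw [Pi.add_apply, rect, if_pos (by omega)] at this
    omega

namespace FiberBounds

variable (hB : FiberBounds a b κ ρ ν₃ ν₄ τ)

include hB

theorem ρ_zero_le : ρ 0 ≤ b - a := by
  rcases Nat.lt_or_ge 1 a with ha | ha
  · exact (Nat.le_succ _).trans (hB.ρ_zero ha)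
  · have hρ := hB.ρ_last
    rw [Nat.sub_eq_zero_of_le ha] at hρ
    exact hρ.le.trans (Nat.zero_le _)

theorem isPartitionFor_totalProblem (i : Fin (4 + m)) :
    IsPartitionFor (2 + a) (4 + b) (totalProblem a b κ ρ ν₃ ν₄ τ i) := by
  have hκ := hB.κ_zero
  have hρ := hB.ρ_zero_le
  have hab := hB.lt
  obtain ⟨hν₃, h₃, h₃'⟩ := hB.part₃
  obtain ⟨hν₄, h₄, h₄'⟩ := hB.part₄
  revert i
  rw [forall_fin_four_add]
  simp only [totalProblem, Fin.append_left, Fin.append_right, Matrix.cons_val]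
  refine ⟨isPartitionFor_prependRows hB.antitone_κ (by omega) (by omega) (by omega)
      (eq_zero_of_antitone_of_le hB.antitone_κ hB.κ_last (by omega)),
    isPartitionFor_rect_add hB.antitone_ρ (by omega) (by omega)
      (eq_zero_of_antitone_of_le hB.antitone_ρ hB.ρ_last (by omega)),
    isPartitionFor_prependRows hν₃ (by omega) (by omega) (by omega)
      (eq_zero_of_antitone_of_le hν₃ h₃' (by omega)),
    isPartitionFor_rect_add hν₄ (by omega) (by omega)
      (eq_zero_of_antitone_of_le hν₄ h₄' (by omega)),
    fun j => ?_⟩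
  obtain ⟨hτ, hj, hj'⟩ := hB.part j
  exact ⟨hτ, by omega, eq_zero_of_antitone_of_le hτ hj' (by omega)⟩

theorem sum_totalProblem :
    ∑ i, ∑ j ∈ Finset.range (2 + a), totalProblem a b κ ρ ν₃ ν₄ τ i j =
      ∑ i, ∑ j ∈ Finset.range a, fiberProblem a b κ ρ ν₃ ν₄ τ i j + (2 * b + 4) := by
  have ha := hB.pos
  have hab := hB.lt
  have hκ := sum_range_eq_of_antitone hB.antitone_κ hB.κ_last (Nat.sub_le a 1)
  have hρ := sum_range_eq_of_antitone hB.antitone_ρ hB.ρ_last (Nat.sub_le a 1)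
  have hρ' := sum_range_eq_of_antitone hB.antitone_ρ hB.ρ_last (by omega : a - 1 ≤ 2 + a)
  have hν₃ := sum_range_eq_of_antitone hB.part₃.1 hB.part₃.2.2 (Nat.le_add_left a 1)
  have hν₄ := sum_range_eq_of_antitone hB.part₄.1 hB.part₄.2.2 (Nat.le_add_left a 2)
  have hτ (j) := sum_range_eq_of_antitone (hB.part j).1 (hB.part j).2.2 (Nat.le_add_left a 2)
  have hfirst := sum_prependRows 1 (a - 1) (b - a - 1) κ
  rw [Nat.add_sub_cancel' ha] at hfirst
  have hthird := sum_prependRows 1 (1 + a) (b - a + 1) ν₃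
  rw [← add_assoc] at hthird
  simp only [Fin.sum_univ_add, Fin.sum_univ_four, fiberProblem, totalProblem, Fin.append_left,
    Fin.append_right, Matrix.cons_val, Pi.add_apply, Finset.sum_add_distrib, hτ]
  rw [sum_prependRows, hfirst, hthird, sum_rect (by omega), sum_rect (by omega),
    sum_rect (by omega), hκ, hρ', hρ, hν₃, hν₄]
  omega

theorem isSchubertProblem (hν : IsSchubertProblem a b (fiberProblem a b κ ρ ν₃ ν₄ τ)) :
    IsSchubertProblem (2 + a) (4 + b) (totalProblem a b κ ρ ν₃ ν₄ τ) := by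
  have hab := hB.lt
  refine ⟨by omega, hB.isPartitionFor_totalProblem, ?_⟩
  rw [hB.sum_totalProblem, ← hν.2.2]
  obtain ⟨c, rfl⟩ := Nat.exists_eq_add_of_lt hab
  rw [show 4 + (a + c + 1) - (2 + a) = c + 3 by omega, show a + c + 1 - a = c + 1 by omega]
  ring

end FiberBounds

end Partitions

section Fibration

variable {b m : ℕ}

/-- The instances whose flags are defined by good tuples of bases: the dense open set over which the
fibration is constructed. -/
def goodInstances (b m : ℕ) (E : Type*) [AddCommGroup E] [Module ℂ E] [FiniteDimensional ℂ E] :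
    Set (Fin (4 + m) → CompleteFlag E) :=
  {F | ∃ e ∈ {e : Frames (4 + m) E | IsGood b e}, frameFlags e = F}

variable {E : Type*} [AddCommGroup E] [Module ℂ E] [FiniteDimensional ℂ E]

theorem exists_isZariskiOpen_induced (hb : 2 ≤ b) (hE : finrank ℂ E = b + 4) (V : Submodule ℂ E)
    (hV : finrank ℂ V = 4) : ∃ B : Set (Fin 4 → CompleteFlag V), IsZariskiOpen B ∧ B.Nonempty ∧
      ∀ F' ∈ B, ∃ C : Set (Fin (4 + m) → CompleteFlag (E ⧸ V)), IsZariskiOpen C ∧ C.Nonempty ∧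
        ∀ G ∈ C, ∃ F ∈ goodInstances b m E,
          inducedOn b F (baseSpace b F) = ⟨V, F', fun _ => G⟩ := by
  obtain ⟨σ, hσ⟩ := V.mkQ.exists_rightInverse_of_surjective V.range_mkQ
  have hW : finrank ℂ (E ⧸ V) = b := by
    have := Submodule.finrank_quotient_add_finrank V
    omega
  have hr (i : Fin (4 + m)) : IsShuffle (finrank ℂ (E ⧸ V)) (shuffleSeq b i) :=
    hW ▸ isShuffle_shuffleSeq hb i
  obtain ⟨n, e₀, g₀, h₀⟩ := exists_isGood_interleaveFrames hσ hr hb hV hE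
  refine ⟨_, ((isFrameOpen_isGood b).preimage
    (isRegularVec_interleaveFrames_left hσ hr n g₀)).isZariskiOpen, ⟨_, e₀, h₀, rfl⟩, ?_⟩
  rintro _ ⟨e, he, rfl⟩
  refine ⟨_, ((isFrameOpen_isGood b).preimage
    (isRegularVec_interleaveFrames_right hσ hr n e)).isZariskiOpen, ⟨_, g₀, he, rfl⟩, ?_⟩
  rintro _ ⟨g, hg, rfl⟩
  exact ⟨_, ⟨_, hg, rfl⟩,
    inducedOn_interleaveFrames hσ hr n e g hb hV hW (IsGood.isTransverse hg hE)⟩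

theorem goodInstances_nonempty (hb : 2 ≤ b) (hE : finrank ℂ E = b + 4) :
    (goodInstances b m E).Nonempty := by
  obtain ⟨V, hV⟩ : ∃ V : Submodule ℂ E, finrank ℂ V = 4 :=
    ⟨(CompleteFlag.ofBasis (finBasis ℂ E)).space 4, by rw [CompleteFlag.finrank_space, hE]; omega⟩
  obtain ⟨B, -, ⟨F', hF'⟩, hB⟩ := exists_isZariskiOpen_induced (m := m) hb hE V hV
  obtain ⟨C, -, ⟨G, hG⟩, hC⟩ := hB F' hF'
  obtain ⟨F, hF, -⟩ := hC G hG
  exact ⟨F, hF⟩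

theorem FiberBounds.isFiberedOver {a : ℕ} {κ ρ ν₃ ν₄ : ℕ → ℕ} {τ : Fin m → ℕ → ℕ}
    (hB : FiberBounds a b κ ρ ν₃ ν₄ τ) :
    IsFiberedOver 2 4 a b (totalProblem a b κ ρ ν₃ ν₄ τ) (fun _ : Fin 4 => rect 1 1)
      (fiberProblem a b κ ρ ν₃ ν₄ τ) := by
  have hb : 2 ≤ b := lt_of_le_of_lt (Nat.succ_le_of_lt hB.pos) hB.lt
  have hE : finrank ℂ (Fin (4 + b) → ℂ) = b + 4 := by simp [add_comm]
  refine ⟨goodInstances b m _, fun F => inducedOn b F (baseSpace b F),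
    (isFrameOpen_isGood b).isZariskiOpen, goodInstances_nonempty hb hE, ?_, fun V hV => ?_⟩
  · rintro _ ⟨e, he, rfl⟩
    have hF := IsGood.isGeneric he hE hb
    refine ⟨hF.finrank_baseSpace, fun H hH => hF.comap_mem_solutions_base hB hH, ?_,
      hF.bijOn_solutions hB⟩
    rintro _ - H hH rfl
    exact hF.map_mem_solutions_fiber hB hH
  · obtain ⟨B, hBopen, hBne, hbase⟩ := exists_isZariskiOpen_induced (m := m) hb hE V hV
    refine ⟨B, hBopen, hBne, fun F' hF' => ?_⟩
    obtain ⟨C, hCopen, ⟨G₀, hG₀⟩, hfiber⟩ := hbase F' hF'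
    refine ⟨?_, fun h _ => ⟨C, hCopen, ⟨G₀, hG₀⟩, fun G hG => ?_⟩⟩
    · obtain ⟨F, hF, hind⟩ := hfiber G₀ hG₀
      exact ⟨F, hF, _, hind⟩
    · obtain ⟨F, hF, hind⟩ := hfiber G hG
      exact ⟨F, hF, _, hind, rfl⟩

end Fibration

end

theorem theorem3p7 (a b m : ℕ) (ha : 0 < a) (hab : a < b)
    (κ ρ ν₃ ν₄ : ℕ → ℕ) (τ : Fin m → ℕ → ℕ)
    (hκ : IsPartition κ) (hκ₁ : κ 0 ≤ b - a - 1)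
    (hρ : IsPartition ρ) (hρₐ : ρ (a - 1) = 0)
    (hν : IsSchubertProblem a b
      (Fin.append ![prependRows 1 (b - a - 1) κ, rect (a - 1) 1 + ρ, ν₃, ν₄] τ)) :
    IsSchubertProblem (2 + a) (4 + b)
      (Fin.append ![prependRows 2 (b - a) κ, rect a 2 + ρ,
        prependRows 1 (b - a + 1) ν₃, rect (a + 1) 1 + ν₄] τ) ∧
    IsFiberedOver 2 4 a b
      (Fin.append ![prependRows 2 (b - a) κ, rect a 2 + ρ,
        prependRows 1 (b - a + 1) ν₃, rect (a + 1) 1 + ν₄] τ)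
      (fun _ : Fin 4 => rect 1 1)
      (Fin.append ![prependRows 1 (b - a - 1) κ, rect (a - 1) 1 + ρ, ν₃, ν₄] τ) := by
  have hB := fiberBounds_of_isSchubertProblem ha hab hκ.1 hκ₁ hρ.1 hρₐ hν
  exact ⟨hB.isSchubertProblem hν, hB.isFiberedOver⟩
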